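/- All graphs are finite and simple; multigraphs are finite and loopless. A subdivision of a multigraph $H$ is a (simple) graph obtained from $H$ by replacing each edge $uv$ by a path of length at least one joining $u,v$, these paths being vertex-disjoint except for their ends. A graph is $J$-subdivision-free if no induced subgraph of it is a subdivision of $J$. An ideal is a class of graphs closed under taking induced subgraphs (and under isomorphism). An ideal $\mathcal C$ is colourable if there exists $k$ such that $\chi(G)\le k$ for all $G\in\mathcal C$. For an integer $\rho\ge 0$, the ideal $\mathcal C$ is $\rho$-bounded if there exists $\tau$ such that for every $G\in\mathcal C$ and every vertex $v$ of $G$, the subgraph of $G$ induced on the vertices at distance at most $\rho$ from $v$ has chromatic number at most $\tau$. A multigraph $H$ is widespread if for every subdivision $J$ of $H$ and every integer $\kappa\ge 0$ there exists an integer $\rho\ge 0$ such that every $\rho$-bounded ideal of $J$-subdivision-free graphs with clique number at most $\kappa$ is colourable. Theorem. Let $k\ge 4$, and let $H$ be a multigraph obtained from a path with vertices $v_1,\ldots,v_k$ in order by replacing each edge $v_iv_{i+1}$ $(1\le i\le k-1)$ by some nonempty set of parallel edges joining $v_i,v_{i+1}$ (the sets for different $i$ may have different sizes), and then adding two new vertices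 $a,b$ and five new edges $av_1,\ av_2,\ bv_{k-1},\ bv_k,\ ab$. Then $H$ is widespread. -/

import Mathlib

open scoped Graph

/-- A finite simple graph. Every finite graph is isomorphic to one whose vertices form a type
in `Type`. -/
structure FiniteGraph where
  /-- The vertices. -/
  V : Type
  /-- There are finitely many vertices. -/
  finite : Finite V
  /-- The underlying simple graph. -/
  graph : SimpleGraph V

/-- A presentation of the simple graph `J` as a subdivision of the loopless multigraph `H`:
each edge `e` of `H`, with ends `src e` and `tgt e`, is replaced by a path `path e` of `J`
(of length at least one, since `H` has no loops and `branch` is injective), different paths share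
no edges and no vertices except common ends, and `J` has no further vertices or edges. -/
structure SubdivisionModel {α β V : Type*} (H : Graph α β) (J : SimpleGraph V) where
  /-- The vertex of `J` that represents a vertex of `H`. -/
  branch : V(H) → V
  /-- One end of an edge of `H`. -/
  src : E(H) → V(H)
  /-- The other end of an edge of `H`. -/
  tgt : E(H) → V(H)
  isLink : ∀ e : E(H), H.IsLink e (src e) (tgt e)
  /-- The path of `J` that replaces an edge of `H`. -/
  path : ∀ e : E(H), J.Walk (branch (src e)) (branch (tgt e))
  branch_injective : Function.Injective branch
  isPath : ∀ e, (path e).IsPath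
  /-- A path meets the branch vertices only in its ends. -/
  inc_of_branch_mem : ∀ (e : E(H)) (x : V(H)), branch x ∈ (path e).support → H.Inc e x
  /-- Two different paths meet only in common ends. -/
  exists_of_mem_mem : ∀ e f : E(H), e ≠ f → ∀ w, w ∈ (path e).support → w ∈ (path f).support →
    ∃ x : V(H), branch x = w
  /-- Two different paths share no edge. This matters for parallel edges: at most one
  edge of a parallel class may be replaced by a path of length one. -/
  edges_disjoint : ∀ e f : E(H), e ≠ f → ∀ d, d ∈ (path e).edges → d ∉ (path f).edges
  vertex_covered : ∀ w, (∃ x, branch x = w) ∨ ∃ e, w ∈ (path e).support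
  edge_covered : ∀ d ∈ J.edgeSet, ∃ e, d ∈ (path e).edges

/-- The graph `J` is a subdivision of the loopless multigraph `H`. -/
def IsSubdivision {α β V : Type*} (H : Graph α β) (J : SimpleGraph V) : Prop :=
  Nonempty (SubdivisionModel H J)

/-- No induced subgraph of `G` is a subdivision of the graph `J`. -/
def SubdivisionFree {W V : Type*} (J : SimpleGraph W) (G : SimpleGraph V) : Prop :=
  ∀ S : Set V, ¬ IsSubdivision (Graph.ofSimpleGraph J) (G.induce S)

/-- The maximum over all vertices `v` of the chromatic number of the subgraph induced on the
vertices at distance at most `ρ` from `v`; it is zero for the null graph. -/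
noncomputable def ballChromaticNumber {V : Type*} (ρ : ℕ) (G : SimpleGraph V) : ℕ∞ :=
  ⨆ v : V, (G.induce {w | G.edist v w ≤ ρ}).chromaticNumber

/-- A class of finite graphs is an ideal if it is closed under taking induced subgraphs
(and isomorphic copies of them). -/
def IsIdeal (C : Set FiniteGraph) : Prop :=
  ∀ G H : FiniteGraph, Nonempty (G.graph ↪g H.graph) → H ∈ C → G ∈ C

/-- The chromatic numbers of the members of `C` are bounded. -/
def IsColourable (C : Set FiniteGraph) : Prop :=
  ∃ k : ℕ, ∀ G ∈ C, G.graph.chromaticNumber ≤ k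

/-- The chromatic numbers of the balls of radius `ρ` in the members of `C` are bounded. -/
def IsBallBounded (ρ : ℕ) (C : Set FiniteGraph) : Prop :=
  ∃ τ : ℕ, ∀ G ∈ C, ballChromaticNumber ρ G.graph ≤ τ

/-- A (finite loopless) multigraph `H` is widespread if for every subdivision `J` of `H` and all
`κ` there exists `ρ` such that every `ρ`-bounded ideal of `J`-subdivision-free graphs with
clique number at most `κ` is colourable. -/
def Widespread {α β : Type*} (H : Graph α β) : Prop :=
  ∀ J : FiniteGraph, IsSubdivision H J.graph → ∀ κ : ℕ, ∃ ρ : ℕ, ∀ C : Set FiniteGraph,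
    IsIdeal C → IsBallBounded ρ C →
    (∀ G ∈ C, SubdivisionFree J.graph G.graph ∧ G.graph.cliqueNum ≤ κ) → IsColourable C

/-- Vertices of the multigraph `fatPathWithEars`: the vertices `v 0, …, v (k - 1)` of a path, and
two more vertices `a`, `b`. -/
inductive EarVertex (k : ℕ) : Type
  | v (i : Fin k)
  | a
  | b

/-- Edges of the multigraph `fatPathWithEars`: for each edge `i` of the path a set of `m i`
parallel edges, and five more edges. -/
inductive EarEdge (k : ℕ) (m : Fin (k - 1) → ℕ) : Type
  | path (i : Fin (k - 1)) (j : Fin (m i))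
  | aFirst
  | aSecond
  | bPenultimate
  | bLast
  | ab

/-- The ends of the edges of `fatPathWithEars`. -/
def EarEdge.ends {k : ℕ} (hk : 4 ≤ k) {m : Fin (k - 1) → ℕ} : EarEdge k m → Sym2 (EarVertex k)
  | .path i _ => s(.v ⟨i, by omega⟩, .v ⟨i + 1, by omega⟩)
  | .aFirst => s(.a, .v ⟨0, by omega⟩)
  | .aSecond => s(.a, .v ⟨1, by omega⟩)
  | .bPenultimate => s(.b, .v ⟨k - 2, by omega⟩)
  | .bLast => s(.b, .v ⟨k - 1, by omega⟩)
  | .ab => s(.a, .b)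

/-- The multigraph obtained from a path with `k ≥ 4` vertices by replacing its `i`-th edge by
`m i` parallel edges, and adding two vertices `a`, `b`, two edges joining `a` to the first two
vertices of the path, two edges joining `b` to its last two vertices, and an edge `ab`. -/
def fatPathWithEars (k : ℕ) (hk : 4 ≤ k) (m : Fin (k - 1) → ℕ) :
    Graph (EarVertex k) (EarEdge k m) where
  vertexSet := Set.univ
  edgeSet := Set.univ
  IsLink e x y := e.ends hk = s(x, y)
  isLink_symm _ _ := ⟨fun _ _ h => h.trans Sym2.eq_swap⟩
  eq_or_eq_of_isLink_of_isLink _ x y v w h h' := by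
    have h2 : s(x, y) = s(v, w) := h.symm.trans h'
    rcases Sym2.eq_iff.1 h2 with h3 | h3
    · exact Or.inl h3.1
    · exact Or.inr h3.1
  edge_mem_iff_exists_isLink e := by
    refine ⟨fun _ => ?_, fun _ => Set.mem_univ e⟩
    induction h : e.ends hk with
    | _ x y => exact ⟨x, y, rfl⟩
  left_mem_of_isLink _ _ _ _ := Set.mem_univ _

/-! Let `l` be the number of vertices of the given subdivision `J` of `H`, and let the radius be `4
* l + 50`. It suffices to find, in every graph of huge chromatic number whose balls of that radius
are `τ`-colourable, an induced subdivision of `H` all of whose paths have length at least `l`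
(`Realizes`). Such a subdivision is also a subdivision of `J`, because each of its paths is long
enough to subdivide the corresponding path of `J` (`Realizes.exists_isSubdivision`). Bounded balls
are cheap to delete, so points can always be chosen far apart, and their labels (chosen neighbours)
then do not interfere with each other.

Breadth-first search gives a level of large chromatic number in which each point `p` has a label `c
p` one level lower, and all labels are attached to a connected set of lower vertices
(`exists_levelling`). A dichotomy for these labels is iterated in `wins_of_wins_succ`.

Suppose first that on some large subset the labels are touch-bounded: a connected set touches the
labels of only a boundedly chromatic set of points anticomplete to it. A levelling inside that
subset then produces a connected set which, after a cheap deletion, no old label touches. This adds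
one private type of labels (`PrivateTypes.exists_succ`). Once there are `τ` times as many types as
edges of `H`, each edge can be routed through a type of its own (`PrivateTypes.exists_realizes`).

Otherwise every large subset contains a connected set and a still large set, anticomplete to it,
whose labels all touch it (`IsScale`). Repetition gives many anticomplete connected sets that all
remaining labels touch (`IsScale.exists_group`). Shortest walks through them yield the parallel
links of the fat path. To protect these links from labels used later, `exists_split` separates a
near part, which supplies the next point, from a far part, which supplies the rest
(`IsScale.exists_tail`). The triangle at each end comes from the cluster lemma `exists_isCluster`:
among the points of a large set attached to a connected set there are three far ones, each two of
which can be joined away from the label of the third. The edge `ab` runs through the levels below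
the labels (`IsEarPath.exists_realizes`). -/

/-! ### Walks, colourings of subsets, shortest walks, and splitting by thresholds. -/

section Basics

variable {V : Type*} {G : SimpleGraph V}

/-- There is a walk of length at most `r` from `u` to `v`. -/
def Near (G : SimpleGraph V) (r : ℕ) (u v : V) : Prop := ∃ p : G.Walk u v, p.length ≤ r

theorem Near.refl (r : ℕ) (u : V) : Near G r u u := ⟨.nil, by simp⟩

theorem Near.symm {r : ℕ} {u v : V} (h : Near G r u v) : Near G r v u := by
  obtain ⟨p, hp⟩ := h
  exact ⟨p.reverse, by simpa using hp⟩

theorem Near.trans {r s : ℕ} {u v w : V} (h : Near G r u v) (h' : Near G s v w) :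
    Near G (r + s) u w := by
  obtain ⟨p, hp⟩ := h
  obtain ⟨q, hq⟩ := h'
  exact ⟨p.append q, by rw [SimpleGraph.Walk.length_append]; omega⟩

theorem Near.mono {r s : ℕ} {u v : V} (h : Near G r u v) (hrs : r ≤ s) : Near G s u v := by
  obtain ⟨p, hp⟩ := h
  exact ⟨p, hp.trans hrs⟩

theorem SimpleGraph.Adj.near {u v : V} (h : G.Adj u v) : Near G 1 u v :=
  ⟨h.toWalk, by simp⟩

/-- The set `S` can be properly coloured with `n` colours. -/
def Col (G : SimpleGraph V) (S : Set V) (n : ℕ) : Prop :=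
  ∃ f : V → ℕ, (∀ v ∈ S, f v < n) ∧ ∀ u ∈ S, ∀ v ∈ S, G.Adj u v → f u ≠ f v

theorem Col.mono {S T : Set V} {m n : ℕ} (h : Col G T m) (hST : S ⊆ T) (hmn : m ≤ n) :
    Col G S n := by
  obtain ⟨f, h1, h2⟩ := h
  exact ⟨f, fun v hv => (h1 v (hST hv)).trans_le hmn,
    fun u hu v hv => h2 u (hST hu) v (hST hv)⟩

theorem Col.union {S T : Set V} {m n : ℕ} (h : Col G S m) (h' : Col G T n) :
    Col G (S ∪ T) (m + n) := by
  classical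
  obtain ⟨f, h1, h2⟩ := h
  obtain ⟨g, h3, h4⟩ := h'
  refine ⟨fun v => if v ∈ S then f v else m + g v, fun v hv => ?_, fun u hu v hv huv => ?_⟩
  · by_cases hS : v ∈ S
    · simpa [hS] using (h1 v hS).trans_le (by omega)
    · have := h3 v (hv.resolve_left hS)
      simpa [hS] using this
  · by_cases hu' : u ∈ S <;> by_cases hv' : v ∈ S
    · simpa [hu', hv'] using h2 u hu' v hv' huv
    · have := h1 u hu'
      simp only [hu', hv', if_true, if_false]; omega
    · have := h1 v hv'
      simp only [hu', hv', if_true, if_false]; omega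
    · have := h4 u (hu.resolve_left hu') v (hv.resolve_left hv') huv
      simp only [hu', hv', if_false]; omega

theorem Col.empty (n : ℕ) : Col G ∅ n := ⟨fun _ => 0, by simp, by simp⟩

/-- A set that is not colourable stays so after removing a set of small chromatic number. -/
theorem not_col_diff {S Z : Set V} {m n : ℕ} (h : ¬ Col G S (m + n)) (hZ : Col G Z n) :
    ¬ Col G (S \ Z) m := fun h' =>
  h ((h'.union hZ).mono (fun x hx => by
    by_cases hxZ : x ∈ Z
    · exact Or.inr hxZ
    · exact Or.inl ⟨hx, hxZ⟩) le_rfl)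

theorem nonempty_of_not_col {S : Set V} {n : ℕ} (h : ¬ Col G S n) : S.Nonempty := by
  by_contra h'
  rw [Set.not_nonempty_iff_eq_empty] at h'
  exact h (h' ▸ Col.empty n)

theorem col_biUnion {ι : Type*} (s : Finset ι) (Z : ι → Set V) {n : ℕ}
    (h : ∀ i ∈ s, Col G (Z i) n) : Col G {v | ∃ i ∈ s, v ∈ Z i} (s.card * n) := by
  classical
  induction s using Finset.induction_on with
  | empty => exact (Col.empty _).mono (by simp) le_rfl
  | insert a s ha ih =>
    have h1 := ih fun i hi => h i (Finset.mem_insert_of_mem hi)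
    refine ((h a (Finset.mem_insert_self _ _)).union h1).mono ?_ ?_
    · rintro v ⟨i, hi, hv⟩
      rcases Finset.mem_insert.1 hi with rfl | hi
      · exact Or.inl hv
      · exact Or.inr ⟨i, hi, hv⟩
    · rw [Finset.card_insert_of_notMem ha]; ring_nf; omega

/-- There is a walk from `a` to `b` inside `Z`. -/
def Conn (G : SimpleGraph V) (Z : Set V) (a b : V) : Prop :=
  ∃ p : G.Walk a b, ∀ v ∈ p.support, v ∈ Z

theorem Conn.refl {Z : Set V} {a : V} (h : a ∈ Z) : Conn G Z a a := ⟨.nil, by simpa using h⟩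

theorem Conn.symm {Z : Set V} {a b : V} (h : Conn G Z a b) : Conn G Z b a := by
  obtain ⟨p, hp⟩ := h
  exact ⟨p.reverse, by simpa using hp⟩

theorem Conn.trans {Z : Set V} {a b c : V} (h : Conn G Z a b) (h' : Conn G Z b c) :
    Conn G Z a c := by
  obtain ⟨p, hp⟩ := h
  obtain ⟨q, hq⟩ := h'
  refine ⟨p.append q, fun v hv => ?_⟩
  rcases SimpleGraph.Walk.mem_support_append_iff _ _ |>.1 hv with hv | hv
  exacts [hp v hv, hq v hv]

theorem Conn.mono {Z Z' : Set V} {a b : V} (h : Conn G Z a b) (hZ : Z ⊆ Z') : Conn G Z' a b := by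
  obtain ⟨p, hp⟩ := h
  exact ⟨p, fun v hv => hZ (hp v hv)⟩

theorem Conn.left_mem {Z : Set V} {a b : V} (h : Conn G Z a b) : a ∈ Z := by
  obtain ⟨p, hp⟩ := h
  exact hp _ p.start_mem_support

theorem Conn.right_mem {Z : Set V} {a b : V} (h : Conn G Z a b) : b ∈ Z := h.symm.left_mem

theorem Conn.of_adj {Z : Set V} {a b : V} (h : G.Adj a b) (ha : a ∈ Z) (hb : b ∈ Z) :
    Conn G Z a b := ⟨h.toWalk, by
      intro v hv
      simp at hv
      rcases hv with rfl | rfl <;> assumption⟩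

/-- `X` is nonempty and connected. -/
def IsConn (G : SimpleGraph V) (X : Set V) : Prop :=
  X.Nonempty ∧ ∀ a ∈ X, ∀ b ∈ X, Conn G X a b

/-- `A` and `B` are disjoint and there are no edges between them. -/
def Anti (G : SimpleGraph V) (A B : Set V) : Prop := ∀ a ∈ A, ∀ b ∈ B, a ≠ b ∧ ¬ G.Adj a b

theorem Anti.symm {A B : Set V} (h : Anti G A B) : Anti G B A :=
  fun b hb a ha => ⟨(h a ha b hb).1.symm, fun h' => (h a ha b hb).2 h'.symm⟩

theorem Anti.mono {A B A' B' : Set V} (h : Anti G A B) (hA : A' ⊆ A) (hB : B' ⊆ B) :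
    Anti G A' B' := fun a ha b hb => h a (hA ha) b (hB hb)

/-- `I` is the set of interior vertices of an induced path of length at least `l`
from `x` to `y`. -/
def Link (G : SimpleGraph V) (l : ℕ) (x y : V) (I : Set V) : Prop :=
  ∃ (n : ℕ) (f : ℕ → V), l ≤ n ∧ f 0 = x ∧ f n = y ∧
    (∀ i ≤ n, ∀ j ≤ n, f i = f j → i = j) ∧
    (∀ i ≤ n, ∀ j ≤ n, G.Adj (f i) (f j) ↔ i + 1 = j ∨ j + 1 = i) ∧
    I = {v | ∃ i, 0 < i ∧ i < n ∧ v = f i}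

theorem Link.symm {l : ℕ} {x y : V} {I : Set V} (h : Link G l x y I) : Link G l y x I := by
  obtain ⟨n, f, hl, h0, hn, hinj, hadj, rfl⟩ := h
  refine ⟨n, fun i => f (n - i), hl, by simpa using hn, by simpa using h0, ?_, ?_, ?_⟩
  · intro i hi j hj h
    have := hinj _ (Nat.sub_le _ _) _ (Nat.sub_le _ _) h
    omega
  · intro i hi j hj
    rw [hadj _ (Nat.sub_le _ _) _ (Nat.sub_le _ _)]
    omega
  · ext v
    constructor
    · rintro ⟨i, h1, h2, rfl⟩
      exact ⟨n - i, by omega, by omega, by congr 1; omega⟩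
    · rintro ⟨i, h1, h2, rfl⟩
      exact ⟨n - i, by omega, by omega, rfl⟩

/-- A shortest walk from `A` to `B` inside `Z`, with its vertices in order. -/
structure IsGeod (G : SimpleGraph V) (Z A B : Set V) (n : ℕ) (f : ℕ → V) : Prop where
  mem : ∀ i ≤ n, f i ∈ Z
  zero : f 0 ∈ A
  last : f n ∈ B
  adj : ∀ i < n, G.Adj (f i) (f (i + 1))
  min : ∀ a ∈ A, ∀ b ∈ B, ∀ p : G.Walk a b, (∀ v ∈ p.support, v ∈ Z) → n ≤ p.length

/-- The walk along a sequence of consecutively adjacent vertices. -/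
theorem exists_walk_of_seq {n : ℕ} {f : ℕ → V} (hf : ∀ i < n, G.Adj (f i) (f (i + 1))) :
    ∀ i j, i ≤ j → j ≤ n → ∃ p : G.Walk (f i) (f j), p.length = j - i ∧
      (∀ v, v ∈ p.support ↔ ∃ t, i ≤ t ∧ t ≤ j ∧ v = f t) ∧
      (∀ d, d ∈ p.edges ↔ ∃ t, i ≤ t ∧ t < j ∧ d = s(f t, f (t + 1))) ∧
      ((∀ s t, s ≤ j → t ≤ j → f s = f t → s = t) → p.IsPath) := by
  intro i j hij
  induction j, hij using Nat.le_induction with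
  | base =>
    intro _
    refine ⟨.nil, by simp, fun v => ?_, fun d => ?_, fun _ => .nil⟩
    · simp only [SimpleGraph.Walk.support_nil, List.mem_singleton]
      constructor
      · rintro rfl; exact ⟨i, le_rfl, le_rfl, rfl⟩
      · rintro ⟨t, h1, h2, rfl⟩
        rw [le_antisymm h2 h1]
    · simp only [SimpleGraph.Walk.edges_nil, List.not_mem_nil, false_iff]
      rintro ⟨t, h1, h2, -⟩
      omega
  | succ j hij ih =>
    intro hj
    obtain ⟨p, h1, h2, h3, h4⟩ := ih (by omega)
    refine ⟨p.concat (hf j (by omega)), by rw [SimpleGraph.Walk.length_concat, h1]; omega,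
      fun v => ?_, fun d => ?_, fun hinj => (h4 fun s t hs ht => hinj s t (by omega)
        (by omega)).concat (fun hm => ?_) _⟩
    · rw [SimpleGraph.Walk.support_concat, List.mem_append, List.mem_singleton, h2]
      constructor
      · rintro (⟨t, h4, h5, rfl⟩ | rfl)
        · exact ⟨t, h4, by omega, rfl⟩
        · exact ⟨j + 1, by omega, le_rfl, rfl⟩
      · rintro ⟨t, h4, h5, rfl⟩
        rcases Nat.lt_or_ge t (j + 1) with h | h
        · exact Or.inl ⟨t, h4, by omega, rfl⟩
        · exact Or.inr (by rw [le_antisymm h5 h])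
    · rw [SimpleGraph.Walk.edges_concat, List.concat_eq_append, List.mem_append, List.mem_singleton, h3]
      constructor
      · rintro (⟨t, h4, h5, rfl⟩ | rfl)
        · exact ⟨t, h4, by omega, rfl⟩
        · exact ⟨j, by omega, by omega, rfl⟩
      · rintro ⟨t, h4, h5, rfl⟩
        rcases Nat.lt_or_ge t j with h | h
        · exact Or.inl ⟨t, h4, by omega, rfl⟩
        · exact Or.inr (by rw [show t = j by omega])
    · obtain ⟨t, -, ht, h⟩ := (h2 _).1 hm
      have := hinj _ _ le_rfl (by omega) h
      omega

theorem exists_isGeod {Z A B : Set V} {a b : V} (ha : a ∈ A) (hb : b ∈ B) (h : Conn G Z a b) :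
    ∃ n f, IsGeod G Z A B n f := by
  classical
  have hex : ∃ n, ∃ a ∈ A, ∃ b ∈ B, ∃ p : G.Walk a b, (∀ v ∈ p.support, v ∈ Z) ∧ p.length = n := by
    obtain ⟨p, hp⟩ := h
    exact ⟨_, a, ha, b, hb, p, hp, rfl⟩
  obtain ⟨a', ha', b', hb', p, hp, hlen⟩ := Nat.find_spec hex
  refine ⟨Nat.find hex, p.getVert, fun i _ => hp _ (p.getVert_mem_support i), ?_, ?_, ?_, ?_⟩
  · rwa [SimpleGraph.Walk.getVert_zero]
  · rw [← hlen, SimpleGraph.Walk.getVert_length]; exact hb'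
  · intro i hi
    exact p.adj_getVert_succ (by omega)
  · intro x hx y hy q hq
    exact Nat.find_min' hex ⟨x, hx, y, hy, q, hq, rfl⟩

namespace IsGeod

variable {Z A B : Set V} {n : ℕ} {f : ℕ → V}

theorem length_unique {m : ℕ} {g : ℕ → V} (h : IsGeod G Z A B n f) (h' : IsGeod G Z A B m g) :
    n = m := by
  have key : ∀ {n m : ℕ} {f g : ℕ → V}, IsGeod G Z A B n f → IsGeod G Z A B m g → n ≤ m := by
    intro n m f g h h'
    obtain ⟨p, h1, h2, -⟩ := exists_walk_of_seq h'.adj 0 m (Nat.zero_le _) le_rfl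
    have := h.min _ h'.zero _ h'.last p (fun v hv => by
      obtain ⟨t, -, ht, rfl⟩ := (h2 v).1 hv
      exact h'.mem t ht)
    omega
  exact le_antisymm (key h h') (key h' h)

theorem conn (h : IsGeod G Z A B n f) {i j : ℕ} (hij : i ≤ j) (hj : j ≤ n) :
    Conn G {v | ∃ t, i ≤ t ∧ t ≤ j ∧ v = f t} (f i) (f j) := by
  obtain ⟨p, -, h2, -⟩ := exists_walk_of_seq h.adj i j hij hj
  exact ⟨p, fun v hv => (h2 v).1 hv⟩

/-- A vertex of a set `B'` appears on a shortest walk no earlier than the distance to `B'`. -/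
theorem le_of_mem {B' : Set V} {m : ℕ} {g : ℕ → V} (h : IsGeod G Z A B n f)
    (h' : IsGeod G Z A B' m g) {i : ℕ} (hi : i ≤ n) (hm : f i ∈ B') : m ≤ i := by
  obtain ⟨p, h1, h2, -⟩ := exists_walk_of_seq h.adj 0 i (Nat.zero_le _) hi
  have := h'.min _ h.zero _ hm p (fun v hv => by
    obtain ⟨t, -, ht, rfl⟩ := (h2 v).1 hv
    exact h.mem t (by omega))
  omega

theorem notMem_source (h : IsGeod G Z A B n f) {i : ℕ} (hi : i ≤ n) (hi0 : 0 < i) :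
    f i ∉ A := by
  intro hA
  obtain ⟨p, h1, h2, -⟩ := exists_walk_of_seq h.adj i n hi le_rfl
  have := h.min _ hA _ h.last p (fun v hv => by
    obtain ⟨t, -, ht, rfl⟩ := (h2 v).1 hv
    exact h.mem t (by omega))
  omega

theorem notMem_target (h : IsGeod G Z A B n f) {i : ℕ} (hi : i < n) : f i ∉ B := by
  intro hB
  have := h.le_of_mem h hi.le hB
  omega

/-- A shortest walk to `B` avoids every disjoint set that is at least as far as `B`. -/
theorem notMem_of_le {B' : Set V} {m : ℕ} {g : ℕ → V} (h : IsGeod G Z A B n f)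
    (h' : IsGeod G Z A B' m g) (hnm : n ≤ m) (hd : Disjoint B B') {i : ℕ} (hi : i ≤ n) :
    f i ∉ B' := by
  intro hm
  have h1 := h.le_of_mem h' hi hm
  obtain rfl : i = n := by omega
  exact Set.disjoint_left.1 hd h.last hm

theorem le_add_one_of_adj (h : IsGeod G Z A B n f) {i j : ℕ} (hi : i ≤ n) (hj : j ≤ n)
    (hij : G.Adj (f i) (f j)) : j ≤ i + 1 := by
  obtain ⟨p, h1, h2, -⟩ := exists_walk_of_seq h.adj 0 i (Nat.zero_le _) hi
  obtain ⟨q, h3, h4, -⟩ := exists_walk_of_seq h.adj j n hj le_rfl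
  have := h.min _ h.zero _ h.last (p.append (.cons hij q)) (fun v hv => by
    rcases SimpleGraph.Walk.mem_support_append_iff _ _ |>.1 hv with hv | hv
    · obtain ⟨t, -, ht, rfl⟩ := (h2 v).1 hv
      exact h.mem t (by omega)
    · rw [SimpleGraph.Walk.support_cons, List.mem_cons] at hv
      rcases hv with rfl | hv
      · exact h.mem i hi
      · obtain ⟨t, -, ht, rfl⟩ := (h4 v).1 hv
        exact h.mem t (by omega))
  rw [SimpleGraph.Walk.length_append, SimpleGraph.Walk.length_cons] at this
  omega

theorem injOn (h : IsGeod G Z A B n f) {i j : ℕ} (hi : i ≤ n) (hj : j ≤ n)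
    (hij : f i = f j) : i = j := by
  have key : ∀ {i j : ℕ}, i ≤ n → j ≤ n → f i = f j → j ≤ i := by
    intro i j hi hj hij
    obtain ⟨p, h1, h2, -⟩ := exists_walk_of_seq h.adj 0 i (Nat.zero_le _) hi
    obtain ⟨q, h3, h4, -⟩ := exists_walk_of_seq h.adj j n hj le_rfl
    have := h.min _ h.zero _ h.last (p.append (q.copy hij.symm rfl)) (fun v hv => by
      rcases SimpleGraph.Walk.mem_support_append_iff _ _ |>.1 hv with hv | hv
      · obtain ⟨t, -, ht, rfl⟩ := (h2 v).1 hv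
        exact h.mem t (by omega)
      · rw [SimpleGraph.Walk.support_copy] at hv
        obtain ⟨t, -, ht, rfl⟩ := (h4 v).1 hv
        exact h.mem t (by omega))
    rw [SimpleGraph.Walk.length_append, SimpleGraph.Walk.length_copy] at this
    omega
  exact le_antisymm (key hj hi hij.symm) (key hi hj hij)

theorem adj_iff (h : IsGeod G Z A B n f) {i j : ℕ} (hi : i ≤ n) (hj : j ≤ n) :
    G.Adj (f i) (f j) ↔ i + 1 = j ∨ j + 1 = i := by
  constructor
  · intro hij
    have h1 := h.le_add_one_of_adj hi hj hij
    have h2 := h.le_add_one_of_adj hj hi hij.symm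
    have h3 : i ≠ j := by rintro rfl; exact G.irrefl hij
    omega
  · rintro (rfl | rfl)
    · exact h.adj i (by omega)
    · exact (h.adj j (by omega)).symm

end IsGeod

/-- Two vertices that are connected inside `Z` and not near are joined by a link in `Z`. -/
theorem exists_link {Z : Set V} {l : ℕ} {x y : V} (h : Conn G Z x y) (hxy : ¬ Near G l x y) :
    ∃ I : Set V, I ⊆ Z \ {x, y} ∧ Link G l x y I := by
  obtain ⟨n, f, hf⟩ := exists_isGeod (A := {x}) (B := {y}) rfl rfl h
  have h0 : f 0 = x := hf.zero
  have hn : f n = y := hf.last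
  refine ⟨_, ?_, n, f, ?_, h0, hn, fun i hi j hj => hf.injOn hi hj,
    fun i hi j hj => hf.adj_iff hi hj, rfl⟩
  · rintro v ⟨i, h1, h2, rfl⟩
    refine ⟨hf.mem i h2.le, ?_⟩
    rintro (h | h)
    · have := hf.injOn h2.le (Nat.zero_le _) (h.trans h0.symm)
      omega
    · have := hf.injOn h2.le le_rfl (h.trans hn.symm)
      omega
  · by_contra hlt
    subst h0 hn
    obtain ⟨p, h1, -⟩ := exists_walk_of_seq hf.adj 0 n (Nat.zero_le _) le_rfl
    exact hxy ⟨p, by omega⟩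

open Classical in
/-- The length of a shortest walk from `A` to `B` inside `Z`. -/
noncomputable def dst (G : SimpleGraph V) (Z A B : Set V) : ℕ :=
  if h : ∃ n f, IsGeod G Z A B n f then h.choose else 0

theorem exists_isGeod_dst {Z A B : Set V} {a b : V} (ha : a ∈ A) (hb : b ∈ B)
    (h : Conn G Z a b) : ∃ f, IsGeod G Z A B (dst G Z A B) f := by
  have h' := exists_isGeod ha hb h
  rw [dst, dif_pos h']
  exact h'.choose_spec

theorem IsConn.exists_isGeod_dst {Z A B : Set V} (hZ : IsConn G Z) (hA : (A ∩ Z).Nonempty)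
    (hB : (B ∩ Z).Nonempty) : ∃ f, IsGeod G Z A B (dst G Z A B) f := by
  obtain ⟨a, ha, ha'⟩ := hA
  obtain ⟨b, hb, hb'⟩ := hB
  exact _root_.exists_isGeod_dst ha hb (hZ.2 a ha' b hb')

/-- One step of the splitting lemma. -/
theorem exists_split_one [Finite V] {L F : Set V} {n : ℕ} (T : V → ℕ) (hL : ¬ Col G L (n + n))
    (hF : ¬ Col G F (n + n)) : ∃ L' ⊆ L, ∃ F' ⊆ F, ¬ Col G L' n ∧ ¬ Col G F' n ∧
      ((∀ p ∈ L', ∀ q ∈ F', T p ≤ T q) ∨ ∀ p ∈ L', ∀ q ∈ F', T q ≤ T p) := by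
  classical
  have hex : ∃ t, ¬ Col G {p ∈ L | T p ≤ t} n := by
    obtain ⟨t, ht⟩ := (Set.finite_range T).bddAbove
    exact ⟨t, fun h => hL (h.mono (fun p hp => ⟨hp, ht ⟨p, rfl⟩⟩) (by omega))⟩
  have h1 := Nat.find_spec hex
  set t := Nat.find hex with ht
  -- By minimality of `t` the part of `L` strictly below `t` is `n`-colourable. So `t` is a median
  -- for chromatic number: the parts `T ≤ t` and `t ≤ T` of `L` are both not `n`-colourable.
  have h2 : ¬ Col G {p ∈ L | t ≤ T p} n := by
    intro h
    refine hL ((h.union (T := {p ∈ L | T p < t}) (n := n) ?_).mono (fun p hp => ?_) le_rfl)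
    · rcases Nat.eq_zero_or_pos t with h0 | h0
      · exact (Col.empty n).mono (by rw [h0]; rintro p ⟨-, hp⟩; simp at hp) le_rfl
      · have := Nat.find_min hex (m := t - 1) (by omega)
        rw [not_not] at this
        exact this.mono (fun p hp => ⟨hp.1, by have := hp.2; omega⟩) le_rfl
    · rcases le_or_gt t (T p) with h | h
      exacts [Or.inl ⟨hp, h⟩, Or.inr ⟨hp, h⟩]
  by_cases h3 : Col G {q ∈ F | t ≤ T q} n
  · refine ⟨_, fun p hp => hp.1, {q ∈ F | T q ≤ t}, fun p hp => hp.1, h2, fun h4 => ?_,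
      Or.inr fun p hp q hq => hq.2.trans hp.2⟩
    exact hF ((h3.union h4).mono (fun p hp => (le_total t (T p)).imp (⟨hp, ·⟩) (⟨hp, ·⟩)) le_rfl)
  · exact ⟨_, fun p hp => hp.1, _, fun p hp => hp.1, h1, h3,
      Or.inl fun p hp q hq => hp.2.trans hq.2⟩

/-- Each function costs a factor of two in the number of colours, and an order relation once
obtained survives passing to subsets. -/
theorem exists_split_aux [Finite V] (T : ℕ → V → ℕ) (n M : ℕ) : ∀ {L F : Set V},
    ¬ Col G L (2 ^ M * n) → ¬ Col G F (2 ^ M * n) → ∃ L' ⊆ L, ∃ F' ⊆ F, ¬ Col G L' n ∧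
      ¬ Col G F' n ∧ ∀ j < M, (∀ p ∈ L', ∀ q ∈ F', T j p ≤ T j q) ∨
        ∀ p ∈ L', ∀ q ∈ F', T j q ≤ T j p := by
  induction M with
  | zero =>
    intro L F hL hF
    exact ⟨L, subset_rfl, F, subset_rfl, by simpa using hL, by simpa using hF, by simp⟩
  | succ M ih =>
    intro L F hL hF
    rw [pow_succ, mul_two, add_mul] at hL hF
    obtain ⟨L₁, hL₁, F₁, hF₁, h1, h2, h3⟩ := exists_split_one (T M) hL hF
    obtain ⟨L₂, hL₂, F₂, hF₂, h4, h5, h6⟩ := ih h1 h2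
    refine ⟨L₂, hL₂.trans hL₁, F₂, hF₂.trans hF₁, h4, h5, fun j hj => ?_⟩
    rcases Nat.lt_succ_iff_lt_or_eq.1 hj with hj | rfl
    · exact h6 j hj
    · exact h3.imp (fun h p hp q hq => h p (hL₂ hp) q (hF₂ hq))
        (fun h p hp q hq => h p (hL₂ hp) q (hF₂ hq))

/-- Given many functions on a set of large chromatic number, there are two subsets of large
chromatic number such that half of the functions are smaller on the first one. -/
theorem exists_split [Finite V] {C : Set V} {n k : ℕ} (T : ℕ → V → ℕ)
    (hC : ¬ Col G C (2 ^ (2 * k) * n)) : ∃ L ⊆ C, ∃ F ⊆ C, ¬ Col G L n ∧ ¬ Col G F n ∧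
      ∃ J : Finset ℕ, k ≤ J.card ∧ ∀ j ∈ J, j < 2 * k ∧ ∀ p ∈ L, ∀ q ∈ F, T j p ≤ T j q := by
  classical
  obtain ⟨L, hL, F, hF, h1, h2, h3⟩ := exists_split_aux T n (2 * k) hC hC
  set J₁ := (Finset.range (2 * k)).filter fun j => ∀ p ∈ L, ∀ q ∈ F, T j p ≤ T j q with hJ₁
  set J₂ := (Finset.range (2 * k)).filter fun j => ∀ p ∈ L, ∀ q ∈ F, T j q ≤ T j p with hJ₂
  have hcard : 2 * k ≤ J₁.card + J₂.card := by
    refine le_trans ?_ (Finset.card_union_le _ _)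
    have : Finset.range (2 * k) ⊆ J₁ ∪ J₂ := by
      intro j hj
      rcases h3 j (Finset.mem_range.1 hj) with h | h
      · exact Finset.mem_union_left _ (Finset.mem_filter.2 ⟨hj, h⟩)
      · exact Finset.mem_union_right _ (Finset.mem_filter.2 ⟨hj, h⟩)
    simpa using Finset.card_le_card this
  -- Both sets come from the same `C`, so the more frequent direction decides which of them is the
  -- low one.
  rcases le_or_gt k J₁.card with h | h
  · refine ⟨L, hL, F, hF, h1, h2, J₁, h, fun j hj => ?_⟩
    have := Finset.mem_filter.1 hj
    exact ⟨Finset.mem_range.1 this.1, this.2⟩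
  · refine ⟨F, hF, L, hL, h2, h1, J₂, by omega, fun j hj => ?_⟩
    have := Finset.mem_filter.1 hj
    exact ⟨Finset.mem_range.1 this.1, fun p hp q hq => this.2 q hq p hp⟩

end Basics

/-! ### The cluster lemma: three far points joined pairwise away from the third. -/

section Cluster

variable {V : Type*} {G : SimpleGraph V}

/-- There is a walk in `R` from the ports of `p` to those of `q` that avoids the ports of `r`. -/
def Vis (G : SimpleGraph V) (R : Set V) (N : V → Set V) (p q r : V) : Prop :=
  ∃ x ∈ N p, ∃ y ∈ N q, Conn G (R \ N r) x y

/-- `p` and `r` are joined through a walk of `L` inside three balls that avoids the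
neighbours of `c q`. -/
def LocalJoin (G : SimpleGraph V) (k : ℕ) (L : Set V) (c : V → V) (p q r : V) : Prop :=
  ∃ W ⊆ L, (∃ x ∈ W, ∃ y ∈ W, G.Adj (c p) x ∧ G.Adj (c r) y ∧ Conn G W x y) ∧
    (∀ v ∈ W, ¬ G.Adj (c q) v) ∧ ∃ a b d, ∀ v ∈ W, Near G k a v ∨ Near G k b v ∨ Near G k d v

theorem Vis.symm {R : Set V} {N : V → Set V} {p q r : V} (h : Vis G R N p q r) :
    Vis G R N q p r := by
  obtain ⟨x, hx, y, hy, h⟩ := h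
  exact ⟨y, hy, x, hx, h.symm⟩

theorem LocalJoin.symm {k : ℕ} {L : Set V} {c : V → V} {p q r : V}
    (h : LocalJoin G k L c p q r) : LocalJoin G k L c r q p := by
  obtain ⟨W, hW, ⟨x, hx, y, hy, h1, h2, h3⟩, h4⟩ := h
  exact ⟨W, hW, ⟨y, hy, x, hx, h2, h1, h3.symm⟩, h4⟩

/-- A walk that meets `B` has an initial part that meets `B` only in its last vertex. -/
theorem exists_first {Z B : Set V} {a : V} (hB : ∃ v ∈ B, Conn G Z a v) :
    ∃ y ∈ B, y ∈ Z ∧ ∀ Q : Set V, (∀ v ∈ Z, v ∉ B → v ∈ Q) → y ∈ Q → Conn G Q a y := by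
  obtain ⟨v, hv, hv'⟩ := hB
  obtain ⟨n, f, hf⟩ := exists_isGeod (A := {a}) (B := B) rfl hv hv'
  have h0 : f 0 = a := hf.zero
  refine ⟨f n, hf.last, hf.mem n le_rfl, fun Q hQ hn => ?_⟩
  have := (hf.conn (Nat.zero_le n) le_rfl).mono (Z' := Q) (by
    rintro _ ⟨t, -, ht, rfl⟩
    rcases ht.lt_or_eq with h | rfl
    · exact hQ _ (hf.mem _ ht) (hf.notMem_target h)
    · exact hn)
  rwa [h0] at this

/-- In a connected set, a set of ports that separates the two others is unique. -/
theorem vis_of_not_vis {R : Set V} (hR : IsConn G R) {N : V → Set V} {p q r : V}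
    (hp : (N p).Nonempty) (hpR : N p ⊆ R)
    (hr : (N r).Nonempty) (hrR : N r ⊆ R)
    (hqr : Disjoint (N q) (N r)) (h : ¬ Vis G R N p r q) : Vis G R N p q r := by
  obtain ⟨x, hx⟩ := hp
  obtain ⟨z, hz⟩ := hr
  -- go from `N p` towards `N q` until the first vertex of `N q ∪ N r`
  obtain ⟨y, hyB, hyR, hy⟩ := exists_first (B := N q ∪ N r)
    ⟨z, Or.inr hz, hR.2 x (hpR hx) z (hrR hz)⟩
  rcases hyB with hyq | hyr
  · exact ⟨x, hx, y, hyq, hy _ (fun v hv hv' => ⟨hv, fun h => hv' (Or.inr h)⟩)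
      ⟨hyR, Set.disjoint_left.1 hqr hyq⟩⟩
  · exact absurd ⟨x, hx, y, hyr, hy _ (fun v hv hv' => ⟨hv, fun h => hv' (Or.inl h)⟩)
      ⟨hyR, Set.disjoint_right.1 hqr hyr⟩⟩ h

/-- A walk from `N p'` to `N z` has to cross `N p`. If it avoided `N y`, its part after the crossing
would join `p` to `z` away from `N y`. -/
theorem not_vis_trans {R : Set V} {N : V → Set V} {p p' y z : V}
    (h1 : ¬ Vis G R N p' z p) (h2 : ¬ Vis G R N p z y) :
    ¬ Vis G R N p' z y := by
  rintro ⟨x, hx, w, hw, h⟩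
  by_cases hp : ∃ v ∈ N p, Conn G (R \ N y) w v
  · obtain ⟨v, hv, hv'⟩ := hp
    exact h2 ⟨v, hv, w, hw, hv'.symm⟩
  · obtain ⟨P, hP⟩ := h
    refine h1 ⟨x, hx, w, hw, P, fun v hv => ⟨(hP v hv).1, fun hvp => hp ⟨v, hvp, ?_⟩⟩⟩
    classical
    exact ⟨(P.dropUntil v hv).reverse, fun u hu => hP u
      (P.support_dropUntil_subset_support hv (by simpa using hu))⟩

/-- The hypotheses of the cluster lemma. -/
structure Ports (G : SimpleGraph V) (k : ℕ) (L R : Set V) (c : V → V) (N : V → Set V) : Prop where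
  adj : ∀ p ∈ L, G.Adj p (c p)
  conn : IsConn G R
  sub : ∀ p ∈ L, N p ⊆ R
  nonempty : ∀ p ∈ L, (N p).Nonempty
  disj : ∀ p ∈ L, ∀ q ∈ L, ¬ Near G k p q → Disjoint (N p) (N q)

namespace Ports

variable {k : ℕ} {L R : Set V} {c : V → V} {N : V → Set V}

theorem vis (h : Ports G k L R c N) {p q r : V} (hp : p ∈ L) (hq : q ∈ L) (hr : r ∈ L)
    (hqr : ¬ Near G k q r) (hv : ¬ Vis G R N p r q) : Vis G R N p q r :=
  vis_of_not_vis h.conn (h.nonempty p hp) (h.sub p hp)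
    (h.nonempty r hr) (h.sub r hr) (h.disj q hq r hr hqr) hv

/-- The distance in `R` from the root `r₀`. -/
noncomputable def height (_ : Ports G k L R c N) (r₀ p : V) : ℕ := dst G R {r₀} (N p)

/-- Shortest walks from the root to `N p` and `N q` are no longer than the distance to `N r`, and
the port sets are disjoint, so neither walk meets `N r`. They are joined at the root. -/
theorem vis_of_height_le (h : Ports G k L R c N) {r₀ : V} (hr₀ : r₀ ∈ R) {p q r : V} (hp : p ∈ L)
    (hq : q ∈ L) (hr : r ∈ L) (hpr : ¬ Near G k p r) (hqr : ¬ Near G k q r)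
    (h1 : h.height r₀ p ≤ h.height r₀ r) (h2 : h.height r₀ q ≤ h.height r₀ r) :
    Vis G R N p q r := by
  have geod : ∀ s ∈ L, ∃ f, IsGeod G R {r₀} (N s) (h.height r₀ s) f := fun s hs => by
    obtain ⟨x, hx⟩ := h.nonempty s hs
    exact h.conn.exists_isGeod_dst ⟨r₀, rfl, hr₀⟩ ⟨x, hx, h.sub s hs hx⟩
  obtain ⟨f, hf⟩ := geod r hr
  have key : ∀ s ∈ L, ¬ Near G k s r → h.height r₀ s ≤ h.height r₀ r →
      ∃ x ∈ N s, Conn G (R \ N r) r₀ x := by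
    intro s hs hsr hle
    obtain ⟨g, hg⟩ := geod s hs
    have h0 : g 0 = r₀ := hg.zero
    refine ⟨_, hg.last, ?_⟩
    have := (hg.conn (Nat.zero_le _) le_rfl).mono (Z' := R \ N r) (by
      rintro _ ⟨t, -, ht, rfl⟩
      exact ⟨hg.mem t ht, hg.notMem_of_le hf hle (h.disj s hs r hr hsr) ht⟩)
    rwa [h0] at this
  obtain ⟨x, hx, hx'⟩ := key p hp hpr h1
  obtain ⟨y, hy, hy'⟩ := key q hq hqr h2
  exact ⟨x, hx, y, hy, hx'.symm.trans hy'⟩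

end Ports

/-- A triple of pairwise far points of `L` that is joined as the cluster lemma asserts. -/
def IsCluster (G : SimpleGraph V) (k : ℕ) (L R : Set V) (c : V → V) (N : V → Set V)
    (p q r : V) : Prop :=
  p ∈ L ∧ q ∈ L ∧ r ∈ L ∧ ¬ Near G k p q ∧ ¬ Near G k q r ∧ ¬ Near G k p r ∧
    Vis G R N p q r ∧ Vis G R N q r p ∧ (Vis G R N p r q ∨ LocalJoin G (k + 1) L c p q r)

section NoCluster

variable {k : ℕ} {L R : Set V} {c : V → V} {N : V → Set V} (h : Ports G k L R c N)
  (hno : ∀ p q r, ¬ IsCluster G k L R c N p q r) {r₀ : V} (hr₀ : r₀ ∈ R)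
include h hno

/-- Pairs that are joined locally are visible. -/
theorem vis_of_localJoin {p q r : V} (hp : p ∈ L) (hq : q ∈ L) (hr : r ∈ L)
    (hpq : ¬ Near G k p q) (hqr : ¬ Near G k q r) (hpr : ¬ Near G k p r)
    (hl : LocalJoin G (k + 1) L c p q r) : Vis G R N p r q := by
  -- If `N q` separated `p` from `r`, connectivity of `R` would make the other two pairs visible,
  -- and the local join would complete a cluster.
  by_contra hv
  have h1 := h.vis hp hq hr hqr hv
  have h2 := h.vis hr hq hp (fun h => hpq h.symm) (fun h => hv h.symm)
  exact hno p q r ⟨hp, hq, hr, hpq, hqr, hpr, h1, h2.symm, Or.inr hl⟩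

include hr₀

/-- As `z` is at least as high as the others, `x` and `y` see each other through the root, and the
local join makes `y` and `z` see each other. A third visible pair would complete a cluster, so `N y`
must separate `z` from `x`. -/
theorem not_vis_of_localJoin {x y z : V} (hx : x ∈ L) (hy : y ∈ L) (hz : z ∈ L)
    (hxy : ¬ Near G k x y) (hyz : ¬ Near G k y z) (hxz : ¬ Near G k x z)
    (hl : LocalJoin G (k + 1) L c y x z) (h1 : h.height r₀ x ≤ h.height r₀ z)
    (h2 : h.height r₀ y ≤ h.height r₀ z) : ¬ Vis G R N z x y := by
  intro hv
  have h3 := vis_of_localJoin h hno hy hx hz (fun h => hxy h.symm) hxz hyz hl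
  have h4 := h.vis_of_height_le hr₀ hx hy hz hxz hyz h1 h2
  exact hno x y z ⟨hx, hy, hz, hxy, hyz, hxz, h4, h3, Or.inl hv.symm⟩

theorem not_vis_or {x y z : V} (hx : x ∈ L) (hy : y ∈ L) (hz : z ∈ L)
    (hxy : ¬ Near G k x y) (hyz : ¬ Near G k y z) (hxz : ¬ Near G k x z)
    (h1 : h.height r₀ x ≤ h.height r₀ z) (h2 : h.height r₀ y ≤ h.height r₀ z) :
    ¬ Vis G R N z x y ∨ ¬ Vis G R N z y x := by
  by_contra! hv
  have h4 := h.vis_of_height_le hr₀ hx hy hz hxz hyz h1 h2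
  exact hno x y z ⟨hx, hy, hz, hxy, hyz, hxz, h4, hv.2.symm, Or.inl hv.1.symm⟩

/-- The state of being separated is preserved along local joins. -/
theorem not_vis_of_not_vis {y₁ y₂ p p' : V} (hy₁ : y₁ ∈ L) (hy₂ : y₂ ∈ L) (hp : p ∈ L)
    (hp' : p' ∈ L) (hy : ¬ Near G k y₁ y₂) (h1 : ¬ Near G k y₁ p) (h2 : ¬ Near G k y₂ p)
    (h1' : ¬ Near G k y₁ p') (h2' : ¬ Near G k y₂ p') (hpp' : ¬ Near G k p p')
    (ht1 : h.height r₀ y₁ ≤ h.height r₀ p)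
    (ht1' : h.height r₀ y₁ ≤ h.height r₀ p') (ht2' : h.height r₀ y₂ ≤ h.height r₀ p')
    (hl1 : LocalJoin G (k + 1) L c p y₁ p') (hl2 : LocalJoin G (k + 1) L c p y₂ p')
    (hA : ¬ Vis G R N p y₂ y₁) : ¬ Vis G R N p' y₂ y₁ := by
  -- The local joins make the ports of the lower of `p`, `p'` separate the higher one from `y₂` (or
  -- `y₁`), and separations compose by `not_vis_trans`.
  rcases le_total (h.height r₀ p) (h.height r₀ p') with hle | hle
  · have h3 := not_vis_of_localJoin h hno hr₀ hy₂ hp hp' h2 hpp' h2' hl2 ht2' hle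
    exact not_vis_trans h3 hA
  · -- otherwise `p'` is in the other state, which is then inherited by `p`
    intro hv
    have h3 := (not_vis_or h hno hr₀ hy₂ hy₁ hp' (fun h => hy h.symm) h1' h2' ht2' ht1').resolve_left
      (fun h => h hv)
    have h4 := not_vis_of_localJoin h hno hr₀ hy₁ hp' hp h1' (fun h => hpp' h.symm) h1
      hl1.symm ht1 hle
    have h5 := not_vis_trans h4 h3
    exact hA (h.vis hp hy₂ hy₁ (fun h => hy h.symm) h5)

/-- Two low vertices joined through higher ones are near each other. -/
theorem near_of_conn_high (hk : 2 ≤ k) {y₁ y₂ x₁ x₂ : V} (hy₁ : y₁ ∈ L) (hy₂ : y₂ ∈ L)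
    (hx₁ : G.Adj (c y₁) x₁) (hx₂ : G.Adj (c y₂) x₂)
    (hconn : Conn G {v ∈ L | ¬ Near G k y₁ v → ¬ Near G k y₂ v →
      h.height r₀ y₁ ≤ h.height r₀ v ∧ h.height r₀ y₂ ≤ h.height r₀ v} x₁ x₂) :
    Near G (2 * k + 1) y₁ y₂ := by
  classical
  by_contra hfar
  have hy : ¬ Near G k y₁ y₂ := fun h => hfar (h.mono (by omega))
  obtain ⟨n, f, hf⟩ := exists_isGeod (A := {v | G.Adj (c y₁) v}) (B := {v | G.Adj (c y₂) v})
    hx₁ hx₂ hconn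
  have hL : ∀ i ≤ n, f i ∈ L := fun i hi => (hf.mem i hi).1
  have hn0 : Near G k y₁ (f 0) :=
    ((h.adj y₁ hy₁).near.trans (SimpleGraph.Adj.near hf.zero)).mono hk
  have hnn : Near G k y₂ (f n) :=
    ((h.adj y₂ hy₂).near.trans (SimpleGraph.Adj.near hf.last)).mono hk
  -- Only points far from both `y₁` and `y₂` have controlled heights.
  let S : ℕ → Prop := fun i => i ≤ n ∧ ¬ Near G k y₁ (f i) ∧ ¬ Near G k y₂ (f i)
  have hS0 : ∀ i, S i → 0 < i := fun i hi => Nat.pos_of_ne_zero fun h => hi.2.1 (h ▸ hn0)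
  have hSn : ∀ i, S i → i < n := fun i hi => lt_of_le_of_ne hi.1 fun h => hi.2.2 (h ▸ hnn)
  have local_seg : ∀ {p q r : V} {i j : ℕ}, i ≤ j → j ≤ n → G.Adj (c p) (f i) →
      G.Adj (c r) (f j) → (∀ t, i ≤ t → t ≤ j → ¬ G.Adj (c q) (f t)) →
      (∃ d, ∀ t, i ≤ t → t ≤ j → Near G (k + 1) y₁ (f t) ∨ Near G (k + 1) y₂ (f t) ∨
        Near G (k + 1) d (f t)) → LocalJoin G (k + 1) L c p q r := by
    rintro p q r i j hij hj h1 h2 h3 ⟨d, h4⟩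
    refine ⟨{v | ∃ t, i ≤ t ∧ t ≤ j ∧ v = f t}, ?_, ⟨f i, ⟨i, le_rfl, hij, rfl⟩, f j, ⟨j, hij, le_rfl, rfl⟩, h1, h2,
      hf.conn hij hj⟩, ?_, y₁, y₂, d, ?_⟩
    · rintro _ ⟨t, -, ht, rfl⟩; exact hL t (ht.trans hj)
    · rintro _ ⟨t, ht, ht', rfl⟩; exact h3 t ht ht'
    · rintro _ ⟨t, ht, ht', rfl⟩; exact h4 t ht ht'
  have hne : ∃ i, S i := by
    by_contra! hS
    have h1 : ∀ i ≤ n, Near G k y₁ (f i) := by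
      intro i
      induction i with
      | zero => exact fun _ => hn0
      | succ i ih =>
        intro hi
        by_contra hc
        have h2 : Near G k y₂ (f (i + 1)) := by
          by_contra h2
          exact hS _ ⟨hi, hc, h2⟩
        exact hfar ((((ih (by omega)).trans (hf.adj i (by omega)).near).trans h2.symm).mono
          (by omega))
    exact hfar (((h1 n le_rfl).trans hnn.symm).mono (by omega))
  -- In state `A` the ports of `y₁` separate those of `f i` from those of `y₂`. The walk enters `S`
  -- in this state and keeps it along local joins, whereas the last segment, which leads to `y₂`,
  -- forces the opposite separation.
  let A : ℕ → Prop := fun i => S i ∧ ¬ Vis G R N (f i) y₂ y₁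
  have hA : A (Nat.find hne) := by
    have hS := Nat.find_spec hne
    have hmin : ∀ t < Nat.find hne, Near G k y₁ (f t) ∨ Near G k y₂ (f t) := by
      intro t ht
      by_contra! hc
      exact Nat.find_min hne ht ⟨ht.le.trans hS.1, hc⟩
    refine ⟨hS, ?_⟩
    have ht := (hf.mem _ hS.1).2 hS.2.1 hS.2.2
    refine not_vis_of_localJoin h hno hr₀ hy₂ hy₁ (hL _ hS.1) (fun h => hy h.symm) hS.2.1 hS.2.2
      (local_seg (Nat.zero_le _) hS.1 hf.zero (h.adj _ (hL _ hS.1)).symm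
        (fun t _ ht => hf.notMem_target (ht.trans_lt (hSn _ hS)))
        ⟨f (Nat.find hne), fun t _ ht => ?_⟩) ht.2 ht.1
    rcases ht.lt_or_eq with h | h
    · exact (hmin t h).imp (fun h => h.mono (by omega)) (fun h => Or.inl (h.mono (by omega)))
    · exact Or.inr (Or.inr (h ▸ Near.refl _ _))
  set m := Nat.findGreatest A n with hm
  have hmA : A m := Nat.findGreatest_spec (Nat.find_spec hne).1 hA
  have hmax : ∀ i, m < i → i ≤ n → ¬ A i := fun i => Nat.findGreatest_is_greatest
  have htm := (hf.mem _ hmA.1.1).2 hmA.1.2.1 hmA.1.2.2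
  -- Take the first point of `S` after `f m` that is far from `f m`. Up to it the walk stays in
  -- three balls, so the state is passed on, against the maximality of `m`. If there is no such
  -- point, the whole rest of the walk is a local join from `f m` to `y₂`.
  by_cases hex : ∃ i, m < i ∧ S i ∧ ¬ Near G k (f m) (f i)
  · obtain ⟨hmi, hS, hfm⟩ := Nat.find_spec hex
    have hmin : ∀ t < Nat.find hex, m < t →
        Near G k y₁ (f t) ∨ Near G k y₂ (f t) ∨ Near G k (f m) (f t) := by
      intro t ht hmt
      by_contra! hc
      exact Nat.find_min hex ht ⟨hmt, ⟨ht.le.trans hS.1, hc.1, hc.2.1⟩, hc.2.2⟩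
    set i := Nat.find hex
    have hnear : ∀ t, m ≤ t → t ≤ i → Near G (k + 1) y₁ (f t) ∨ Near G (k + 1) y₂ (f t) ∨
        Near G (k + 1) (f m) (f t) := by
      have aux : ∀ t, m ≤ t → t < i → Near G k y₁ (f t) ∨ Near G k y₂ (f t) ∨
          Near G k (f m) (f t) := by
        intro t h1 h2
        rcases h1.lt_or_eq with h | rfl
        · exact hmin t h2 h
        · exact Or.inr (Or.inr (Near.refl _ _))
      intro t h1 h2
      rcases h2.lt_or_eq with h | h
      · exact (aux t h1 h).imp (fun h => h.mono (by omega))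
          (Or.imp (fun h => h.mono (by omega)) (fun h => h.mono (by omega)))
      · have hadj := (hf.adj (t - 1) (by have := hS.1; omega)).near
        have hmt : m < t := h ▸ hmi
        rw [Nat.sub_add_cancel (by omega)] at hadj
        exact (aux (t - 1) (by omega) (by omega)).imp (fun h => h.trans hadj)
          (Or.imp (fun h => h.trans hadj) (fun h => h.trans hadj))
    have hti := (hf.mem _ hS.1).2 hS.2.1 hS.2.2
    have h1 : LocalJoin G (k + 1) L c (f m) y₁ (f i) :=
      local_seg hmi.le hS.1 (h.adj _ (hL _ hmA.1.1)).symm (h.adj _ (hL _ hS.1)).symm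
        (fun t ht ht' => hf.notMem_source (ht'.trans hS.1) ((hS0 _ hmA.1).trans_le ht))
        ⟨_, hnear⟩
    have h2 : LocalJoin G (k + 1) L c (f m) y₂ (f i) :=
      local_seg hmi.le hS.1 (h.adj _ (hL _ hmA.1.1)).symm (h.adj _ (hL _ hS.1)).symm
        (fun t ht ht' => hf.notMem_target (ht'.trans_lt (hSn _ hS)))
        ⟨_, hnear⟩
    exact hmax i hmi hS.1 ⟨hS, not_vis_of_not_vis h hno hr₀ hy₁ hy₂ (hL _ hmA.1.1) (hL _ hS.1) hy
      hmA.1.2.1 hmA.1.2.2 hS.2.1 hS.2.2 hfm htm.1 hti.1 hti.2 h1 h2 hmA.2⟩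
  · have hnear : ∀ t, m ≤ t → t ≤ n → Near G (k + 1) y₁ (f t) ∨ Near G (k + 1) y₂ (f t) ∨
        Near G (k + 1) (f m) (f t) := by
      intro t h1 h2
      by_contra! hc
      rcases h1.lt_or_eq with h | rfl
      · exact hex ⟨t, h, ⟨h2, fun h => hc.1 (h.mono (by omega)), fun h => hc.2.1 (h.mono (by omega))⟩,
          fun h => hc.2.2 (h.mono (by omega))⟩
      · exact hc.2.2 (Near.refl _ _)
    have h1 : LocalJoin G (k + 1) L c (f m) y₁ y₂ :=
      local_seg hmA.1.1 le_rfl (h.adj _ (hL _ hmA.1.1)).symm hf.last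
        (fun t ht ht' => hf.notMem_source ht' ((hS0 _ hmA.1).trans_le ht)) ⟨_, hnear⟩
    have h2 := not_vis_of_localJoin h hno hr₀ hy₁ hy₂ (hL _ hmA.1.1) hy hmA.1.2.2 hmA.1.2.1
      h1.symm htm.1 htm.2
    exact h2 (h.vis (hL _ hmA.1.1) hy₁ hy₂ hy hmA.2)

end NoCluster

/-- A set is `2τ`-colourable if it has an injective order such that, for each vertex `v`, the
earlier neighbours of the component of `v` in the graph on the later vertices are near
each other. -/
theorem col_of_near_boundary {L : Set V} {τ b : ℕ} (hb : 1 ≤ b)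
    (hτ : ∀ v, Col G {w | Near G (2 * b) v w} τ) (key : V → ℕ) (hkey : Function.Injective key)
    (hnear : ∀ v ∈ L, ∀ y₁ ∈ L, ∀ y₂ ∈ L, key y₁ < key v → key y₂ < key v →
      (∃ u₁, G.Adj y₁ u₁ ∧ Conn G {w ∈ L | key v ≤ key w} v u₁) →
      (∃ u₂, G.Adj y₂ u₂ ∧ Conn G {w ∈ L | key v ≤ key w} v u₂) → Near G b y₁ y₂) :
    Col G L (2 * τ) := by
  classical
  let D : V → V → Prop := fun v y => y ∈ L ∧ key y < key v ∧
    ∃ u, G.Adj y u ∧ Conn G {w ∈ L | key v ≤ key w} v u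
  -- `D v` holds for the earlier attachments of the component of `v` among the later vertices; the
  -- parent of `v` is the latest of them.
  have hex : ∀ v, (∃ y, D v y) → ∃ y, D v y ∧ ∀ y', D v y' → key y' ≤ key y := by
    intro v hv
    have hbd : BddAbove (key '' {y | D v y}) :=
      ⟨key v, by rintro _ ⟨y, hy, rfl⟩; exact hy.2.1.le⟩
    obtain ⟨y, hy, hy'⟩ := Nat.sSup_mem (Set.Nonempty.image key hv) hbd
    exact ⟨y, hy, fun y' h' => hy' ▸ le_csSup hbd ⟨y', h', rfl⟩⟩
  choose! par hpar hparmax using hex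
  -- the root and the depth of a vertex
  have hrec : ∃ g : V → V × ℕ, ∀ v, g v = if (∃ y, D v y) then
      (if Near G (2 * b) (g (par v)).1 v then g (par v) else (v, (g (par v)).2 + 1))
      else (v, 0) := by
    have hwf : WellFounded (fun u v : V => key u < key v) := InvImage.wf key Nat.lt_wfRel.wf
    let F : (v : V) → ((u : V) → key u < key v → V × ℕ) → V × ℕ := fun v ih =>
      if hv : ∃ y, D v y then
        (if Near G (2 * b) (ih (par v) (hpar v hv).2.1).1 v then ih (par v) (hpar v hv).2.1
          else (v, (ih (par v) (hpar v hv).2.1).2 + 1))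
      else (v, 0)
    refine ⟨hwf.fix F, fun v => ?_⟩
    rw [hwf.fix_eq]
    by_cases hv : ∃ y, D v y
    · simp only [F, dif_pos hv, if_pos hv]
    · simp only [F, dif_neg hv, if_neg hv]
  obtain ⟨g, hg⟩ := hrec
  have hball : ∀ v, Near G (2 * b) (g v).1 v := by
    intro v
    rw [hg]
    split_ifs with h1 h2
    · exact h2
    · exact Near.refl _ _
    · exact Near.refl _ _
  -- A vertex shares root and depth with its parent while it is within `2 * b` of that root;
  -- otherwise it becomes a root, one level deeper. An attachment `w` of `u` is the parent of `u` or
  -- an attachment of that parent. The depth cannot increase twice between `w` and `u`: the first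
  -- new root would be within `b` of `w`, hence within `2 * b` of `u`, and `u` would have kept it.
  have hclaim : ∀ w ∈ L, ∀ m, ∀ u ∈ L, key u = m → (w = u ∨ (D u w ∧ Near G b w u)) →
      g u = g w ∨ ((g u).2 = (g w).2 + 1 ∧ Near G b w (g u).1) := by
    intro w hw m
    induction m using Nat.strong_induction_on with
    | _ m ih =>
      rintro u hu rfl (rfl | ⟨hwu, hnu⟩)
      · exact Or.inl rfl
      · have hDu : ∃ y, D u y := ⟨w, hwu⟩
        have hy := hpar u hDu
        have hwy : w = par u ∨ (D (par u) w ∧ Near G b w (par u)) := by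
          by_cases hwp : w = par u
          · exact Or.inl hwp
          · have hlt : key w < key (par u) :=
              lt_of_le_of_ne (hparmax u hDu w hwu) fun h => hwp (hkey h)
            obtain ⟨u₁, h1, h2⟩ := hwu.2.2
            obtain ⟨u₂, h3, h4⟩ := hy.2.2
            refine Or.inr ⟨⟨hw, hlt, u₁, h1, ?_⟩,
              hnear u hu w hw _ hy.1 hwu.2.1 hy.2.1 hwu.2.2 hy.2.2⟩
            have hsub : {w ∈ L | key u ≤ key w} ⊆ {w ∈ L | key (par u) ≤ key w} :=
              fun x hx => ⟨hx.1, hy.2.1.le.trans hx.2⟩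
            have hm : par u ∈ {w ∈ L | key (par u) ≤ key w} := ⟨hy.1, le_rfl⟩
            exact (Conn.of_adj h3 hm (hsub h4.right_mem)).trans
              ((h4.symm.trans h2).mono hsub)
        have hQ := ih _ hy.2.1 (par u) hy.1 rfl hwy
        rw [hg u, if_pos hDu]
        split_ifs with hN
        · exact hQ
        · right
          rcases hQ with hQ | ⟨-, hQ⟩
          · exact ⟨by rw [hQ], hnu⟩
          · exact absurd ((hQ.symm.trans hnu).mono (by omega)) hN
  have hedge : ∀ v ∈ L, ∀ w ∈ L, G.Adj v w → key w < key v →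
      g v = g w ∨ (g v).2 = (g w).2 + 1 := by
    intro v hv w hw hvw hlt
    have hc : Conn G {w ∈ L | key v ≤ key w} v v := Conn.refl ⟨hv, le_rfl⟩
    refine (hclaim w hw (key v) v hv rfl (Or.inr ⟨⟨hw, hlt, v, hvw.symm, hc⟩, hvw.symm.near.mono hb⟩)).imp id (fun h => h.1)
  choose col hcol1 hcol2 using hτ
  -- Adjacent vertices with the same root and depth are distinguished by the colouring of the ball
  -- around the root, all others by the parity of the depth.
  refine ⟨fun v => 2 * col (g v).1 v + (g v).2 % 2, fun v _ => ?_, ?_⟩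
  · have := hcol1 (g v).1 v (hball v)
    have := Nat.mod_lt (g v).2 two_pos
    show 2 * col (g v).1 v + (g v).2 % 2 < 2 * τ
    omega
  · have key2 : ∀ v ∈ L, ∀ w ∈ L, G.Adj v w → key w < key v →
        2 * col (g v).1 v + (g v).2 % 2 ≠ 2 * col (g w).1 w + (g w).2 % 2 := by
      intro v hv w hw hvw hlt
      rcases hedge v hv w hw hvw hlt with h | h
      · have h3 := hcol2 (g v).1 v (hball v) w (h ▸ hball w) hvw
        rw [← h]
        omega
      · omega
    intro u hu v hv huv
    rcases lt_trichotomy (key u) (key v) with hlt | heq | hlt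
    · exact (key2 v hv u hu huv.symm hlt).symm
    · exact absurd (hkey heq) huv.ne
    · exact key2 u hu v hv huv hlt

/-- The cluster lemma. -/
theorem exists_isCluster [Finite V] {k τ : ℕ} (hk : 2 ≤ k)
    (hτ : ∀ v, Col G {w | Near G (2 * (2 * k + 1)) v w} τ) {L R : Set V} {c : V → V}
    {N : V → Set V} (h : Ports G k L R c N) (hL : ¬ Col G L (2 * τ)) :
    ∃ p q r, IsCluster G k L R c N p q r := by
  by_contra! hno
  obtain ⟨r₀, hr₀⟩ := h.conn.1
  -- Order by height, with ties broken by an enumeration of the vertices.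
  have hkey : ∃ key : V → ℕ, Function.Injective key ∧
      ∀ u v, key u ≤ key v → h.height r₀ u ≤ h.height r₀ v := by
    have := Fintype.ofFinite V
    have e := Fintype.equivFin V
    refine ⟨fun v => h.height r₀ v * Fintype.card V + e v, fun u v huv => ?_, fun u v huv => ?_⟩
    · have hu := (e u).2
      have hv := (e v).2
      have h1 : h.height r₀ u = h.height r₀ v := by
        have := congrArg (· / Fintype.card V) huv
        simpa [Nat.mul_add_div (Nat.zero_lt_of_lt hu), Nat.mul_comm _ (Fintype.card V),
          Nat.div_eq_of_lt hu, Nat.div_eq_of_lt hv] using this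
      simp only [h1] at huv
      exact e.injective (Fin.ext (by omega))
    · by_contra! hlt
      have hv := (e v).2
      have := Nat.mul_le_mul_right (Fintype.card V) (Nat.succ_le_of_lt hlt)
      simp only [Nat.succ_mul] at this
      simp only at huv
      omega
  obtain ⟨key, hinj, hmono⟩ := hkey
  refine hL (col_of_near_boundary (by omega) hτ key hinj ?_)
  rintro v hv y₁ hy₁ y₂ hy₂ hlt₁ hlt₂ ⟨u₁, hu₁, hc₁⟩ ⟨u₂, hu₂, hc₂⟩
  refine near_of_conn_high h hno hr₀ hk hy₁ hy₂ (h.adj _ hy₁).symm (h.adj _ hy₂).symm ?_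
  -- No height condition is imposed near `y₁` or `y₂`, so both points lie in `Z`. Being neighbours
  -- of their own labels, they serve as the ends of the walk.
  set Z := {x ∈ L | ¬ Near G k y₁ x → ¬ Near G k y₂ x →
    h.height r₀ y₁ ≤ h.height r₀ x ∧ h.height r₀ y₂ ≤ h.height r₀ x} with hZ
  have hsub : {w ∈ L | key v ≤ key w} ⊆ Z := fun x hx =>
    ⟨hx.1, fun _ _ => ⟨hmono _ _ (hlt₁.le.trans hx.2), hmono _ _ (hlt₂.le.trans hx.2)⟩⟩
  have h1 : y₁ ∈ Z := ⟨hy₁, fun h => absurd (Near.refl _ _) h⟩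
  have h2 : y₂ ∈ Z := ⟨hy₂, fun _ h => absurd (Near.refl _ _) h⟩
  have c1 := hc₁.mono hsub
  have c2 := hc₂.mono hsub
  exact ((Conn.of_adj hu₁ h1 c1.right_mem).trans (c1.symm.trans c2)).trans
    (Conn.of_adj hu₂ h2 c2.right_mem).symm

end Cluster

/-! ### From a realization of the multigraph to an induced subdivision of `J`. -/

section Realization

/-- A system of links of `G` that realizes every edge `e` of the multigraph `H` by an induced path
with interior `I e` whose ends are the points `b x` for the ends `x` of `e`. -/
structure Realizes {α β V : Type*} (G : SimpleGraph V) (l : ℕ) (H : Graph α β) (b : α → V)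
    (I : β → Set V) : Prop where
  link : ∀ e x y, H.IsLink e x y → Link G l (b x) (b y) (I e)
  anti : ∀ e f, e ≠ f → Anti G (I e) (I f)
  avoid : ∀ x e, ∀ v ∈ I e, v ≠ b x ∧ (G.Adj (b x) v → H.Inc e x)
  far : ∀ x y, x ≠ y → b x ≠ b y ∧ ¬ G.Adj (b x) (b y)

/-- A link is at least as long as the path of `M` it represents. The surplus length is absorbed by
the last edge of that path, while every earlier edge is represented by a single edge of the link. -/
theorem Realizes.exists_isSubdivision {α β V W : Type*} {G : SimpleGraph V} {l : ℕ} {H : Graph α β}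
    {b : α → V} {I : β → Set V} (h : Realizes G l H b I) (hloop : ∀ e x, ¬ H.IsLink e x x)
    {J : SimpleGraph W} (M : SubdivisionModel H J) (hl : ∀ e, (M.path e).length ≤ l) :
    ∃ S : Set V, IsSubdivision (Graph.ofSimpleGraph J) (G.induce S) := by
  classical
  set len : E(H) → ℕ := fun e => (M.path e).length with hlen
  set p : E(H) → ℕ → W := fun e i => (M.path e).getVert i with hp
  choose n f hln f0 fn finj fadj hI using fun e : E(H) => h.link e _ _ (M.isLink e)
  have hne : ∀ e : E(H), (M.src e : α) ≠ M.tgt e := fun e he =>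
    hloop e (M.tgt e) (he ▸ M.isLink e)
  have p0 : ∀ e, p e 0 = M.branch (M.src e) := fun e => (M.path e).getVert_zero
  have pl : ∀ e, p e (len e) = M.branch (M.tgt e) := fun e => (M.path e).getVert_length
  have hlen0 : ∀ e, 0 < len e := fun e => Nat.pos_of_ne_zero fun h0 => by
    have h1 := p0 e
    have h2 := pl e
    rw [h0, h1] at h2
    exact hne e (congrArg _ (M.branch_injective h2))
  have hlenn : ∀ e, len e ≤ n e := fun e => (hl e).trans (hln e)
  have pinj : ∀ e i j, i ≤ len e → j ≤ len e → p e i = p e j → i = j := fun e i j hi hj hij =>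
    (M.isPath e).getVert_injOn hi hj hij
  have pmem : ∀ e i, p e i ∈ (M.path e).support := fun e i => (M.path e).getVert_mem_support i
  -- the position on the link that corresponds to a position on the path
  set g : E(H) → ℕ → ℕ := fun e i => if i < len e then i else n e with hg
  have g0 : ∀ e, g e 0 = 0 := fun e => by simp [hg, hlen0 e]
  have gl : ∀ e, g e (len e) = n e := fun e => by simp [hg]
  have glt : ∀ e i, i < len e → g e i = i := fun e i hi => by simp [hg, hi]
  have gle : ∀ e i, g e i ≤ n e := fun e i => by
    by_cases hi : i < len e
    · rw [glt e i hi]; have := hlenn e; omega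
    · simp [hg, hi]
  have gmono : ∀ e i, i < len e → i ≤ g e (i + 1) ∧ g e i < g e (i + 1) := fun e i hi => by
    rw [glt e i hi]
    rcases Nat.lt_or_ge (i + 1) (len e) with h1 | h1
    · rw [glt e _ h1]; omega
    · rw [show i + 1 = len e by omega, gl]; have := hlenn e; omega
  have hbranch : ∀ e i, i ≤ len e → ∀ x, p e i = M.branch x →
      (i = 0 ∧ x = M.src e) ∨ (i = len e ∧ x = M.tgt e) := by
    intro e i hi x hx
    have hinc := M.inc_of_branch_mem e x (hx ▸ pmem e i)
    rcases (M.isLink e).eq_and_eq_or_eq_and_eq hinc.choose_spec with h1 | h1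
    · have hxe : x = M.src e := Subtype.ext h1.1.symm
      exact Or.inl ⟨pinj e _ _ hi (Nat.zero_le _) (by rw [hx, p0, hxe]), hxe⟩
    · have hxe : x = M.tgt e := Subtype.ext h1.2.symm
      exact Or.inr ⟨pinj e _ _ hi le_rfl (by rw [hx, pl, hxe]), hxe⟩
  have hint : ∀ e s, 0 < s → s < n e → f e s ∈ I e := fun e s h1 h2 => by
    rw [hI]; exact ⟨s, h1, h2, rfl⟩
  have hfb : ∀ e s, s ≤ n e → ∀ x : V(H), f e s = b x →
      (s = 0 ∧ x = M.src e) ∨ (s = n e ∧ x = M.tgt e) := by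
    intro e s hs x hx
    have hb : ∀ y : V(H), b y = b x → x = y := fun y hy => by
      by_contra hne
      exact (h.far y x fun h => hne (Subtype.ext h.symm)).1 hy
    rcases Nat.eq_zero_or_pos s with rfl | h1
    · exact Or.inl ⟨rfl, hb _ (by rw [← f0, hx])⟩
    · rcases hs.lt_or_eq with h2 | rfl
      · exact absurd hx (h.avoid x e _ (hint e s h1 h2)).1
      · exact Or.inr ⟨rfl, hb _ (by rw [← fn, hx])⟩
  have hends : ∀ e s, s ≤ n e → (0 < s ∧ s < n e) ∨ ∃ x : V(H), f e s = b x := by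
    intro e s hs
    rcases Nat.eq_zero_or_pos s with rfl | h1
    · exact Or.inr ⟨_, f0 e⟩
    · rcases hs.lt_or_eq with h2 | rfl
      · exact Or.inl ⟨h1, h2⟩
      · exact Or.inr ⟨_, fn e⟩
  have hsep : ∀ e e', e ≠ e' → ∀ s t, s ≤ n e → t ≤ n e' → f e s = f e' t →
      ∃ x : V(H), f e s = b x := by
    intro e e' hee s t hs ht hst
    rcases hends e s hs with ⟨h1, h2⟩ | h1
    · rcases hends e' t ht with ⟨h3, h4⟩ | ⟨x, hx⟩
      · exact absurd hst (h.anti e e' (fun h => hee (Subtype.ext h)) _ (hint e s h1 h2) _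
          (hint e' t h3 h4)).1
      · exact ⟨x, hst.trans hx⟩
    · exact h1
  -- the vertex of `G` that represents a vertex of `J`
  have hex : ∀ w : W, ∃ v : V, (∀ x, M.branch x = w → v = b x) ∧
      ∀ e i, i ≤ len e → p e i = w → v = f e (g e i) := by
    intro w
    by_cases hw : ∃ x, M.branch x = w
    · obtain ⟨x, rfl⟩ := hw
      refine ⟨b x, fun y hy => by rw [M.branch_injective hy], fun e i hi hei => ?_⟩
      rcases hbranch e i hi x hei with ⟨rfl, rfl⟩ | ⟨rfl, rfl⟩
      · rw [g0, f0]
      · rw [gl, fn]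
    · obtain ⟨e, he⟩ := (M.vertex_covered w).resolve_left hw
      obtain ⟨i, hi, hil⟩ := SimpleGraph.Walk.mem_support_iff_exists_getVert.1 he
      refine ⟨f e (g e i), fun x hx => absurd ⟨x, hx⟩ hw, fun e' i' hi' hei' => ?_⟩
      obtain rfl : e = e' := by
        by_contra hne
        exact hw (M.exists_of_mem_mem e e' hne w he (hei' ▸ pmem e' i'))
      rw [pinj e i i' hil hi' (hi.trans hei'.symm)]
  choose φ hφb hφp using hex
  have hφb' : ∀ x, φ (M.branch x) = b x := fun x => hφb _ x rfl
  have hφp' : ∀ e i, i ≤ len e → φ (p e i) = f e (g e i) := fun e i hi => hφp _ e i hi rfl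
  -- a vertex on a link represents a vertex of `J` only in the right position
  have hφf : ∀ e s, s ≤ n e → ∀ w, φ w = f e s → ∃ i ≤ len e, w = p e i ∧ s = g e i := by
    intro e s hs w hw
    by_cases hwb : ∃ x, M.branch x = w
    · obtain ⟨x, rfl⟩ := hwb
      rw [hφb'] at hw
      rcases hfb e s hs x hw.symm with ⟨rfl, rfl⟩ | ⟨rfl, rfl⟩
      · exact ⟨0, Nat.zero_le _, (p0 e).symm, (g0 e).symm⟩
      · exact ⟨len e, le_rfl, (pl e).symm, (gl e).symm⟩
    · obtain ⟨e', he'⟩ := (M.vertex_covered w).resolve_left hwb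
      obtain ⟨i, hi, hil⟩ := SimpleGraph.Walk.mem_support_iff_exists_getVert.1 he'
      have hi : p e' i = w := hi
      have hil : i ≤ len e' := hil
      have h2 : f e' (g e' i) = f e s := by rw [← hφp' e' i hil, hi, hw]
      have hii : 0 < i ∧ i < len e' := by
        constructor
        · refine Nat.pos_of_ne_zero fun h0 => hwb ⟨M.src e', ?_⟩
          rw [← hi, h0, p0]
        · refine lt_of_le_of_ne hil fun h0 => hwb ⟨M.tgt e', ?_⟩
          rw [← hi, h0, pl]
      obtain rfl : e' = e := by
        by_contra hne
        obtain ⟨x, hx⟩ := hsep e' e hne _ _ (gle e' i) hs h2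
        have := hfb e' _ (gle e' i) x hx
        rw [glt e' i hii.2] at this
        have := hlenn e'
        omega
      exact ⟨i, hil, hi.symm, (finj e' _ (gle e' i) _ hs h2).symm⟩
  have hφinj : Function.Injective φ := by
    intro w w' hww
    by_cases hwb : ∃ x, M.branch x = w
    · obtain ⟨x, rfl⟩ := hwb
      by_cases hwb' : ∃ x, M.branch x = w'
      · obtain ⟨y, rfl⟩ := hwb'
        rw [hφb', hφb'] at hww
        by_contra hne
        exact (h.far x y fun h => hne (by rw [Subtype.ext h])).1 hww
      · obtain ⟨e, he⟩ := (M.vertex_covered w').resolve_left hwb'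
        obtain ⟨i, hi, hil⟩ := SimpleGraph.Walk.mem_support_iff_exists_getVert.1 he
        have hi : p e i = w' := hi
        obtain ⟨j, hj, h1, h2⟩ := hφf e (g e i) (gle e i) _ (by rw [hww, ← hi, hφp' e i hil])
        rcases hbranch e j hj x h1.symm with ⟨rfl, -⟩ | ⟨rfl, -⟩
        · rw [g0] at h2
          rcases Nat.eq_zero_or_pos i with rfl | hi0
          · rw [h1, hi]
          · by_cases hil' : i < len e
            · rw [glt e i hil'] at h2; omega
            · have h3 : i = len e := le_antisymm hil (not_lt.1 hil')
              rw [h3, gl] at h2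
              have := hlenn e; have := hlen0 e; omega
        · rw [gl] at h2
          by_cases hil' : i < len e
          · rw [glt e i hil'] at h2; have := hlenn e; omega
          · have h3 : i = len e := le_antisymm hil (not_lt.1 hil')
            rw [h1, ← hi, h3]
    · obtain ⟨e, he⟩ := (M.vertex_covered w).resolve_left hwb
      obtain ⟨i, hi, hil⟩ := SimpleGraph.Walk.mem_support_iff_exists_getVert.1 he
      have hi : p e i = w := hi
      obtain ⟨j, hj, h1, h2⟩ := hφf e (g e i) (gle e i) w' (by rw [← hww, ← hi, hφp' e i hil])
      have hil' : i < len e := lt_of_le_of_ne hil fun h0 => hwb ⟨M.tgt e, by rw [← hi, h0, pl]⟩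
      have hij : i = j := by
        rw [glt e i hil'] at h2
        by_cases hjl : j < len e
        · rwa [glt e j hjl] at h2
        · rw [le_antisymm hj (not_lt.1 hjl), gl] at h2
          have := hlenn e; omega
      rw [h1, ← hij, hi]
  have hedge : ∀ d : E(Graph.ofSimpleGraph J), ∃ e i, i < len e ∧
      (d : Sym2 W) = s(p e i, p e (i + 1)) := by
    rintro ⟨d, hd⟩
    obtain ⟨e, he⟩ := M.edge_covered d hd
    induction d with
    | h u v =>
      obtain ⟨i, hi, hi'⟩ := (SimpleGraph.Walk.mk_mem_edges_iff_exists _).1 he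
      exact ⟨e, i, hi, hi'.symm⟩
  choose ed idx hidx hed using hedge
  have gs : ∀ e i j, i < j → j ≤ len e → g e i < g e j := by
    intro e i j hij hj
    rw [glt e i (by omega)]
    by_cases hjl : j < len e
    · rwa [glt e j hjl]
    · rw [le_antisymm hj (not_lt.1 hjl), gl]; have := hlenn e; omega
  have gs' : ∀ e i j, i ≤ j → j ≤ len e → g e i ≤ g e j := fun e i j hij hj => by
    rcases hij.lt_or_eq with h1 | rfl
    exacts [(gs e i j h1 hj).le, le_rfl]
  have ginj : ∀ e i j, i ≤ len e → j ≤ len e → g e i = g e j → i = j := fun e i j hi hj hij => by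
    by_contra hne
    rcases Nat.lt_or_gt_of_ne hne with h1 | h1
    · exact (gs e i j h1 hj).ne hij
    · exact (gs e j i h1 hi).ne' hij
  have hcov : ∀ e s, s < n e → ∃ i < len e, g e i ≤ s ∧ s < g e (i + 1) := by
    intro e s hs
    have h0 := hlen0 e
    rcases Nat.lt_or_ge s (len e) with h1 | h1
    · refine ⟨s, h1, (glt e s h1).le, ?_⟩
      have := (gmono e s h1).2
      rwa [glt e s h1] at this
    · refine ⟨len e - 1, by omega, ?_, ?_⟩
      · rw [glt e _ (by omega)]; omega
      · rwa [Nat.sub_add_cancel (by omega), gl]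
  -- Since the paths of `M` share no edges, the pair `(ed d, idx d)` is the only one that represents
  -- `d`; hence every position on every path is attained.
  have hd : ∀ e i, i < len e → ∃ d, ed d = e ∧ idx d = i := by
    intro e i hi
    have hmem : s(p e i, p e (i + 1)) ∈ (M.path e).edges :=
      (SimpleGraph.Walk.mk_mem_edges_iff_exists _).2 ⟨i, hi, rfl⟩
    let d : E(Graph.ofSimpleGraph J) := ⟨_, (M.path e).edges_subset_edgeSet hmem⟩
    have h1 := hed d
    have h2 : ed d = e := by
      by_contra hne
      refine M.edges_disjoint e (ed d) (Ne.symm hne) _ hmem ?_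
      rw [show s(p e i, p e (i + 1)) = (d : Sym2 W) from rfl, h1]
      exact (SimpleGraph.Walk.mk_mem_edges_iff_exists _).2 ⟨idx d, hidx d, rfl⟩
    refine ⟨d, h2, ?_⟩
    have h3 := hidx d
    rw [h2] at h1 h3
    rcases Sym2.eq_iff.1 (show s(p e i, p e (i + 1)) = _ from h1) with ⟨h4, -⟩ | ⟨h4, h5⟩
    · exact (pinj e _ _ hi.le h3.le h4).symm
    · have := pinj e _ _ hi.le h3 h4
      have := pinj e _ _ hi h3.le h5
      omega
  set S : Set V := {v | (∃ x : V(H), v = b x) ∨ ∃ e s, s ≤ n e ∧ v = f e s} with hS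
  have hSf : ∀ e s, s ≤ n e → f e s ∈ S := fun e s hs => Or.inr ⟨e, s, hs, rfl⟩
  have hSφ : ∀ w, φ w ∈ S := by
    intro w
    rcases M.vertex_covered w with ⟨x, rfl⟩ | ⟨e, he⟩
    · exact Or.inl ⟨x, hφb' x⟩
    · obtain ⟨i, hi, hil⟩ := SimpleGraph.Walk.mem_support_iff_exists_getVert.1 he
      have := hφp' e i hil
      rw [show p e i = w from hi] at this
      rw [this]
      exact hSf e _ (gle e i)
  -- Positions beyond the end are clamped only to make `f'` total.
  let f' : E(H) → ℕ → S := fun e s => ⟨f e (min s (n e)), hSf e _ (min_le_right _ _)⟩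
  have hf' : ∀ e s (hs : s ≤ n e), f' e s = ⟨f e s, hSf e s hs⟩ := fun e s hs => by
    simp only [f', min_eq_left hs]
  have hf'adj : ∀ e, ∀ i < n e, (G.induce S).Adj (f' e i) (f' e (i + 1)) := by
    intro e i hi
    rw [hf' e i hi.le, hf' e (i + 1) hi]
    exact (fadj e i hi.le (i + 1) hi).2 (Or.inl rfl)
  have hf'φ : ∀ e i, i ≤ len e → f' e (g e i) = ⟨φ (p e i), hSφ _⟩ := fun e i hi => by
    rw [hf' e _ (gle e i)]
    exact Subtype.ext (hφp' e i hi).symm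
  have hf'inj : ∀ e s t, s ≤ n e → t ≤ n e → f' e s = f' e t → s = t := by
    intro e s t hs ht hst
    rw [hf' e s hs, hf' e t ht] at hst
    exact finj e s hs t ht (congrArg Subtype.val hst)
  have hwalk : ∀ d : E(Graph.ofSimpleGraph J), ∃ q : (G.induce S).Walk
      ⟨φ (p (ed d) (idx d)), hSφ _⟩ ⟨φ (p (ed d) (idx d + 1)), hSφ _⟩, q.IsPath ∧
      (∀ v, v ∈ q.support ↔ ∃ t, g (ed d) (idx d) ≤ t ∧ t ≤ g (ed d) (idx d + 1) ∧
        v = f' (ed d) t) ∧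
      ∀ x, x ∈ q.edges ↔ ∃ t, g (ed d) (idx d) ≤ t ∧ t < g (ed d) (idx d + 1) ∧
        x = s(f' (ed d) t, f' (ed d) (t + 1)) := by
    intro d
    rw [← hf'φ _ _ (hidx d).le, ← hf'φ _ _ (hidx d)]
    obtain ⟨q, -, h1, h2, h3⟩ := exists_walk_of_seq (hf'adj (ed d)) _ _
      (gs' _ _ _ (Nat.le_succ (idx d)) (hidx d)) (gle _ _)
    exact ⟨q, h3 fun s t hs ht => hf'inj _ s t (hs.trans (gle _ _)) (ht.trans (gle _ _)), h1, h2⟩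
  choose q hqp hqs hqe using hwalk
  have hdd : ∀ d d', d ≠ d' → ed d = ed d' → idx d ≠ idx d' := fun d d' hne h1 h2 =>
    hne (Subtype.ext (by rw [hed d, hed d', h1, h2]))
  -- This is where inducedness enters: the conditions in `Realizes` leave no edges on `S` except
  -- those of the links.
  have hadj : ∀ u v, u ∈ S → v ∈ S → G.Adj u v → ∃ e s, s < n e ∧
      s(u, v) = s(f e s, f e (s + 1)) := by
    have hcl : ∀ u ∈ S, (∃ x : V(H), u = b x) ∨ ∃ e s, 0 < s ∧ s < n e ∧ u = f e s := by
      rintro u (hu | ⟨e, s, hs, rfl⟩)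
      · exact Or.inl hu
      · exact (hends e s hs).symm.imp id fun h1 => ⟨e, s, h1.1, h1.2, rfl⟩
    have hmix : ∀ (x : V(H)) e s, 0 < s → s < n e → G.Adj (b x) (f e s) →
        ∃ t < n e, s(b x, f e s) = s(f e t, f e (t + 1)) := by
      intro x e s h1 h2 h3
      have hinc := (h.avoid x e _ (hint e s h1 h2)).2 h3
      rcases (M.isLink e).eq_and_eq_or_eq_and_eq hinc.choose_spec with h4 | h4
      · rw [← h4.1, ← f0] at h3 ⊢
        have := (fadj e 0 (Nat.zero_le _) s h2.le).1 h3
        refine ⟨0, by omega, ?_⟩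
        rw [show s = 0 + 1 by omega]
      · rw [← h4.2, ← fn] at h3 ⊢
        have := (fadj e (n e) le_rfl s h2.le).1 h3
        refine ⟨s, h2, ?_⟩
        rw [show n e = s + 1 by omega, Sym2.eq_swap]
    intro u v hu hv huv
    rcases hcl u hu with ⟨x, rfl⟩ | ⟨e, s, h1, h2, rfl⟩
    · rcases hcl v hv with ⟨y, rfl⟩ | ⟨e, s, h1, h2, rfl⟩
      · exact absurd huv (h.far x y fun h => huv.ne (by rw [h])).2
      · obtain ⟨t, h3, h4⟩ := hmix x e s h1 h2 huv
        exact ⟨e, t, h3, h4⟩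
    · rcases hcl v hv with ⟨y, rfl⟩ | ⟨e', t, h3, h4, rfl⟩
      · obtain ⟨t, h3, h4⟩ := hmix y e s h1 h2 huv.symm
        exact ⟨e, t, h3, by rw [Sym2.eq_swap, h4]⟩
      · by_cases hee : e = e'
        · subst hee
          rcases (fadj e s h2.le t h4.le).1 huv with rfl | rfl
          · exact ⟨e, s, h2, rfl⟩
          · exact ⟨e, t, h4, Sym2.eq_swap⟩
        · exact absurd huv (h.anti e e' (fun h => hee (Subtype.ext h)) _ (hint e s h1 h2) _
            (hint e' t h3 h4)).2
  refine ⟨S, ⟨{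
    branch := fun w => ⟨φ w, hSφ w⟩
    src := fun d => ⟨p (ed d) (idx d), trivial⟩
    tgt := fun d => ⟨p (ed d) (idx d + 1), trivial⟩
    isLink := fun d => ⟨hed d, d.2⟩
    path := q
    branch_injective := fun w w' hww => Subtype.ext (hφinj (congrArg Subtype.val hww))
    isPath := hqp
    inc_of_branch_mem := ?_
    exists_of_mem_mem := ?_
    edges_disjoint := ?_
    vertex_covered := ?_
    edge_covered := ?_ }⟩⟩
  · intro d x hx
    obtain ⟨t, h1, h2, h3⟩ := (hqs d _).1 hx
    have htn := h2.trans (gle (ed d) _)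
    rw [hf' _ t htn] at h3
    obtain ⟨j, hj, hxj, htj⟩ := hφf _ t htn x (congrArg Subtype.val h3)
    have h4 : j = idx d ∨ j = idx d + 1 := by
      have h5 : idx d ≤ j := by
        by_contra hlt
        have := gs (ed d) j (idx d) (by omega) (hidx d).le
        omega
      have h6 : j ≤ idx d + 1 := by
        by_contra hlt
        have := gs (ed d) (idx d + 1) j (by omega) hj
        omega
      omega
    rcases h4 with rfl | rfl
    · exact ⟨p (ed d) (idx d + 1), by rw [hxj]; exact hed d, d.2⟩
    · exact ⟨p (ed d) (idx d), by rw [hxj, Sym2.eq_swap]; exact hed d, d.2⟩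
  · intro d d' hne v hv hv'
    obtain ⟨t, h1, h2, rfl⟩ := (hqs d _).1 hv
    obtain ⟨t', h1', h2', h3⟩ := (hqs d' _).1 hv'
    have htn := h2.trans (gle (ed d) _)
    have htn' := h2'.trans (gle (ed d') _)
    by_cases hee : ed d = ed d'
    · have hii := hdd d d' hne hee
      have hl1 := hidx d
      have hl2 := hidx d'
      rw [← hee] at h3 htn' h1' h2' hl2
      obtain rfl := hf'inj _ _ _ htn htn' h3
      rcases Nat.lt_or_gt_of_ne hii with h5 | h5
      · have h6 := gs' (ed d) (idx d + 1) (idx d') h5 hl2.le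
        refine ⟨⟨p (ed d) (idx d'), trivial⟩, ?_⟩
        rw [← hf'φ _ _ hl2.le, le_antisymm (h2.trans h6) h1']
      · have h6 := gs' (ed d) (idx d' + 1) (idx d) h5 hl1.le
        refine ⟨⟨p (ed d) (idx d), trivial⟩, ?_⟩
        rw [← hf'φ _ _ hl1.le, le_antisymm (h2'.trans h6) h1]
    · rw [hf' _ _ htn, hf' _ _ htn'] at h3
      obtain ⟨x, hx⟩ := hsep _ _ hee t t' htn htn' (congrArg Subtype.val h3)
      refine ⟨⟨M.branch x, trivial⟩, ?_⟩
      rw [hf' _ _ htn]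
      exact Subtype.ext ((hφb' x).trans hx.symm)
  · intro d d' hne x hx hx'
    obtain ⟨t, h1, h2, rfl⟩ := (hqe d _).1 hx
    obtain ⟨t', h1', h2', h3⟩ := (hqe d' _).1 hx'
    have htn := h2.trans_le (gle (ed d) _)
    have htn' := h2'.trans_le (gle (ed d') _)
    by_cases hee : ed d = ed d'
    · have hii := hdd d d' hne hee
      have hl1 := hidx d
      have hl2 := hidx d'
      rw [← hee] at h3 htn' h1' h2' hl2
      obtain rfl : t = t' := by
        rcases Sym2.eq_iff.1 h3 with ⟨h4, -⟩ | ⟨h4, h5⟩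
        · exact hf'inj _ _ _ htn.le htn'.le h4
        · have := hf'inj _ _ _ htn.le htn' h4
          have := hf'inj _ _ _ htn htn'.le h5
          omega
      rcases Nat.lt_or_gt_of_ne hii with h5 | h5
      · have h6 := gs' (ed d) (idx d + 1) (idx d') h5 hl2.le
        omega
      · have h6 := gs' (ed d) (idx d' + 1) (idx d) h5 hl1.le
        omega
    · have hb1 : (∃ x : V(H), f (ed d) t = b x) ∧ ∃ x : V(H), f (ed d) (t + 1) = b x := by
        rw [hf' _ _ htn.le, hf' _ _ htn'.le, hf' _ (t + 1) htn, hf' _ (t' + 1) htn'] at h3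
        rcases Sym2.eq_iff.1 h3 with ⟨h4, h5⟩ | ⟨h4, h5⟩
        · exact ⟨hsep _ _ hee _ _ htn.le htn'.le (congrArg Subtype.val h4),
            hsep _ _ hee _ _ htn htn' (congrArg Subtype.val h5)⟩
        · exact ⟨hsep _ _ hee _ _ htn.le htn' (congrArg Subtype.val h4),
            hsep _ _ hee _ _ htn htn'.le (congrArg Subtype.val h5)⟩
      obtain ⟨⟨x, hx⟩, y, hy⟩ := hb1
      have hadj' := (fadj (ed d) t htn.le (t + 1) htn).2 (Or.inl rfl)
      rw [hx, hy] at hadj'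
      exact (h.far x y fun h => hadj'.ne (by rw [h])).2 hadj'
  · rintro ⟨v, hv⟩
    rcases hv with ⟨x, rfl⟩ | ⟨e, s, hs, rfl⟩
    · exact Or.inl ⟨⟨M.branch x, trivial⟩, Subtype.ext (hφb' x)⟩
    · right
      have hse : ∃ i < len e, g e i ≤ s ∧ s ≤ g e (i + 1) := by
        rcases hs.lt_or_eq with h1 | rfl
        · obtain ⟨i, h2, h3, h4⟩ := hcov e s h1
          exact ⟨i, h2, h3, h4.le⟩
        · have := hlen0 e
          exact ⟨len e - 1, by omega, gle _ _, by rw [Nat.sub_add_cancel (by omega), gl]⟩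
      obtain ⟨i, h1, h2, h3⟩ := hse
      obtain ⟨d, rfl, rfl⟩ := hd e i h1
      exact ⟨d, (hqs d _).2 ⟨s, h2, h3, (hf' _ s hs).symm⟩⟩
  · intro x hx
    induction x with
    | h u v =>
      obtain ⟨e, s, hs, hes⟩ := hadj u v u.2 v.2 hx
      obtain ⟨i, h1, h2, h3⟩ := hcov e s hs
      obtain ⟨d, rfl, rfl⟩ := hd e i h1
      refine ⟨d, (hqe d _).2 ⟨s, h2, h3, ?_⟩⟩
      rw [hf' _ s hs.le, hf' _ (s + 1) hs]
      rcases Sym2.eq_iff.1 hes with ⟨h4, h5⟩ | ⟨h4, h5⟩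
      · exact Sym2.eq_iff.2 (Or.inl ⟨Subtype.ext h4, Subtype.ext h5⟩)
      · exact Sym2.eq_iff.2 (Or.inr ⟨Subtype.ext h4, Subtype.ext h5⟩)

end Realization

/-! ### Levels of large chromatic number, and far apart points. -/

section Levelling

variable {V : Type*} {G : SimpleGraph V}

/-- Every ball of radius `r` is `τ`-colourable. -/
def Balls (G : SimpleGraph V) (r τ : ℕ) : Prop := ∀ v, Col G {w | Near G r v w} τ

theorem Balls.mono {r s τ : ℕ} (h : Balls G s τ) (hrs : r ≤ s) : Balls G r τ :=
  fun v => (h v).mono (fun _ hw => hw.mono hrs) le_rfl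

/-- Three consecutive levels `C'`, `c`, `e` and a connected set `Y` of lower ones. -/
structure Levelling (G : SimpleGraph V) (C C' : Set V) (c e : V → V) (Y : Set V) : Prop where
  sub : C' ⊆ C
  adj : ∀ p ∈ C', G.Adj p (c p)
  adj' : ∀ p ∈ C', G.Adj (c p) (e p)
  touch : ∀ p ∈ C', ∃ y ∈ Y, G.Adj (e p) y
  mem_c : ∀ p ∈ C', c p ∈ C
  mem_e : ∀ p ∈ C', e p ∈ C
  subY : Y ⊆ C
  conn : IsConn G Y
  antiY : Anti G C' Y
  anti_e : Anti G C' (e '' C')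
  not_adj : ∀ p ∈ C', ∀ y ∈ Y, ¬ G.Adj (c p) y

theorem IsGeod.le_succ {C : Set V} {r u v : V} {m n : ℕ} {f g : ℕ → V}
    (hf : IsGeod G C {r} {u} m f) (hg : IsGeod G C {r} {v} n g) (huv : G.Adj u v) (hv : v ∈ C) :
    n ≤ m + 1 := by
  obtain ⟨p, h1, h2, -⟩ := exists_walk_of_seq hf.adj 0 m (Nat.zero_le _) le_rfl
  have hu : f m = u := hf.last
  have := hg.min (f 0) hf.zero v rfl (p.concat (hu ▸ huv)) (fun w hw => by
    rw [SimpleGraph.Walk.support_concat, List.mem_append, List.mem_singleton] at hw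
    rcases hw with hw | rfl
    · obtain ⟨t, -, ht, rfl⟩ := (h2 w).1 hw
      exact hf.mem t ht
    · exact hv)
  rw [SimpleGraph.Walk.length_concat] at this
  omega

theorem IsGeod.initial {C A : Set V} {u : V} {n : ℕ} {f : ℕ → V} (h : IsGeod G C A {u} n f)
    {i : ℕ} (hi : i ≤ n) : IsGeod G C A {f i} i f where
  mem t ht := h.mem t (ht.trans hi)
  zero := h.zero
  last := rfl
  adj t ht := h.adj t (ht.trans_le hi)
  min a ha b hb p hp := by
    obtain rfl : b = f i := hb
    obtain ⟨q, h1, h2, -⟩ := exists_walk_of_seq h.adj i n hi le_rfl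
    have := h.min a ha _ h.last (p.append q) (fun v hv => by
      rcases SimpleGraph.Walk.mem_support_append_iff _ _ |>.1 hv with hv | hv
      · exact hp v hv
      · obtain ⟨t, -, ht, rfl⟩ := (h2 v).1 hv
        exact h.mem t ht)
    rw [SimpleGraph.Walk.length_append] at this
    omega

/-- Adjacent vertices have distances from the root of their component that differ by at most one. If
all levels were `n`-colourable, a colour within the level together with the parity of the level
would give a colouring with `2 * n` colours. -/
theorem exists_level {C : Set V} {n : ℕ} (hC : ¬ Col G C (2 * n)) :
    ∃ r ∈ C, ∃ d, ¬ Col G {v | ∃ f, IsGeod G C {r} {v} d f} n := by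
  classical
  by_contra! hall
  have : Nonempty V := ⟨(nonempty_of_not_col hC).some⟩
  choose! col hcol1 hcol2 using hall
  -- The predicate from which `r v` is chosen is the same for all `v` in one component of `C`, so
  -- `r` is constant on components.
  let r : V → V := fun v => Classical.epsilon fun u => Conn G C v u
  have hr : ∀ v ∈ C, Conn G C v (r v) := fun v hv =>
    Classical.epsilon_spec (p := fun u => Conn G C v u) ⟨v, Conn.refl hv⟩
  have hgeod : ∀ v ∈ C, ∃ f, IsGeod G C {r v} {v} (dst G C {r v} {v}) f := fun v hv =>
    exists_isGeod_dst rfl rfl (hr v hv).symm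
  refine hC ⟨fun v => 2 * col (r v) (dst G C {r v} {v}) v + dst G C {r v} {v} % 2,
    fun v hv => ?_, fun u hu v hv huv => ?_⟩
  · have := hcol1 (r v) (hr v hv).right_mem (dst G C {r v} {v}) v (hgeod v hv)
    show _ + _ < _
    omega
  · have huv' := Conn.of_adj huv hu hv
    have hrr : r u = r v := by
      have : (fun w => Conn G C u w) = fun w => Conn G C v w :=
        funext fun w => propext ⟨fun h => huv'.symm.trans h, fun h => huv'.trans h⟩
      simp only [r, this]
    obtain ⟨f, hf⟩ := hgeod u hu
    obtain ⟨g, hg⟩ := hgeod v hv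
    have h3 := hcol2 (r v) (hr v hv).right_mem (dst G C {r v} {v}) u
    rw [hrr] at hf
    beta_reduce
    rw [hrr]
    have h1 := hf.le_succ hg huv hv
    have h2 := hg.le_succ hf huv.symm hu
    rcases eq_or_ne (dst G C {r v} {u}) (dst G C {r v} {v}) with h | h
    · rw [h] at hf ⊢
      have := h3 ⟨f, hf⟩ v ⟨g, hg⟩ huv
      omega
    · omega

/-- The large level is at distance `d ≥ 3` from the root, because the ball of radius two is
`τ`-colourable. The maps `c` and `e` give the two preceding vertices on a shortest walk, and `Y`
collects the levels up to `d - 3`. The anticompleteness conditions hold since levels two or more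
apart have no edges between them. -/
theorem exists_levelling {C : Set V} {n τ : ℕ} (hτ : Balls G 2 τ) (hn : τ ≤ n)
    (hC : ¬ Col G C (2 * n)) : ∃ C' c e Y, Levelling G C C' c e Y ∧ ¬ Col G C' n := by
  classical
  obtain ⟨r, hr, d, hd⟩ := exists_level hC
  have hd3 : 3 ≤ d := by
    by_contra hlt
    refine hd ((hτ r).mono ?_ hn)
    rintro v ⟨f, hf⟩
    obtain ⟨p, h1, -⟩ := exists_walk_of_seq hf.adj 0 d (Nat.zero_le _) le_rfl
    have h0 : f 0 = r := hf.zero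
    have hv : f d = v := hf.last
    subst h0 hv
    exact ⟨p, by omega⟩
  have hgap : ∀ {u v : V} {m n : ℕ}, (∃ f, IsGeod G C {r} {u} m f) →
      (∃ f, IsGeod G C {r} {v} n f) → m + 2 ≤ n → v ≠ u ∧ ¬ G.Adj v u := by
    rintro u v m n ⟨f, hf⟩ ⟨g, hg⟩ hmn
    constructor
    · rintro rfl
      have := hf.length_unique hg
      omega
    · intro hvu
      have hv : g n = v := hg.last
      have := hf.le_succ hg hvu.symm (hv ▸ hg.mem n le_rfl)
      omega
  choose! f hf using show ∀ v ∈ {v | ∃ f, IsGeod G C {r} {v} d f}, ∃ f, IsGeod G C {r} {v} d f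
    from fun v hv => hv
  have hY : ∀ v ∈ {v | ∃ m ≤ d - 3, ∃ f, IsGeod G C {r} {v} m f},
      Conn G {v | ∃ m ≤ d - 3, ∃ f, IsGeod G C {r} {v} m f} r v := by
    rintro v ⟨m, hm, g, hg⟩
    have h0 : g 0 = r := hg.zero
    have hv : g m = v := hg.last
    rw [← hv, ← h0]
    refine (hg.conn (Nat.zero_le m) le_rfl).mono ?_
    rintro _ ⟨t, -, ht, rfl⟩
    rw [h0]
    exact ⟨t, ht.trans hm, g, hg.initial ht⟩
  have hlast : ∀ p ∈ {v | ∃ f, IsGeod G C {r} {v} d f}, f p d = p := fun p hp => (hf p hp).last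
  refine ⟨{v | ∃ f, IsGeod G C {r} {v} d f}, fun p => f p (d - 1), fun p => f p (d - 2),
    {v | ∃ m ≤ d - 3, ∃ f, IsGeod G C {r} {v} m f}, ?_, hd⟩
  refine ⟨fun p hp => ?_, fun p hp => ?_, fun p hp => ?_, fun p hp => ?_, fun p hp => ?_,
    fun p hp => ?_, ?_, ⟨?_, fun u hu v hv => ?_⟩, ?_, ?_, ?_⟩
  · exact hlast p hp ▸ (hf p hp).mem d le_rfl
  · have := (hf p hp).adj (d - 1) (by omega)
    rw [Nat.sub_add_cancel (by omega), hlast p hp] at this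
    exact this.symm
  · have := (hf p hp).adj (d - 2) (by omega)
    rw [show d - 2 + 1 = d - 1 by omega] at this
    exact this.symm
  · have := (hf p hp).adj (d - 3) (by omega)
    rw [show d - 3 + 1 = d - 2 by omega] at this
    exact ⟨_, ⟨d - 3, le_rfl, _, (hf p hp).initial (by omega)⟩, this.symm⟩
  · exact (hf p hp).mem _ (by omega)
  · exact (hf p hp).mem _ (by omega)
  · rintro v ⟨m, -, g, hg⟩
    have hv : g m = v := hg.last
    exact hv ▸ hg.mem m le_rfl
  · have h0 : IsGeod G C {r} {r} 0 fun _ => r :=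
      ⟨fun _ _ => hr, rfl, rfl, fun i hi => absurd hi (Nat.not_lt_zero i),
        fun _ _ _ _ _ _ => Nat.zero_le _⟩
    exact ⟨r, 0, Nat.zero_le _, _, h0⟩
  · exact (hY u hu).symm.trans (hY v hv)
  · rintro p hp v ⟨m, hm, hv⟩
    exact hgap hv hp (by omega)
  · rintro p hp _ ⟨p', hp', rfl⟩
    exact hgap ⟨_, (hf p' hp').initial (i := d - 2) (by omega)⟩ hp (by omega)
  · rintro p hp v ⟨m, hm, hv⟩
    exact (hgap hv ⟨_, (hf p hp).initial (i := d - 1) (by omega)⟩ (by omega)).2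

/-- Greedy choice: the balls around the first `N` points use up at most `N * τ` colours. -/
theorem exists_far_points {C : Set V} {k τ : ℕ} (hτ : Balls G k τ) (N : ℕ)
    (hC : ¬ Col G C (N * τ)) : ∃ p : ℕ → V, (∀ i ≤ N, p i ∈ C) ∧
      ∀ i ≤ N, ∀ j ≤ N, i ≠ j → ¬ Near G k (p i) (p j) := by
  classical
  induction N with
  | zero =>
    obtain ⟨v, hv⟩ := nonempty_of_not_col hC
    exact ⟨fun _ => v, fun _ _ => hv, fun i hi j hj hij => by omega⟩
  | succ N ih =>
    obtain ⟨p, hp, hfar⟩ := ih fun h => hC (h.mono subset_rfl (Nat.mul_le_mul_right _ (by omega)))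
    have h1 := col_biUnion (G := G) (Finset.range (N + 1)) (fun i => {w | Near G k (p i) w})
      (n := τ) fun i _ => hτ (p i)
    rw [Finset.card_range] at h1
    obtain ⟨v, hv, hv'⟩ : ∃ v ∈ C, v ∉ {v | ∃ i ∈ Finset.range (N + 1), v ∈ {w | Near G k (p i) w}} := by
      by_contra! hc
      exact hC (h1.mono hc le_rfl)
    have hv' : ∀ i ≤ N, ¬ Near G k (p i) v := fun i hi h =>
      hv' ⟨i, Finset.mem_range.2 (by omega), h⟩
    refine ⟨fun i => if i ≤ N then p i else v, fun i hi => ?_, fun i hi j hj hij => ?_⟩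
    · by_cases h : i ≤ N
      · simpa [h] using hp i h
      · simpa [h] using hv
    · by_cases h : i ≤ N <;> by_cases h' : j ≤ N
      · simpa [h, h'] using hfar i h j h' hij
      · simpa [h, h'] using hv' i h
      · simpa [h, h'] using fun hh => hv' j h' hh.symm
      · omega

end Levelling

/-! ### Private types, and routing every edge through a type of its own. -/

section PrivateTypes

variable {V : Type*} {G : SimpleGraph V}

/-- Covers of `C` by neighbours `c i` attached to connected sets `X i`, such that the
`i`-th neighbours are attached to no other set `X j`. -/
structure PrivateTypes (G : SimpleGraph V) (C : Set V) (s : ℕ) (c : ℕ → V → V) (X : ℕ → Set V) :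
    Prop where
  conn : ∀ i < s, IsConn G (X i)
  anti : ∀ i < s, Anti G C (X i)
  adj : ∀ i < s, ∀ p ∈ C, G.Adj p (c i p)
  touch : ∀ i < s, ∀ p ∈ C, ∃ x ∈ X i, G.Adj (c i p) x
  anti' : ∀ i < s, ∀ j < s, i ≠ j → Anti G (X i) (X j)
  not_adj : ∀ i < s, ∀ j < s, i ≠ j → ∀ p ∈ C, ∀ x ∈ X j, ¬ G.Adj (c i p) x

theorem PrivateTypes.mono {C C' : Set V} {s : ℕ} {c : ℕ → V → V} {X : ℕ → Set V}
    (h : PrivateTypes G C s c X) (hC : C' ⊆ C) : PrivateTypes G C' s c X where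
  conn := h.conn
  anti i hi p hp := h.anti i hi p (hC hp)
  adj i hi p hp := h.adj i hi p (hC hp)
  touch i hi p hp := h.touch i hi p (hC hp)
  anti' := h.anti'
  not_adj i hi j hj hij p hp := h.not_adj i hi j hj hij p (hC hp)

/-- Among sufficiently many types, many have pairwise nonadjacent representatives at all points
of a subset of large chromatic number. -/
theorem PrivateTypes.exists_nonadj {C : Set V} {τ m n : ℕ} {c : ℕ → V → V} {X : ℕ → Set V}
    (h : PrivateTypes G C (τ * m) c X) (hτ : Balls G 1 τ) (hC : ¬ Col G C (τ ^ (τ * m) * n)) :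
    ∃ C' ⊆ C, ¬ Col G C' n ∧ ∃ σ : Fin m → ℕ, Function.Injective σ ∧ (∀ i, σ i < τ * m) ∧
      ∀ p ∈ C', ∀ i j, ¬ G.Adj (c (σ i) p) (c (σ j) p) := by
  classical
  choose col hcol1 hcol2 using hτ
  -- Points are sorted by the colours their labels receive in the colouring of the ball around the
  -- point. One colour pattern occurs on a large set, and by pigeonhole `m` types have equal colours
  -- in it; labels of those types at a common point are then nonadjacent.
  let F : (Fin (τ * m) → Fin τ) → Set V := fun a => {p ∈ C | ∀ i : Fin (τ * m), col p (c i p) = a i}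
  have hF : ∃ a, ¬ Col G (F a) n := by
    by_contra! hF
    have := col_biUnion Finset.univ F (n := n) fun a _ => hF a
    rw [Finset.card_univ, Fintype.card_fun, Fintype.card_fin, Fintype.card_fin] at this
    refine hC (this.mono (fun p hp => ?_) le_rfl)
    exact ⟨fun i => ⟨col p (c i p), hcol1 p _ (h.adj i i.2 p hp).near⟩, Finset.mem_univ _, hp,
      fun i => rfl⟩
  obtain ⟨a, ha⟩ := hF
  obtain ⟨b, -, hb⟩ : ∃ b ∈ (Finset.univ : Finset (Fin τ)), m ≤
      ((Finset.univ : Finset (Fin (τ * m))).filter fun i => a i = b).card := by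
    rcases Nat.eq_zero_or_pos τ with rfl | hτ0
    · obtain ⟨p, hp⟩ := nonempty_of_not_col hC
      exact absurd (hcol1 p p (Near.refl _ _)) (Nat.not_lt_zero _)
    · refine Finset.exists_le_card_fiber_of_mul_le_card_of_maps_to (fun _ _ => Finset.mem_univ _)
        ⟨⟨0, hτ0⟩, Finset.mem_univ _⟩ (by simp)
  obtain ⟨t, ht, htm⟩ := Finset.exists_subset_card_eq hb
  refine ⟨F a, fun p hp => hp.1, ha, fun i => (t.orderEmbOfFin htm i : ℕ), fun i j hij =>
    (t.orderEmbOfFin htm).injective (Fin.ext hij), fun i => (t.orderEmbOfFin htm i).2,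
    fun p hp i j hadj => ?_⟩
  have hi := (Finset.mem_filter.1 (ht (t.orderEmbOfFin_mem htm i))).2
  have hj := (Finset.mem_filter.1 (ht (t.orderEmbOfFin_mem htm j))).2
  refine hcol2 p _ (h.adj _ (Fin.is_lt _) p hp.1).near _ (h.adj _ (Fin.is_lt _) p hp.1).near hadj ?_
  rw [hp.2, hp.2, hi, hj]

/-- With sufficiently many private types, every multigraph can be realized. -/
theorem PrivateTypes.exists_realizes {α β : Type*} [Finite α] [Finite β] (H : Graph α β)
    (hloop : ∀ e x, ¬ H.IsLink e x x) {l τ : ℕ} (hτ : Balls G (l + 4) τ)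
    {C : Set V} {c : ℕ → V → V} {X : ℕ → Set V}
    (h : PrivateTypes G C (τ * Nat.card β) c X)
    (hC : ¬ Col G C (τ ^ (τ * Nat.card β) * (Nat.card α * τ))) : ∃ b I, Realizes G l H b I := by
  classical
  obtain ⟨C', hCC', hC', σ, hσ, hσlt, hσadj⟩ := h.exists_nonadj (hτ.mono (by omega)) hC
  have h' := h.mono hCC'
  obtain ⟨p', hp', hfar'⟩ := exists_far_points hτ _ hC'
  let ea := Finite.equivFin α
  let eb := Finite.equivFin β
  -- Vertices of `H` become far apart points, so only labels at the same point can interfere. Those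
  -- are nonadjacent by the choice of `C'` and `σ`.
  set p : α → V := fun x => p' (ea x) with hpdef
  have hp : ∀ x, p x ∈ C' := fun x => hp' _ (ea x).2.le
  have hfar : ∀ x y, x ≠ y → ¬ Near G (l + 4) (p x) (p y) := fun x y hxy =>
    hfar' _ (ea x).2.le _ (ea y).2.le fun hh => hxy (ea.injective (Fin.ext hh))
  set t : β → ℕ := fun e => σ (eb e) with htdef
  have ht : ∀ e, t e < τ * Nat.card β := fun e => hσlt _
  have htinj : ∀ e f, e ≠ f → t e ≠ t f := fun e f hef hh => hef (eb.injective (hσ hh))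
  have htadj : ∀ e f x, ¬ G.Adj (c (t e) (p x)) (c (t f) (p x)) := fun e f x =>
    hσadj _ (hp x) _ _
  have hlink : ∀ e, ∃ I : Set V, (∀ v ∈ I, v ∈ X (t e) ∨ ∃ x, H.Inc e x ∧ v = c (t e) (p x)) ∧
      ∀ x y, H.IsLink e x y → Link G l (p x) (p y) I := by
    intro e
    by_cases hex : ∃ x y, H.IsLink e x y
    · obtain ⟨x, y, hxy⟩ := hex
      have hne : x ≠ y := fun hh => hloop e x (by rw [← hh] at hxy; exact hxy)
      obtain ⟨u, hu, hu'⟩ := h'.touch _ (ht e) _ (hp x)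
      obtain ⟨w, hw, hw'⟩ := h'.touch _ (ht e) _ (hp y)
      set Z : Set V := {v | v ∈ X (t e) ∨ (∃ x, H.Inc e x ∧ v = c (t e) (p x)) ∨
        v ∈ ({p x, p y} : Set V)} with hZ
      have hxZ : p x ∈ Z := Or.inr (Or.inr (Or.inl rfl))
      have hyZ : p y ∈ Z := Or.inr (Or.inr (Or.inr rfl))
      have hcxZ : c (t e) (p x) ∈ Z := Or.inr (Or.inl ⟨x, ⟨y, hxy⟩, rfl⟩)
      have hcyZ : c (t e) (p y) ∈ Z := Or.inr (Or.inl ⟨y, ⟨x, hxy.symm⟩, rfl⟩)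
      have hconn : Conn G Z (p x) (p y) :=
        ((Conn.of_adj (h'.adj _ (ht e) _ (hp x)) hxZ hcxZ).trans
          (Conn.of_adj hu' hcxZ (Or.inl hu))).trans
        ((((h'.conn _ (ht e)).2 u hu w hw).mono fun v hv => Or.inl hv).trans
          ((Conn.of_adj (h'.adj _ (ht e) _ (hp y)) hyZ hcyZ).trans
          (Conn.of_adj hw' hcyZ (Or.inl hw))).symm)
      obtain ⟨I, hI, hI'⟩ := exists_link hconn fun hn => hfar x y hne (hn.mono (Nat.le_add_right l 4))
      refine ⟨I, fun v hv => ?_, fun x' y' hxy' => ?_⟩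
      · have := hI hv
        rcases this.1 with h1 | h1 | h1
        exacts [Or.inl h1, Or.inr h1, absurd h1 this.2]
      · rcases hxy.eq_and_eq_or_eq_and_eq hxy' with ⟨rfl, rfl⟩ | ⟨rfl, rfl⟩
        exacts [hI', hI'.symm]
    · exact ⟨∅, by simp, fun x y hxy => absurd ⟨x, y, hxy⟩ hex⟩
  choose I hI hIlink using hlink
  have hcX : ∀ e f x, c (t e) (p x) ∉ X (t f) := fun e f x hmem =>
    (h'.anti _ (ht f) _ (hp x) _ hmem).2 (h'.adj _ (ht e) _ (hp x))
  have hcc : ∀ e f x y, x ≠ y → c (t e) (p x) ≠ c (t f) (p y) ∧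
      ¬ G.Adj (c (t e) (p x)) (c (t f) (p y)) := by
    intro e f x y hxy
    have h1 := (h'.adj _ (ht e) _ (hp x)).near
    have h2 := (h'.adj _ (ht f) _ (hp y)).near.symm
    refine ⟨fun hh => by
      rw [← hh] at h2
      exact hfar x y hxy ((h1.trans h2).mono (by omega)), fun hh =>
      hfar x y hxy (((h1.trans hh.near).trans h2).mono (by omega))⟩
  refine ⟨p, I, ⟨fun e x y hxy => hIlink e x y hxy, fun e f hef u hu v hv => ?_, fun x e v hv => ?_,
    fun x y hxy => ⟨fun hh => hfar x y hxy (hh ▸ Near.refl _ _), fun hh =>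
      hfar x y hxy (hh.near.mono (by omega))⟩⟩⟩
  · have htt := htinj e f hef
    rcases hI e u hu with hu | ⟨x, -, rfl⟩ <;> rcases hI f v hv with hv | ⟨y, -, rfl⟩
    · exact h'.anti' _ (ht e) _ (ht f) htt u hu v hv
    · exact ⟨fun hh => hcX f e y (hh ▸ hu), fun hh =>
        h'.not_adj _ (ht f) _ (ht e) htt.symm _ (hp y) u hu hh.symm⟩
    · exact ⟨fun hh => hcX e f x (hh ▸ hv), fun hh =>
        h'.not_adj _ (ht e) _ (ht f) htt _ (hp x) v hv hh⟩
    · by_cases hxy : x = y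
      · subst hxy
        refine ⟨fun hh => ?_, htadj e f x⟩
        obtain ⟨u, hu, hu'⟩ := h'.touch _ (ht e) _ (hp x)
        exact h'.not_adj _ (ht f) _ (ht e) htt.symm _ (hp x) u hu (hh ▸ hu')
      · exact hcc e f x y hxy
  · rcases hI e v hv with hv | ⟨y, hy, rfl⟩
    · have := h'.anti _ (ht e) _ (hp x) v hv
      exact ⟨this.1.symm, fun hh => absurd hh this.2⟩
    · have h1 := h'.adj _ (ht e) _ (hp y)
      by_cases hxy : x = y
      · subst hxy
        exact ⟨h1.ne', fun _ => hy⟩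
      · exact ⟨fun hh => hfar x y hxy (by rw [← hh]; exact (h1.symm.near).mono (by omega)),
          fun hh => absurd ((hh.near.trans h1.symm.near).mono (by omega)) (hfar x y hxy)⟩

end PrivateTypes

/-! ### Systems of anticomplete links, and the combinatorics of a triangle. -/

section Systems

variable {V : Type*} {G : SimpleGraph V}

/-- A set `E` of links `(x, y, I)` that join the labels of points `x` and `y` through
interiors `I` inside `Z`, where different interiors are anticomplete and the labels of the
points of `P` have neighbours only on the links that they belong to. -/
structure IsSystem (G : SimpleGraph V) (l : ℕ) (c : V → V) (E : Set (V × V × Set V))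
    (P Z : Set V) : Prop where
  link : ∀ x y I, (x, y, I) ∈ E → Link G l (c x) (c y) I
  anti : ∀ a ∈ E, ∀ b ∈ E, a ≠ b → Anti G a.2.2 b.2.2
  avoid : ∀ p ∈ P, ∀ x y I, (x, y, I) ∈ E → ∀ v ∈ I, G.Adj (c p) v → p = x ∨ p = y
  sub : ∀ x y I, (x, y, I) ∈ E → I ⊆ Z

theorem IsSystem.union {l : ℕ} {c : V → V} {E E' : Set (V × V × Set V)} {P P' Z Z' : Set V}
    (h : IsSystem G l c E P Z) (h' : IsSystem G l c E' P' Z') (hZ : Anti G Z Z')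
    (hP : ∀ p ∈ P', p ∉ P → ∀ z ∈ Z, ¬ G.Adj (c p) z)
    (hP' : ∀ p ∈ P, p ∉ P' → ∀ z ∈ Z', ¬ G.Adj (c p) z) :
    IsSystem G l c (E ∪ E') (P ∪ P') (Z ∪ Z') where
  link x y I hI := hI.elim (h.link x y I) (h'.link x y I)
  anti a ha b hb hab := by
    rcases ha with ha | ha <;> rcases hb with hb | hb
    · exact h.anti a ha b hb hab
    · exact hZ.mono (h.sub _ _ _ ha) (h'.sub _ _ _ hb)
    · exact (hZ.mono (h.sub _ _ _ hb) (h'.sub _ _ _ ha)).symm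
    · exact h'.anti a ha b hb hab
  avoid p hp x y I hI v hv hadj := by
    rcases hI with hI | hI
    · by_cases hpP : p ∈ P
      · exact h.avoid p hpP x y I hI v hv hadj
      · exact absurd hadj (hP p (hp.resolve_left hpP) hpP v (h.sub _ _ _ hI hv))
    · by_cases hpP : p ∈ P'
      · exact h'.avoid p hpP x y I hI v hv hadj
      · exact absurd hadj (hP' p (hp.resolve_right hpP) hpP v (h'.sub _ _ _ hI hv))
  sub x y I hI := hI.elim (fun hI => (h.sub x y I hI).trans Set.subset_union_left)
    (fun hI => (h'.sub x y I hI).trans Set.subset_union_right)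

theorem IsSystem.mono {l : ℕ} {c : V → V} {E : Set (V × V × Set V)} {P P' Z Z' : Set V}
    (h : IsSystem G l c E P Z) (hP : P' ⊆ P) (hZ : Z ⊆ Z') : IsSystem G l c E P' Z' :=
  ⟨h.link, h.anti, fun p hp => h.avoid p (hP hp), fun x y I hI => (h.sub x y I hI).trans hZ⟩

/-- The system `E` has `m` parallel links from `x` to `y`. -/
def HasFat (G : SimpleGraph V) (m : ℕ) (E : Set (V × V × Set V)) (x y : V) : Prop :=
  ∃ F : ℕ → Set V, (∀ j < m, (x, y, F j) ∈ E) ∧ ∀ i < m, ∀ j < m, i ≠ j → Anti G (F i) (F j)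

theorem HasFat.mono {m : ℕ} {E E' : Set (V × V × Set V)} {x y : V} (h : HasFat G m E x y)
    (hE : E ⊆ E') : HasFat G m E' x y := by
  obtain ⟨F, h1, h2⟩ := h
  exact ⟨F, fun j hj => hE (h1 j hj), h2⟩

/-- `m` parallel links inside disjoint anticomplete sets form a system. -/
theorem exists_fat_system {l m : ℕ} {c : V → V} {x y : V} {P : Set V} (X : ℕ → Set V)
    (J : Finset ℕ) (hJ : m ≤ J.card)
    (hX : ∀ i ∈ J, ∀ j ∈ J, i ≠ j → Anti G (X i) (X j))
    (h : ∀ j ∈ J, ∃ I ⊆ X j, Link G l (c x) (c y) I ∧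
      ∀ p ∈ P, ∀ v ∈ I, G.Adj (c p) v → p = x ∨ p = y) :
    ∃ E, IsSystem G l c E P {v | ∃ j ∈ J, v ∈ X j} ∧ HasFat G m E x y := by
  classical
  choose! I hIX hI hIav using h
  obtain ⟨t, htJ, htm⟩ := Finset.exists_subset_card_eq hJ
  set σ : ℕ → ℕ := fun j => if h : j < m then t.orderEmbOfFin htm ⟨j, h⟩ else 0 with hσ
  have hσJ : ∀ j < m, σ j ∈ J := fun j hj => by
    simp only [hσ, dif_pos hj]
    exact htJ (t.orderEmbOfFin_mem htm _)
  have hσinj : ∀ i < m, ∀ j < m, i ≠ j → σ i ≠ σ j := fun i hi j hj hij h => by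
    simp only [hσ, dif_pos hi, dif_pos hj] at h
    exact hij (Fin.mk.inj_iff.1 ((t.orderEmbOfFin htm).injective h))
  refine ⟨{a | ∃ j ∈ J, a = (x, y, I j)}, ⟨?_, ?_, ?_, ?_⟩, fun j => I (σ j),
    fun j hj => ⟨σ j, hσJ j hj, rfl⟩, fun i hi j hj hij =>
      (hX _ (hσJ i hi) _ (hσJ j hj) (hσinj i hi j hj hij)).mono (hIX _ (hσJ i hi))
        (hIX _ (hσJ j hj))⟩
  · rintro _ _ _ ⟨j, hj, h⟩
    simp only [Prod.mk.injEq] at h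
    obtain ⟨rfl, rfl, rfl⟩ := h
    exact hI j hj
  · rintro _ ⟨i, hi, rfl⟩ _ ⟨j, hj, rfl⟩ hij
    have : i ≠ j := by rintro rfl; exact hij rfl
    exact (hX i hi j hj this).mono (hIX i hi) (hIX j hj)
  · rintro p hp _ _ _ ⟨j, hj, h⟩
    simp only [Prod.mk.injEq] at h
    obtain ⟨rfl, rfl, rfl⟩ := h
    exact hIav j hj p hp
  · rintro _ _ _ ⟨j, hj, h⟩ v hv
    simp only [Prod.mk.injEq] at h
    obtain ⟨rfl, rfl, rfl⟩ := h
    exact ⟨j, hj, hIX j hj hv⟩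

theorem isSystem_singleton {l : ℕ} {c : V → V} {x y : V} {I P : Set V}
    (h : Link G l (c x) (c y) I) (hav : ∀ p ∈ P, ∀ v ∈ I, G.Adj (c p) v → p = x ∨ p = y) :
    IsSystem G l c {(x, y, I)} P I := by
  refine ⟨?_, ?_, ?_, ?_⟩
  · rintro _ _ _ h'
    simp only [Set.mem_singleton_iff, Prod.mk.injEq] at h'
    obtain ⟨rfl, rfl, rfl⟩ := h'
    exact h
  · rintro a rfl b rfl hab
    exact absurd rfl hab
  · rintro p hp _ _ _ h'
    simp only [Set.mem_singleton_iff, Prod.mk.injEq] at h'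
    obtain ⟨rfl, rfl, rfl⟩ := h'
    exact hav p hp
  · rintro _ _ _ h'
    simp only [Set.mem_singleton_iff, Prod.mk.injEq] at h'
    obtain ⟨rfl, rfl, rfl⟩ := h'
    exact subset_rfl

/-- The links of a triangle can use the channels described by `av`. -/
structure Triangle (av : V → V → V → Option ℕ → Prop) (J : Finset ℕ) (p q r : V) : Prop where
  ex₁ : ∃ h, av p q r h
  ex₂ : ∃ h, av q r p h
  ex₃ : ∃ h, av r p q h
  or₁ : ∀ j ∈ J, av p q r (some j) ∨ av q r p (some j)
  or₂ : ∀ j ∈ J, av q r p (some j) ∨ av r p q (some j)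
  or₃ : ∀ j ∈ J, av r p q (some j) ∨ av p q r (some j)

theorem Triangle.rotate {av : V → V → V → Option ℕ → Prop} {J : Finset ℕ} {p q r : V}
    (h : Triangle av J p q r) : Triangle av J q r p :=
  ⟨h.ex₂, h.ex₃, h.ex₁, h.or₂, h.or₃, h.or₁⟩

/-- Each channel fails for at most one of the three pairs, so it joins `p` to `q` or to `r`. The
more frequent partner becomes `t`, with at least `m + 2` channels. The single links to `u` need two
different channels; if the ones at hand coincide, any other channel of `J` serves one of the two
pairs. Discarding these two leaves `m`. -/
theorem Triangle.exists_roles {av : V → V → V → Option ℕ → Prop} {J : Finset ℕ} {p q r : V}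
    (h : Triangle av J p q r) (hsymm : ∀ p q r h, av p q r h → av q p r h) {m : ℕ}
    (hm : 2 * m + 4 ≤ J.card) : ∃ t u, ((t = q ∧ u = r) ∨ (t = r ∧ u = q)) ∧
      ∃ h₁ h₂, h₁ ≠ h₂ ∧ av p u t h₁ ∧ av t u p h₂ ∧ ∃ J' ⊆ J, m ≤ J'.card ∧
        ∀ j ∈ J', some j ≠ h₁ ∧ some j ≠ h₂ ∧ av p t u (some j) := by
  classical
  have main : ∀ t u, (∃ h, av p u t h) → (∃ h, av t u p h) →
      (∀ j ∈ J, av p u t (some j) ∨ av t u p (some j)) →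
      m + 2 ≤ (J.filter fun j => av p t u (some j)).card →
      ∃ h₁ h₂, h₁ ≠ h₂ ∧ av p u t h₁ ∧ av t u p h₂ ∧ ∃ J' ⊆ J, m ≤ J'.card ∧
        ∀ j ∈ J', some j ≠ h₁ ∧ some j ≠ h₂ ∧ av p t u (some j) := by
    rintro t u ⟨g₁, hg₁⟩ ⟨g₂, hg₂⟩ hor hcard
    have hdist : ∃ h₁ h₂, h₁ ≠ h₂ ∧ av p u t h₁ ∧ av t u p h₂ := by
      by_cases hg : g₁ = g₂
      · subst hg
        obtain ⟨j, hj, hjg⟩ : ∃ j ∈ J, some j ≠ g₁ := by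
          obtain ⟨i, hi, j, hj, hij⟩ := Finset.one_lt_card.1 (show 1 < J.card by omega)
          by_cases hig : some i = g₁
          · exact ⟨j, hj, fun hjg => hij (Option.some.inj (hig.trans hjg.symm))⟩
          · exact ⟨i, hi, hig⟩
        rcases hor j hj with h1 | h1
        · exact ⟨some j, g₁, hjg, h1, hg₂⟩
        · exact ⟨g₁, some j, hjg.symm, hg₁, h1⟩
      · exact ⟨g₁, g₂, hg, hg₁, hg₂⟩
    obtain ⟨h₁, h₂, hne, ha₁, ha₂⟩ := hdist
    -- The default `0` for `none` is harmless: each erasure loses at most one channel, and two were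
    -- kept in reserve.
    refine ⟨h₁, h₂, hne, ha₁, ha₂, ((J.filter fun j => av p t u (some j)).erase (h₁.getD 0)).erase
      (h₂.getD 0), ?_, ?_, ?_⟩
    · exact (Finset.erase_subset _ _).trans ((Finset.erase_subset _ _).trans
        (Finset.filter_subset _ _))
    · have := Finset.pred_card_le_card_erase (s := (J.filter fun j => av p t u (some j)))
        (a := h₁.getD 0)
      have := Finset.pred_card_le_card_erase
        (s := (J.filter fun j => av p t u (some j)).erase (h₁.getD 0)) (a := h₂.getD 0)
      omega
    · intro j hj
      rw [Finset.mem_erase, Finset.mem_erase, Finset.mem_filter] at hj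
      refine ⟨?_, ?_, hj.2.2.2⟩
      · rintro rfl; exact hj.2.1 rfl
      · rintro rfl; exact hj.1 rfl
  have hcard : J.card ≤ (J.filter fun j => av p q r (some j)).card +
      (J.filter fun j => av p r q (some j)).card := by
    refine le_trans (Finset.card_le_card fun j hj => ?_) (Finset.card_union_le _ _)
    rw [Finset.mem_union, Finset.mem_filter, Finset.mem_filter]
    exact (h.or₃ j hj).symm.imp (fun h1 => ⟨hj, h1⟩) (fun h1 => ⟨hj, hsymm _ _ _ _ h1⟩)
  rcases le_or_gt (m + 2) (J.filter fun j => av p q r (some j)).card with h1 | h1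
  · exact ⟨q, r, Or.inl ⟨rfl, rfl⟩, main q r (h.ex₃.imp fun _ => hsymm _ _ _ _) h.ex₂
      (fun j hj => (h.or₂ j hj).symm.imp_left (hsymm _ _ _ _)) h1⟩
  · exact ⟨r, q, Or.inr ⟨rfl, rfl⟩, main r q h.ex₁ (h.ex₂.imp fun _ => hsymm _ _ _ _)
      (fun j hj => (h.or₁ j hj).imp_right (hsymm _ _ _ _)) (by omega)⟩

/-- A system that consists of `m` links from `s` to `t` and single links from `s` and `t`
to `u`. -/
def HasEar (G : SimpleGraph V) (m : ℕ) (E : Set (V × V × Set V)) (s t u : V) : Prop :=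
  HasFat G m E s t ∧ (∃ I, (s, u, I) ∈ E) ∧ ∃ I, (t, u, I) ∈ E

theorem HasEar.mono {m : ℕ} {E E' : Set (V × V × Set V)} {s t u : V} (h : HasEar G m E s t u)
    (hE : E ⊆ E') : HasEar G m E' s t u :=
  ⟨h.1.mono hE, h.2.1.imp fun _ hI => hE hI, h.2.2.imp fun _ hI => hE hI⟩

end Systems

/-! ### Construction of an ear from a group of channels. -/

section Ears

variable {V : Type*} {G : SimpleGraph V}

/-- Connected sets `R j` inside anticomplete sets `X j`, to which each label `c p` is attached
directly or through `e j p`. -/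
structure PortGroup (G : SimpleGraph V) (c : V → V) (L : Set V) (J : Finset ℕ) (R : ℕ → Set V)
    (e : ℕ → V → V) (X : ℕ → Set V) : Prop where
  adj : ∀ p ∈ L, G.Adj p (c p)
  conn : ∀ j ∈ J, IsConn G (R j)
  subX : ∀ j ∈ J, R j ⊆ X j
  mem_e : ∀ j ∈ J, ∀ p ∈ L, e j p ∈ X j
  adj_e : ∀ j ∈ J, ∀ p ∈ L, G.Adj (c p) (e j p)
  port : ∀ j ∈ J, ∀ p ∈ L, ∃ x ∈ R j, G.Adj (c p) x ∨ G.Adj (e j p) x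
  anti : ∀ i ∈ J, ∀ j ∈ J, i ≠ j → Anti G (X i) (X j)
  antiL : ∀ j ∈ J, Anti G (X j) L

/-- A port is within distance three of its point, so a common port puts two points within distance
six. -/
theorem PortGroup.ports {c : V → V} {L : Set V} {J : Finset ℕ} {R : ℕ → Set V} {e : ℕ → V → V}
    {X : ℕ → Set V} (h : PortGroup G c L J R e X) {k : ℕ} (hk : 6 ≤ k) {j : ℕ} (hj : j ∈ J) :
    Ports G k L (R j) c (fun p => {x ∈ R j | G.Adj (c p) x ∨ G.Adj (e j p) x}) where
  adj := h.adj
  conn := h.conn j hj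
  sub p _ x hx := hx.1
  nonempty p hp := by
    obtain ⟨x, hx, hx'⟩ := h.port j hj p hp
    exact ⟨x, hx, hx'⟩
  disj p hp q hq hpq := by
    rw [Set.disjoint_left]
    have near : ∀ p ∈ L, ∀ x, (G.Adj (c p) x ∨ G.Adj (e j p) x) → Near G 3 p x := by
      rintro p hp x (hx | hx)
      · exact ((h.adj p hp).near.trans hx.near).mono (by omega)
      · exact ((h.adj p hp).near.trans (h.adj_e j hj p hp).near).trans hx.near
    intro x hx hx'
    exact hpq (((near p hp x hx.2).trans (near q hq x hx'.2).symm).mono hk)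

theorem not_near_label {l : ℕ} {c : V → V} {p q : V} (hp : G.Adj p (c p)) (hq : G.Adj q (c q))
    (h : ¬ Near G (l + 2) p q) : ¬ Near G l (c p) (c q) := fun h' =>
  h (((hp.near.trans h').trans hq.near.symm).mono (by omega))

set_option maxHeartbeats 1000000 in
-- The cluster lemma is applied in one channel `j₀` only; it joins all three pairs there, except
-- that one pair may have to use `W` instead. In every channel connectivity alone joins two of the
-- three pairs, and this suffices for `Triangle`. The conclusion lets any of the points play the
-- role of `s`, since the point at which the ear gets attached is determined elsewhere.
theorem PortGroup.exists_ear [Finite V] {c : V → V} {L : Set V} {J : Finset ℕ} {R : ℕ → Set V}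
    {e : ℕ → V → V} {X : ℕ → Set V} (h : PortGroup G c L J R e X) {l m τ : ℕ}
    (hJ : 2 * m + 4 ≤ J.card) (hτ : Balls G (4 * l + 42) τ) (hL : ¬ Col G L (2 * τ)) :
    ∃ S : Finset V, S.card ≤ 3 ∧ S.Nonempty ∧ ↑S ⊆ L ∧
      (∀ s ∈ S, ∀ t ∈ S, s ≠ t → ¬ Near G (l + 10) s t) ∧
      ∃ W ⊆ L, (∃ a b d, ∀ v ∈ W, Near G (l + 11) a v ∨ Near G (l + 11) b v ∨
        Near G (l + 11) d v) ∧
      ∀ s ∈ S, ∃ t ∈ S, ∃ u ∈ S, s ≠ t ∧ s ≠ u ∧ t ≠ u ∧ ∃ E, IsSystem G l c E S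
        (W ∪ {x | ∃ j ∈ J, x ∈ R j ∪ e j '' S}) ∧ HasEar G m E s t u := by
  classical
  obtain ⟨j₀, hj₀⟩ := Finset.card_pos.1 (show 0 < J.card by omega)
  set N : ℕ → V → Set V := fun j p => {x ∈ R j | G.Adj (c p) x ∨ G.Adj (e j p) x} with hN
  have hports : ∀ j ∈ J, Ports G (l + 10) L (R j) c (N j) := fun j hj => h.ports (by omega) hj
  -- With `k = l + 10` the cluster lemma needs balls of radius `2 * (2 * k + 1) = 4 * l + 42`.
  obtain ⟨p, q, r, hp, hq, hr, hpq, hqr, hpr, hv₁, hv₂, hv₃⟩ :=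
    exists_isCluster (by omega) (hτ.mono (by omega)) (hports j₀ hj₀) hL
  have hW : ∃ W ⊆ L, (∃ a b d, ∀ v ∈ W, Near G (l + 11) a v ∨ Near G (l + 11) b v ∨
      Near G (l + 11) d v) ∧ (Vis G (R j₀) (N j₀) p r q ∨
      (∃ x ∈ W, ∃ y ∈ W, G.Adj (c p) x ∧ G.Adj (c r) y ∧ Conn G W x y) ∧
        ∀ v ∈ W, ¬ G.Adj (c q) v) := by
    rcases hv₃ with hv₃ | ⟨W, hWL, hW₁, hW₂, hW₃⟩
    · exact ⟨∅, Set.empty_subset _, ⟨p, p, p, by simp⟩, Or.inl hv₃⟩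
    · exact ⟨W, hWL, hW₃, Or.inr ⟨hW₁, hW₂⟩⟩
  obtain ⟨W, hWL, hWnear, hW⟩ := hW
  set S : Finset V := {p, q, r} with hS
  have hSL : ∀ s ∈ S, s ∈ L := by
    intro s hs
    simp only [hS, Finset.mem_insert, Finset.mem_singleton] at hs
    rcases hs with rfl | rfl | rfl <;> assumption
  have hSfar : ∀ s ∈ S, ∀ t ∈ S, s ≠ t → ¬ Near G (l + 10) s t := by
    intro s hs t ht hst
    simp only [hS, Finset.mem_insert, Finset.mem_singleton] at hs ht
    rcases hs with rfl | rfl | rfl <;> rcases ht with rfl | rfl | rfl <;>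
      first | exact absurd rfl hst | assumption | exact fun hh => hpq hh.symm |
        exact fun hh => hqr hh.symm | exact fun hh => hpr hh.symm
  -- the channels
  obtain ⟨av, avsome, avnone⟩ : ∃ av : V → V → V → Option ℕ → Prop,
      (∀ x y z j, av x y z (some j) ↔ j ∈ J ∧ Vis G (R j) (N j) x y z) ∧
      ∀ x y z, av x y z none ↔ (∃ a ∈ W, ∃ b ∈ W, G.Adj (c x) a ∧ G.Adj (c y) b ∧
        Conn G W a b) ∧ ∀ v ∈ W, ¬ G.Adj (c z) v :=
    ⟨fun x y z g => match g with
      | some j => j ∈ J ∧ Vis G (R j) (N j) x y z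
      | none => (∃ a ∈ W, ∃ b ∈ W, G.Adj (c x) a ∧ G.Adj (c y) b ∧ Conn G W a b) ∧
        ∀ v ∈ W, ¬ G.Adj (c z) v, fun _ _ _ _ => Iff.rfl, fun _ _ _ => Iff.rfl⟩
  -- The territory of each channel, with `none` standing for the local set `W`. It is empty for
  -- indices outside `J`, so different channels are anticomplete without exception.
  obtain ⟨Z, Zsome, Znone⟩ : ∃ Z : Option ℕ → Set V,
      (∀ j, Z (some j) = {x | j ∈ J ∧ x ∈ R j ∪ e j '' S}) ∧ Z none = W :=
    ⟨fun g => match g with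
      | some j => {x | j ∈ J ∧ x ∈ R j ∪ e j '' S}
      | none => W, fun _ => rfl, rfl⟩
  have avsymm : ∀ x y z g, av x y z g → av y x z g := by
    rintro x y z (_ | j)
    · rw [avnone, avnone]
      rintro ⟨⟨a, ha, b, hb, h1, h2, h3⟩, h4⟩
      exact ⟨⟨b, hb, a, ha, h2, h1, h3.symm⟩, h4⟩
    · rw [avsome, avsome]
      rintro ⟨hj, hv⟩
      exact ⟨hj, hv.symm⟩
  have hvis : ∀ j ∈ J, ∀ x ∈ S, ∀ y ∈ S, ∀ z ∈ S, y ≠ z →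
      av x y z (some j) ∨ av z x y (some j) := by
    intro j hj x hx y hy z hz hyz
    by_cases hv : Vis G (R j) (N j) x z y
    · exact Or.inr ((avsome _ _ _ _).2 ⟨hj, hv.symm⟩)
    · exact Or.inl ((avsome _ _ _ _).2 ⟨hj, (hports j hj).vis (hSL x hx) (hSL y hy) (hSL z hz)
        (hSfar y hy z hz hyz) hv⟩)
  have hpS : p ∈ S := by simp [hS]
  have hqS : q ∈ S := by simp [hS]
  have hrS : r ∈ S := by simp [hS]
  have npq : p ≠ q := fun hh => hpq (hh ▸ Near.refl _ _)
  have nqr : q ≠ r := fun hh => hqr (hh ▸ Near.refl _ _)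
  have npr : p ≠ r := fun hh => hpr (hh ▸ Near.refl _ _)
  have htri : Triangle av J p q r := by
    refine ⟨⟨some j₀, (avsome _ _ _ _).2 ⟨hj₀, hv₁⟩⟩,
      ⟨some j₀, (avsome _ _ _ _).2 ⟨hj₀, hv₂⟩⟩, ?_, fun j hj => ?_, fun j hj => ?_,
      fun j hj => ?_⟩
    · rcases hW with hW | hW
      · exact ⟨some j₀, (avsome _ _ _ _).2 ⟨hj₀, hW.symm⟩⟩
      · exact ⟨none, avsymm _ _ _ _ ((avnone _ _ _).2 hW)⟩
    · exact (hvis j hj q hqS p hpS r hrS npr).imp (avsymm _ _ _ _) (avsymm _ _ _ _)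
    · exact (hvis j hj r hrS q hqS p hpS npq.symm).imp (avsymm _ _ _ _) (avsymm _ _ _ _)
    · exact (hvis j hj p hpS r hrS q hqS nqr.symm).imp (avsymm _ _ _ _) (avsymm _ _ _ _)
  have hZanti : ∀ g g', g ≠ g' → Anti G (Z g) (Z g') := by
    have hX : ∀ j, Z (some j) ⊆ {x | j ∈ J ∧ x ∈ X j} := by
      intro j
      rw [Zsome]
      rintro x ⟨hj, hx | ⟨s, hs, rfl⟩⟩
      · exact ⟨hj, h.subX j hj hx⟩
      · exact ⟨hj, h.mem_e j hj s (hSL s hs)⟩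
    rintro (_ | i) (_ | j) hij
    · exact absurd rfl hij
    · rw [Znone]
      exact fun a ha b hb => (h.antiL j (hX j hb).1).symm a (hWL ha) b (hX j hb).2
    · rw [Znone]
      exact fun a ha b hb => h.antiL i (hX i ha).1 a (hX i ha).2 b (hWL hb)
    · exact fun a ha b hb => h.anti i (hX i ha).1 j (hX j hb).1 (fun hh => hij (by rw [hh])) a
        (hX i ha).2 b (hX j hb).2
  have hlink : ∀ x ∈ S, ∀ y ∈ S, ∀ z ∈ S, x ≠ y → x ≠ z → y ≠ z →
      (∀ s ∈ S, s = x ∨ s = y ∨ s = z) → ∀ g, av x y z g →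
      ∃ I ⊆ Z g, Link G l (c x) (c y) I ∧ ∀ s ∈ S, ∀ v ∈ I, G.Adj (c s) v → s = x ∨ s = y := by
    intro x hx y hy z hz hxy hxz hyz hall g hg
    have hnear : ¬ Near G l (c x) (c y) := not_near_label (h.adj x (hSL x hx))
      (h.adj y (hSL y hy)) fun hh => hSfar x hx y hy hxy (hh.mono (by omega))
    suffices hsuff : ∃ Q : Set V, Q ⊆ Z g ∧ (∀ v ∈ Q, ¬ G.Adj (c z) v) ∧
        Conn G (Q ∪ {c x, c y}) (c x) (c y) by
      obtain ⟨Q, hQZ, hQz, hQ⟩ := hsuff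
      obtain ⟨I, hI, hI'⟩ := exists_link hQ hnear
      have hIQ : I ⊆ Q := fun v hv => (hI hv).1.resolve_right (hI hv).2
      refine ⟨I, hIQ.trans hQZ, hI', fun s hs v hv hadj => ?_⟩
      rcases hall s hs with h1 | h1 | rfl
      · exact Or.inl h1
      · exact Or.inr h1
      · exact absurd hadj (hQz v (hIQ hv))
    rcases g with _ | j
    · obtain ⟨⟨a, ha, b, hb, h1, h2, h3⟩, h4⟩ := (avnone _ _ _).1 hg
      rw [Znone]
      exact ⟨W, subset_rfl, h4, ((Conn.of_adj h1 (by simp) (Or.inl ha)).trans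
        (h3.mono Set.subset_union_left)).trans (Conn.of_adj h2 (by simp) (Or.inl hb)).symm⟩
    · obtain ⟨hj, a, ha, b, hb, hconn⟩ := (avsome _ _ _ _).1 hg
      rw [Zsome]
      have hez : ∀ s ∈ S, s ≠ z → ¬ G.Adj (c z) (e j s) := fun s hs hsz hadj =>
        hSfar s hs z hz hsz (((((h.adj s (hSL s hs)).near.trans
          (h.adj_e j hj s (hSL s hs)).near).trans hadj.near.symm).trans
          (h.adj z (hSL z hz)).near.symm).mono (by omega))
      -- Removing `N j z` keeps the route off the neighbours of the label of `z`. The vertices `e j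
      -- x` and `e j y` may be needed to get from a label to its port, and they are too far from `z`
      -- to be adjacent to its label.
      set Q : Set V := (R j \ N j z) ∪ {e j x, e j y} with hQ
      have hQx : e j x ∈ Q := Or.inr (Or.inl rfl)
      have hQy : e j y ∈ Q := Or.inr (Or.inr rfl)
      have hstart : ∀ s ∈ S, e j s ∈ Q → c s ∈ Q ∪ {c x, c y} → ∀ a ∈ N j s, a ∈ Q →
          Conn G (Q ∪ {c x, c y}) (c s) a := by
        rintro s hs heQ hcs a ⟨-, ha | ha⟩ haQ
        · exact Conn.of_adj ha hcs (Or.inl haQ)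
        · exact (Conn.of_adj (h.adj_e j hj s (hSL s hs)) hcs (Or.inl heQ)).trans
            (Conn.of_adj ha (Or.inl heQ) (Or.inl haQ))
      refine ⟨Q, ?_, ?_, ?_⟩
      · rintro v (hv | rfl | rfl)
        · exact ⟨hj, Or.inl hv.1⟩
        · exact ⟨hj, Or.inr ⟨x, hx, rfl⟩⟩
        · exact ⟨hj, Or.inr ⟨y, hy, rfl⟩⟩
      · rintro v (hv | rfl | rfl)
        · exact fun hadj => hv.2 ⟨hv.1, Or.inl hadj⟩
        · exact hez x hx hxz
        · exact hez y hy hyz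
      · exact ((hstart x hx hQx (by simp) a ha (Or.inl hconn.left_mem)).trans
          (hconn.mono (fun v hv => Or.inl (Or.inl hv)))).trans
          (hstart y hy hQy (by simp) b hb (Or.inl hconn.right_mem)).symm
  refine ⟨S, Finset.card_le_three, ⟨p, hpS⟩, hSL, hSfar, W, hWL, hWnear, ?_⟩
  have main : ∀ x ∈ S, ∀ y ∈ S, ∀ z ∈ S, x ≠ y → x ≠ z → y ≠ z →
      (∀ s ∈ S, s = x ∨ s = y ∨ s = z) → Triangle av J x y z →
      ∃ t ∈ S, ∃ u ∈ S, x ≠ t ∧ x ≠ u ∧ t ≠ u ∧ ∃ E, IsSystem G l c E S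
        (W ∪ {x | ∃ j ∈ J, x ∈ R j ∪ e j '' S}) ∧ HasEar G m E x t u := by
    intro x hx y hy z hz hxy hxz hyz hall htri
    obtain ⟨t, u, htu, g₁, g₂, hg, ha₁, ha₂, J', hJ'J, hJ'm, hJ'⟩ := htri.exists_roles avsymm hJ
    obtain ⟨htS, huS, hxt, hxu, htu', hall'⟩ : t ∈ S ∧ u ∈ S ∧ x ≠ t ∧ x ≠ u ∧ t ≠ u ∧
        ∀ s ∈ S, s = x ∨ s = t ∨ s = u := by
      rcases htu with ⟨rfl, rfl⟩ | ⟨rfl, rfl⟩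
      · exact ⟨hy, hz, hxy, hxz, hyz, hall⟩
      · exact ⟨hz, hy, hxz, hxy, hyz.symm, fun s hs => (hall s hs).imp_right Or.symm⟩
    obtain ⟨I₁, hI₁Z, hI₁, hI₁av⟩ := hlink x hx u huS t htS hxu hxt htu'.symm
      (fun s hs => (hall' s hs).imp_right Or.symm) g₁ ha₁
    obtain ⟨I₂, hI₂Z, hI₂, hI₂av⟩ := hlink t htS u huS x hx htu' hxt.symm hxu.symm
      (fun s hs => by have := hall' s hs; tauto) g₂ ha₂
    obtain ⟨E, hE, hfat⟩ := exists_fat_system (G := G) (l := l) (m := m) (c := c) (x := x) (y := t)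
      (P := S) (fun j => Z (some j)) J' hJ'm
      (fun i hi j hj hij => hZanti _ _ fun hh => hij (Option.some.inj hh))
      (fun j hj => hlink x hx t htS u huS hxt hxu htu' hall' (some j) (hJ' j hj).2.2)
    have hZsub : ∀ g, Z g ⊆ W ∪ {x | ∃ j ∈ J, x ∈ R j ∪ e j '' S} := by
      rintro (_ | j) v hv
      · exact Or.inl (Znone ▸ hv)
      · rw [Zsome] at hv
        exact Or.inr ⟨j, hv.1, hv.2⟩
    have hsys := ((isSystem_singleton hI₁ hI₁av).mono subset_rfl hI₁Z).union
      ((isSystem_singleton hI₂ hI₂av).mono subset_rfl hI₂Z) (hZanti _ _ hg)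
      (fun s hs hs' => absurd hs hs') (fun s hs hs' => absurd hs hs')
    have hsys' := hsys.union (P' := S) hE (by
      rintro a (ha | ha) b ⟨j, hj, hb⟩
      · exact hZanti g₁ (some j) (hJ' j hj).1.symm a ha b hb
      · exact hZanti g₂ (some j) (hJ' j hj).2.1.symm a ha b hb)
      (fun s hs hs' => (hs' (Or.inl hs)).elim) (fun s hs hs' => absurd (hs.elim id id) hs')
    refine ⟨t, htS, u, huS, hxt, hxu, htu', _, hsys'.mono (fun s hs => Or.inr hs) ?_,
      hfat.mono Set.subset_union_right, ⟨I₁, Or.inl (Or.inl rfl)⟩, ⟨I₂, Or.inl (Or.inr rfl)⟩⟩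
    rintro v ((hv | hv) | ⟨j, hj, hv⟩)
    exacts [hZsub _ hv, hZsub _ hv, hZsub _ hv]
  intro s hs
  have hall : ∀ s ∈ S, s = p ∨ s = q ∨ s = r := fun s hs => by
    simpa only [hS, Finset.mem_insert, Finset.mem_singleton] using hs
  have hq' : ∀ s ∈ S, s = q ∨ s = r ∨ s = p := fun s hs => by have := hall s hs; tauto
  have hr' : ∀ s ∈ S, s = r ∨ s = p ∨ s = q := fun s hs => by have := hall s hs; tauto
  rcases hall s hs with h1 | h1 | h1 <;> rw [h1]
  · exact main p hpS q hqS r hrS npq npr nqr hall htri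
  · exact main q hqS r hrS p hpS nqr npq.symm npr.symm hq' htri.rotate
  · exact main r hrS p hpS q hqS npr.symm nqr.symm npq hr' htri.rotate.rotate

end Ears

/-! ### Groups of connected sets touched by all labels, and the last step of the tail. -/

section Groups

variable {V : Type*} {G : SimpleGraph V}

/-- Connected anticomplete sets `X j` inside `Z` that are anticomplete to `D` and to which all
labels of points of `D` are attached. -/
structure IsGroup (G : SimpleGraph V) (c : V → V) (Z D : Set V) (M : ℕ) (X : ℕ → Set V) :
    Prop where
  conn : ∀ j < M, IsConn G (X j)
  sub : ∀ j < M, X j ⊆ Z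
  anti : ∀ i < M, ∀ j < M, i ≠ j → Anti G (X i) (X j)
  antiD : ∀ j < M, Anti G (X j) D
  touch : ∀ j < M, ∀ p ∈ D, ∃ x ∈ X j, G.Adj (c p) x

/-- Every subset of `C₀` that is not `K (r + 1)`-colourable contains a connected set and a set
anticomplete to it that is not `K r`-colourable and whose labels are attached to it; moreover,
`K` grows fast. -/
structure IsScale (G : SimpleGraph V) (c : V → V) (C₀ : Set V) (B R : ℕ) (K : ℕ → ℕ) : Prop where
  attach : ∀ r < R, ∀ C ⊆ C₀, ¬ Col G C (K (r + 1)) → ∃ X ⊆ C, ∃ C' ⊆ C, IsConn G X ∧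
    Anti G X C' ∧ (∀ p ∈ C', ∃ x ∈ X, G.Adj (c p) x) ∧ ¬ Col G C' (K r)
  grow : ∀ r, B * (K r + 1) ≤ K (r + 1)
  base : B ≤ K 0

variable {c : V → V} {C₀ : Set V} {B R : ℕ} {K : ℕ → ℕ}

theorem IsScale.base_le (h : IsScale G c C₀ B R K) (r : ℕ) : B ≤ K r := by
  cases r with
  | zero => exact h.base
  | succ r => exact (Nat.le_mul_of_pos_right B (Nat.succ_pos _)).trans (h.grow r)

/-- Every use of `attach` yields one connected set and lowers the scale by one. The next set is
sought inside the remaining part, which is anticomplete to the earlier sets and whose labels touch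
all of them. -/
theorem IsScale.exists_group (h : IsScale G c C₀ B R K) (M : ℕ) : ∀ (r : ℕ) {C : Set V}, C ⊆ C₀ →
    r + M ≤ R → ¬ Col G C (K (r + M)) → ∃ X, ∃ C' ⊆ C, IsGroup G c C C' M X ∧ ¬ Col G C' (K r) := by
  classical
  induction M with
  | zero =>
    intro r C _ _ hC
    exact ⟨fun _ => ∅, C, subset_rfl, ⟨by simp, by simp, by simp, by simp, by simp⟩, hC⟩
  | succ M ih =>
    intro r C hCC₀ hr hC
    obtain ⟨X, C₁, hC₁, hX, hC₁'⟩ := ih (r + 1) hCC₀ (by omega)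
      (by rwa [show r + 1 + M = r + (M + 1) by omega])
    obtain ⟨Y, hY, C₂, hC₂, hYconn, hYanti, hYtouch, hC₂'⟩ :=
      h.attach r (by omega) C₁ (hC₁.trans hCC₀) hC₁'
    set X' : ℕ → Set V := fun j => if j < M then X j else Y with hX'
    have h1 : ∀ j < M, X' j = X j := fun j hj => by simp [hX', hj]
    have h2 : X' M = Y := by simp [hX']
    refine ⟨X', C₂, hC₂.trans hC₁, ⟨fun j hj => ?_, fun j hj => ?_, fun i hi j hj hij => ?_,
      fun j hj => ?_, fun j hj => ?_⟩, hC₂'⟩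
    · rcases Nat.lt_succ_iff_lt_or_eq.1 hj with hj | rfl
      · rw [h1 j hj]; exact hX.conn j hj
      · rw [h2]; exact hYconn
    · rcases Nat.lt_succ_iff_lt_or_eq.1 hj with hj | rfl
      · rw [h1 j hj]; exact hX.sub j hj
      · rw [h2]; exact hY.trans hC₁
    · rcases Nat.lt_succ_iff_lt_or_eq.1 hi with hi | rfl <;>
        rcases Nat.lt_succ_iff_lt_or_eq.1 hj with hj | rfl
      · rw [h1 i hi, h1 j hj]; exact hX.anti i hi j hj hij
      · rw [h1 i hi, h2]; exact (hX.antiD i hi).mono subset_rfl hY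
      · rw [h1 j hj, h2]; exact ((hX.antiD j hj).mono subset_rfl hY).symm
      · exact absurd rfl hij
    · rcases Nat.lt_succ_iff_lt_or_eq.1 hj with hj | rfl
      · rw [h1 j hj]; exact (hX.antiD j hj).mono subset_rfl hC₂
      · rw [h2]; exact hYanti
    · rcases Nat.lt_succ_iff_lt_or_eq.1 hj with hj | rfl
      · rw [h1 j hj]; exact fun p hp => hX.touch j hj p (hC₂ hp)
      · rw [h2]; exact hYtouch

/-- The neighbours of the labels of points of `S`. -/
def labelNbrs (G : SimpleGraph V) (c : V → V) (S : Set V) : Set V := {x | ∃ s ∈ S, G.Adj (c s) x}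

/-- A shortest walk between the neighbours of two sets of labels yields a link that avoids the
other labels. -/
theorem IsGeod.exists_link {X S T : Set V} {l n : ℕ} {f : ℕ → V}
    (hf : IsGeod G X (labelNbrs G c S) (labelNbrs G c T) n f)
    (hadj : ∀ p ∈ S ∪ T, G.Adj p (c p)) (hST : Disjoint S T)
    (hfar : ∀ p ∈ S ∪ T, ∀ q ∈ S ∪ T, p ≠ q → ¬ Near G (l + 10) p q) :
    ∃ s ∈ S, ∃ t ∈ T, ∃ I ⊆ {v | ∃ i ≤ n, v = f i}, Link G l (c s) (c t) I ∧
      ∀ p ∈ S ∪ T, ∀ v ∈ I, G.Adj (c p) v → p = s ∨ p = t := by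
  obtain ⟨s, hs, hs'⟩ := hf.zero
  obtain ⟨t, ht, ht'⟩ := hf.last
  have hst : s ≠ t := fun hh => Set.disjoint_left.1 hST hs (hh ▸ ht)
  have hconn : Conn G ({v | ∃ i ≤ n, v = f i} ∪ {c s, c t}) (c s) (c t) :=
    ((Conn.of_adj hs' (by simp) (Or.inl ⟨0, Nat.zero_le _, rfl⟩)).trans
      ((hf.conn (Nat.zero_le n) le_rfl).mono (by
        rintro v ⟨i, -, hi, rfl⟩; exact Or.inl ⟨i, hi, rfl⟩))).trans
      (Conn.of_adj ht' (by simp) (Or.inl ⟨n, le_rfl, rfl⟩)).symm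
  obtain ⟨I, hI, hI'⟩ := _root_.exists_link hconn (not_near_label (hadj s (Or.inl hs))
    (hadj t (Or.inr ht)) fun hh => hfar s (Or.inl hs) t (Or.inr ht) hst (hh.mono (show l + 2 ≤ l + 10 by omega)))
  have hIf : I ⊆ {v | ∃ i ≤ n, v = f i} := fun v hv => (hI hv).1.resolve_right (hI hv).2
  have hfar' : ∀ p ∈ S ∪ T, ∀ q ∈ S ∪ T, ∀ v, G.Adj (c p) v → G.Adj (c q) v → p = q := by
    intro p hp q hq v hpv hqv
    by_contra hne
    exact hfar p hp q hq hne ((((hadj p hp).near.trans hpv.near).trans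
      (hqv.near.symm.trans (hadj q hq).near.symm)).mono (by omega))
  -- A shortest walk meets neighbours of labels of `S` only at its first vertex and those of `T`
  -- only at its last, and no vertex is adjacent to the labels of two far points.
  refine ⟨s, hs, t, ht, I, hIf, hI', fun p hp v hv hpv => ?_⟩
  obtain ⟨i, hi, rfl⟩ := hIf hv
  rcases hp with hp | hp
  · left
    rcases Nat.eq_zero_or_pos i with rfl | hi0
    · exact hfar' p (Or.inl hp) s (Or.inl hs) _ hpv hs'
    · exact absurd ⟨p, hp, hpv⟩ (hf.notMem_source hi hi0)
  · right
    rcases hi.lt_or_eq with hi | rfl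
    · exact absurd ⟨p, hp, hpv⟩ (hf.notMem_target hi)
    · exact hfar' p (Or.inr hp) t (Or.inr ht) _ hpv ht'

/-- Many links between two small sets contain many links between the same two points. -/
theorem exists_fat_system_of_links {l m : ℕ} {S T : Finset V} {P : Set V} (X : ℕ → Set V)
    (J : Finset ℕ) (hJ : S.card * T.card * m ≤ J.card) (hS : S.Nonempty) (hT : T.Nonempty)
    (hX : ∀ i ∈ J, ∀ j ∈ J, i ≠ j → Anti G (X i) (X j))
    (h : ∀ j ∈ J, ∃ s ∈ S, ∃ t ∈ T, ∃ I ⊆ X j, Link G l (c s) (c t) I ∧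
      ∀ p ∈ P, ∀ v ∈ I, G.Adj (c p) v → p = s ∨ p = t) :
    ∃ s ∈ S, ∃ t ∈ T, ∃ E, IsSystem G l c E P {v | ∃ j ∈ J, v ∈ X j} ∧ HasFat G m E s t := by
  classical
  obtain ⟨v₀, hv₀⟩ := hS
  have : Nonempty V := ⟨v₀⟩
  choose! s hs t ht h using h
  obtain ⟨⟨x, y⟩, hxy, hm⟩ := Finset.exists_le_card_fiber_of_mul_le_card_of_maps_to
    (s := J) (t := S ×ˢ T) (f := fun j => (s j, t j)) (n := m)
    (fun j hj => Finset.mem_product.2 ⟨hs j hj, ht j hj⟩) (Finset.Nonempty.product ⟨v₀, hv₀⟩ hT)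
    (by rwa [Finset.card_product])
  rw [Finset.mem_product] at hxy
  have hsub : ∀ j ∈ J.filter fun j => (s j, t j) = (x, y), j ∈ J ∧ s j = x ∧ t j = y := by
    intro j hj
    have := Finset.mem_filter.1 hj
    exact ⟨this.1, (Prod.mk.inj this.2).1, (Prod.mk.inj this.2).2⟩
  obtain ⟨E, hE, hfat⟩ := exists_fat_system (G := G) (l := l) (c := c) (x := x) (y := y) (P := P) X
    _ hm (fun i hi j hj => hX i (hsub i hi).1 j (hsub j hj).1) (fun j hj => by
      obtain ⟨hjJ, rfl, rfl⟩ := hsub j hj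
      exact h j hjJ)
  exact ⟨x, hxy.1, y, hxy.2, E, hE.mono subset_rfl fun v ⟨j, hj, hv⟩ => ⟨j, (hsub j hj).1, hv⟩, hfat⟩

/-- The output of the tail lemma: fat links along the points `v 0, …, v (n + 1)`, followed by an
ear with the additional points `v (n + 2)` and `u`. -/
structure IsTail (G : SimpleGraph V) (l m n : ℕ) (c : V → V) (E : Set (V × V × Set V))
    (S Q Z : Set V) (v : ℕ → V) (u : V) : Prop where
  zero : v 0 ∈ S
  mem : ∀ i ≤ n + 1, v (i + 1) ∈ Q
  mem_u : u ∈ Q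
  far : ∀ p ∈ Q, ∀ q ∈ Q, p ≠ q → ¬ Near G (l + 10) p q
  inj : ∀ i ≤ n + 2, ∀ j ≤ n + 2, i ≠ j → v i ≠ v j
  ne : ∀ i ≤ n + 2, v i ≠ u
  system : IsSystem G l c E (S ∪ Q) Z
  fat : ∀ i ≤ n, HasFat G m E (v i) (v (i + 1))
  ear : HasEar G m E (v (n + 1)) (v (n + 2)) u

theorem IsGroup.portGroup {Z D : Set V} {M : ℕ} {X : ℕ → Set V} (h : IsGroup G c Z D M X)
    (hadj : ∀ p ∈ D, G.Adj p (c p)) : ∃ e, PortGroup G c D (Finset.range M) X e X := by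
  have : ∀ j, ∀ p, ∃ x, j < M → p ∈ D → x ∈ X j ∧ G.Adj (c p) x := by
    intro j p
    by_cases hjp : j < M ∧ p ∈ D
    · obtain ⟨x, hx⟩ := h.touch j hjp.1 p hjp.2
      exact ⟨x, fun _ _ => hx⟩
    · exact ⟨p, fun h1 h2 => absurd ⟨h1, h2⟩ hjp⟩
  choose e he using this
  refine ⟨e, hadj, fun j hj => h.conn j (Finset.mem_range.1 hj), fun j hj => subset_rfl,
    fun j hj p hp => (he j p (Finset.mem_range.1 hj) hp).1,
    fun j hj p hp => (he j p (Finset.mem_range.1 hj) hp).2, fun j hj p hp => ?_,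
    fun i hi j hj => h.anti i (Finset.mem_range.1 hi) j (Finset.mem_range.1 hj),
    fun j hj => h.antiD j (Finset.mem_range.1 hj)⟩
  have := he j p (Finset.mem_range.1 hj) hp
  exact ⟨e j p, this.1, Or.inl this.2⟩

theorem IsGroup.exists_isGeod {Z D S T : Set V} {M : ℕ} {X : ℕ → Set V}
    (h : IsGroup G c Z D M X) (hS : S.Nonempty) (hSD : S ⊆ D) (hT : T.Nonempty) (hTD : T ⊆ D)
    {j : ℕ} (hj : j < M) : ∃ f, IsGeod G (X j) (labelNbrs G c S) (labelNbrs G c T)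
      (dst G (X j) (labelNbrs G c S) (labelNbrs G c T)) f := by
  obtain ⟨s, hs⟩ := hS
  obtain ⟨t, ht⟩ := hT
  obtain ⟨x, hx, hx'⟩ := h.touch j hj s (hSD hs)
  obtain ⟨y, hy, hy'⟩ := h.touch j hj t (hTD ht)
  exact (h.conn j hj).exists_isGeod_dst ⟨x, ⟨s, hs, hx'⟩, hx⟩ ⟨y, ⟨t, ht, hy'⟩, hy⟩

theorem not_adj_of_far {k : ℕ} (hk : 2 ≤ k) {p z : V} (hp : G.Adj p (c p)) (h : ¬ Near G k p z) :
    ¬ G.Adj (c p) z := fun hh => h ((hp.near.trans hh.near).mono hk)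

/-- An ear on a set `T` is built inside `C`. Each of the `9 * m` sets `X j` yields a link from `S`
to `T`; there are at most nine pairs of ends, so `m` links are parallel. Their end in `T` cannot be
prescribed, but the ear is available from every point of `T`. -/
theorem IsScale.exists_tail_zero [Finite V] (h : IsScale G c C₀ B R K) {l m τ : ℕ}
    (hadj : ∀ p ∈ C₀, G.Adj p (c p)) (hτ : Balls G (4 * l + 50) τ) (hB : 2 * τ < B)
    (hR : 2 * m + 4 ≤ R) {S : Finset V} {C D Z₀ : Set V} {X : ℕ → Set V} (hScard : S.card ≤ 3)
    (hS : S.Nonempty) (hSD : ↑S ⊆ D) (hCD : C ⊆ D) (hD : D ⊆ C₀) (hX : IsGroup G c Z₀ D (9 * m) X)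
    (hSfar : ∀ s ∈ S, ∀ t ∈ S, s ≠ t → ¬ Near G (l + 10) s t)
    (hSC : ∀ s ∈ S, ∀ p ∈ C, ¬ Near G (l + 10) s p) (hC : ¬ Col G C (K (2 * m + 4))) :
    ∃ E Q v u, Q ⊆ C ∧ IsTail G l m 0 c E S Q (C ∪ {x | ∃ j < 9 * m, x ∈ X j}) v u := by
  classical
  obtain ⟨X', C', hC'C, hX', hC'⟩ := h.exists_group (2 * m + 4) 0 (hCD.trans hD) (by omega)
    (by rwa [Nat.zero_add])
  obtain ⟨e, he⟩ := hX'.portGroup fun p hp => hadj p (hD (hCD (hC'C hp)))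
  obtain ⟨T, hTcard, hT, hTC', hTfar, W, hWC', -, hear⟩ := he.exists_ear (l := l) (m := m) (τ := τ)
    (by simp) (hτ.mono (by omega)) fun hh => hC' (hh.mono subset_rfl
      (by have := h.base; omega))
  have hTC : (↑T : Set V) ⊆ C := hTC'.trans hC'C
  have hST : Disjoint (↑S : Set V) ↑T := Set.disjoint_left.2 fun s hs ht =>
    hSC s hs s (hTC ht) (Near.refl _ _)
  have hfar : ∀ p ∈ (↑S ∪ ↑T : Set V), ∀ q ∈ (↑S ∪ ↑T : Set V), p ≠ q →
      ¬ Near G (l + 10) p q := by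
    rintro p (hp | hp) q (hq | hq) hpq
    · exact hSfar p hp q hq hpq
    · exact hSC p hp q (hTC hq)
    · exact fun hh => hSC q hq p (hTC hp) hh.symm
    · exact hTfar p hp q hq hpq
  obtain ⟨s, hs, t, ht, E, hE, hfat⟩ := exists_fat_system_of_links (G := G) (c := c) (l := l)
    (m := m) (S := S) (T := T) (P := ↑S ∪ ↑T) X (Finset.range (9 * m)) (by
      rw [Finset.card_range]
      exact Nat.mul_le_mul_right m ((Nat.mul_le_mul hScard hTcard).trans (by norm_num))) hS hT
    (fun i hi j hj => hX.anti i (Finset.mem_range.1 hi) j (Finset.mem_range.1 hj)) (by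
      intro j hj
      obtain ⟨f, hf⟩ := hX.exists_isGeod hS.to_set hSD hT.to_set (hTC.trans hCD)
        (Finset.mem_range.1 hj)
      obtain ⟨s, hs, t, ht, I, hI, hI', hav⟩ := hf.exists_link (l := l)
        (fun p hp => hadj p (hD (hp.elim (fun h => hSD h) fun h => hCD (hTC h)))) hST hfar
      refine ⟨s, hs, t, ht, I, fun v hv => ?_, hI', hav⟩
      obtain ⟨i, hi, rfl⟩ := hI hv
      exact hf.mem i hi)
  obtain ⟨t', ht', u, hu, htt', htu, ht'u, E', hE', hear'⟩ := hear t ht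
  have hZ' : (W ∪ {x | ∃ j ∈ Finset.range (2 * m + 4), x ∈ X' j ∪ e j '' ↑T}) ⊆ C := by
    rintro x (hx | ⟨j, hj, hx | ⟨p, hp, rfl⟩⟩)
    · exact hC'C (hWC' hx)
    · exact hX'.sub j (Finset.mem_range.1 hj) hx
    · exact hX'.sub j (Finset.mem_range.1 hj) (he.mem_e j hj p (hTC' hp))
  have hsys := hE.union (hE'.mono subset_rfl hZ') (by
      rintro x ⟨j, hj, hx⟩ y hy
      exact hX.antiD j (Finset.mem_range.1 hj) x hx y (hCD hy))
    (fun p hp hp' => (hp' (Or.inr hp)).elim)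
    (fun p hp hp' z hz => not_adj_of_far (by omega) (hadj p (hD (hSD (hp.resolve_right hp'))))
      (hSC p (hp.resolve_right hp') z hz))
  have hsne : ∀ p ∈ T, s ≠ p := fun p hp hh => Set.disjoint_left.1 hST hs (hh ▸ hp)
  refine ⟨E ∪ E', T, fun i => if i = 0 then s else if i = 1 then t else t', u, hTC,
    ⟨by simpa using hs, ?_, hu, hTfar, ?_, ?_, hsys.mono ?_ ?_, ?_, ?_⟩⟩
  · intro i hi
    interval_cases i
    · simpa using ht
    · simpa using ht'
  · intro i hi j hj hij
    have h1 := hsne t ht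
    have h2 := hsne t' ht'
    interval_cases i <;> interval_cases j <;> simp_all [Ne.symm]
  · intro i hi
    interval_cases i
    · simpa using hsne u hu
    · simpa using htu
    · simpa using ht'u
  · rintro p (hp | hp)
    exacts [Or.inl (Or.inl hp), Or.inr hp]
  · rintro x (⟨j, hj, hx⟩ | hx)
    exacts [Or.inr ⟨j, Finset.mem_range.1 hj, hx⟩, Or.inl hx]
  · intro i hi
    obtain rfl : i = 0 := by omega
    simpa using hfat.mono Set.subset_union_left
  · simpa using hear'.mono Set.subset_union_right

end Groups

/-! ### Induction along the fat path. -/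

section Tail

variable {V : Type*} {G : SimpleGraph V} {c : V → V} {C₀ : Set V} {B R : ℕ} {K : ℕ → ℕ}

theorem IsScale.not_col_of_mul (h : IsScale G c C₀ B R K) {C : Set V} {r b : ℕ} (hb : b ≤ B)
    (hC : ¬ Col G C (K (r + 1))) : ¬ Col G C (b * K r) := fun hh =>
  hC (hh.mono subset_rfl ((Nat.mul_le_mul hb (Nat.le_succ _)).trans (h.grow r)))

theorem IsScale.not_col_of_add (h : IsScale G c C₀ B R K) {C : Set V} {r b : ℕ} (hb : b ≤ B)
    (hB : 0 < B) (hC : ¬ Col G C (K (r + 1))) : ¬ Col G C (K r + b) := fun hh =>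
  hC (hh.mono subset_rfl (le_trans (by
    rw [Nat.mul_add, Nat.mul_one]
    exact Nat.add_le_add (Nat.le_mul_of_pos_left _ hB) hb) (h.grow r)))

/-- Points are compared by the distance, inside `X j`, from the label neighbours of `S` to their own
label neighbours. The next point `w` is near and all later points are far, so a shortest walk
towards `w` meets no neighbour of a later label. The next group `X'` is found before the split, so
that it is touched by the labels of `w` and of the later points alike. One step uses `9 * m` scales
for the group, one for the split and one for deleting a ball around `w`. -/
theorem IsScale.exists_tail [Finite V] (h : IsScale G c C₀ B R K) {l m τ : ℕ}
    (hadj : ∀ p ∈ C₀, G.Adj p (c p)) (hτ : Balls G (4 * l + 50) τ) (hB : 2 * τ < B)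
    (hB' : 2 ^ (2 * (3 * m)) ≤ B) (n : ℕ) (hR : n * (9 * m + 2) + (2 * m + 4) ≤ R) :
    ∀ {S : Finset V} {C D Z₀ : Set V} {X : ℕ → Set V}, S.card ≤ 3 →
    S.Nonempty → ↑S ⊆ D → C ⊆ D → D ⊆ C₀ → IsGroup G c Z₀ D (9 * m) X →
    (∀ s ∈ S, ∀ t ∈ S, s ≠ t → ¬ Near G (l + 10) s t) →
    (∀ s ∈ S, ∀ p ∈ C, ¬ Near G (l + 10) s p) →
    ¬ Col G C (K (n * (9 * m + 2) + (2 * m + 4))) →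
    ∃ E Q v u, Q ⊆ C ∧ IsTail G l m n c E S Q (C ∪ {x | ∃ j < 9 * m, x ∈ X j}) v u := by
  classical
  induction n with
  | zero =>
    intro S C D Z₀ X hScard hS hSD hCD hD hX hSfar hSC hC
    exact h.exists_tail_zero hadj hτ hB (by omega) hScard hS hSD hCD hD hX hSfar hSC
      (by simpa using hC)
  | succ n ih =>
    intro S C D Z₀ X hScard hS hSD hCD hD hX hSfar hSC hC
    rw [Nat.succ_mul] at hR
    rw [Nat.succ_mul] at hC
    set r := n * (9 * m + 2) + (2 * m + 4) with hr
    obtain ⟨X', C', hC'C, hX', hC'⟩ := h.exists_group (9 * m) (r + 2) (hCD.trans hD) (by omega)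
      (by rwa [show r + 2 + 9 * m = n * (9 * m + 2) + (9 * m + 2) + (2 * m + 4) by omega])
    -- Of the `9 * m` sets, `2 * (3 * m)` are compared. Half of these survive, which is enough for
    -- `m` parallel links since `S` has at most three points.
    obtain ⟨L, hL, F, hF, hLcol, hFcol, J, hJ, hJ'⟩ := exists_split (k := 3 * m)
      (fun j p => dst G (X j) (labelNbrs G c S) (labelNbrs G c {p}))
      (h.not_col_of_mul (r := r + 1) hB' hC')
    obtain ⟨w, hw⟩ := nonempty_of_not_col hLcol
    have hwC : w ∈ C := hC'C (hL hw)
    set F' : Set V := F \ {v | Near G (l + 10) w v} with hF'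
    have hF'C' : F' ⊆ C' := fun x hx => hF hx.1
    have hF'C : F' ⊆ C := hF'C'.trans hC'C
    have hF'col : ¬ Col G F' (K r) :=
      not_col_diff (h.not_col_of_add (r := r) (b := τ) (by omega) (by omega) hFcol)
        (hτ.mono (by omega) w)
    have hST : Disjoint (↑S : Set V) {w} := Set.disjoint_left.2 fun s hs ht =>
      hSC s hs w hwC (by rw [Set.mem_singleton_iff.1 ht]; exact Near.refl _ _)
    have hfar : ∀ p ∈ (↑S ∪ {w} : Set V), ∀ q ∈ (↑S ∪ {w} : Set V), p ≠ q →
        ¬ Near G (l + 10) p q := by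
      rintro p (hp | rfl) q (hq | rfl) hpq
      · exact hSfar p hp q hq hpq
      · exact hSC p hp q hwC
      · exact fun hh => hSC q hq p hwC hh.symm
      · exact absurd rfl hpq
    have hadjD : ∀ p ∈ D, G.Adj p (c p) := fun p hp => hadj p (hD hp)
    obtain ⟨s, hs, w', hw', E, hE, hfat⟩ := exists_fat_system_of_links (G := G) (c := c) (l := l)
      (m := m) (S := S) (T := {w}) (P := ↑S ∪ {w} ∪ F') X J (by
        rw [Finset.card_singleton, Nat.mul_one]
        exact (Nat.mul_le_mul_right m hScard).trans hJ) hS (Finset.singleton_nonempty w)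
      (fun i hi j hj => hX.anti i (by have := (hJ' i hi).1; omega) j
        (by have := (hJ' j hj).1; omega)) (by
        intro j hj
        have hj9 : j < 9 * m := by have := (hJ' j hj).1; omega
        have geod : ∀ p ∈ D, ∃ f, IsGeod G (X j) (labelNbrs G c S) (labelNbrs G c {p})
            (dst G (X j) (labelNbrs G c S) (labelNbrs G c {p})) f := fun p hp =>
          hX.exists_isGeod hS.to_set hSD (Set.singleton_nonempty p)
            (Set.singleton_subset_iff.2 hp) hj9
        obtain ⟨f, hf⟩ := geod w (hCD hwC)
        obtain ⟨s, hs, t, ht, I, hI, hI', hav⟩ := hf.exists_link (l := l)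
          (fun p hp => hadjD p (hp.elim (fun h => hSD h) fun h => h ▸ hCD hwC)) hST hfar
        refine ⟨s, hs, t, Finset.mem_singleton.2 ht, I, fun v hv => ?_, hI',
          fun p hp v hv hpv => ?_⟩
        · obtain ⟨i, hi, rfl⟩ := hI hv
          exact hf.mem i hi
        · rcases hp with hp | hp
          · exact hav p hp v hv hpv
          · obtain ⟨i, hi, rfl⟩ := hI hv
            obtain ⟨g, hg⟩ := geod p (hCD (hF'C hp))
            refine absurd ⟨p, rfl, hpv⟩ (hf.notMem_of_le hg ((hJ' j hj).2 w hw p hp.1) ?_ hi)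
            rw [Set.disjoint_left]
            rintro x ⟨q, rfl, hx⟩ ⟨q', rfl, hx'⟩
            exact hp.2 ((((hadjD q (hCD hwC)).near.trans hx.near).trans
              (hx'.near.symm.trans (hadjD q' (hCD (hF'C hp))).near.symm)).mono
                (show 1 + 1 + (1 + 1) ≤ l + 10 by omega)))
    obtain rfl : w' = w := Finset.mem_singleton.1 hw'
    obtain ⟨E', Q, v, u, hQ, ht⟩ := ih (by omega) (S := {w'}) (C := F') (D := C') (by simp)
      (Finset.singleton_nonempty w') (by simpa using hL hw) hF'C' (hC'C.trans (hCD.trans hD)) hX'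
      (by
        intro s hs t ht hst
        rw [Finset.mem_singleton] at hs ht
        exact absurd (hs.trans ht.symm) hst)
      (by
        intro s hs p hp
        rw [Finset.mem_singleton.1 hs]
        exact hp.2) hF'col
    have hQC : Q ⊆ C := hQ.trans hF'C
    have hZ' : (F' ∪ {x | ∃ j < 9 * m, x ∈ X' j}) ⊆ C := by
      rintro x (hx | ⟨j, hj, hx⟩)
      · exact hF'C hx
      · exact hX'.sub j hj hx
    have hv0 : v 0 = w' := by simpa using ht.zero
    have hsys := (hE.mono (P' := ↑S ∪ {w'} ∪ Q)
      (fun p hp => hp.imp id fun hp => hQ hp) subset_rfl).union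
      (ht.system.mono subset_rfl hZ') (by
        rintro x ⟨j, hj, hx⟩ y hy
        exact hX.antiD j (by have := (hJ' j hj).1; omega) x hx y (hCD hy))
      (fun p hp hp' => (hp' (hp.elim (fun hp => Or.inl (Or.inr (by simpa using hp)))
        fun hp => Or.inr hp)).elim)
      (fun p hp hp' z hz => by
        have hpS : p ∈ S := by
          rcases hp with (hp | hp) | hp
          · exact hp
          · exact (hp' (Or.inl (by simpa using hp))).elim
          · exact (hp' (Or.inr hp)).elim
        exact not_adj_of_far (by omega) (hadjD p (hSD hpS)) (hSC p hpS z hz))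
    have hsC : s ∉ C := fun hh => hSC s hs s hh (Near.refl _ _)
    have hvC : ∀ i ≤ n + 2, v i ∈ C := by
      intro i hi
      rcases Nat.eq_zero_or_pos i with rfl | hi0
      · rwa [hv0]
      · have := ht.mem (i - 1) (by omega)
        rw [Nat.sub_add_cancel hi0] at this
        exact hQC this
    set v' : ℕ → V := fun i => if i = 0 then s else v (i - 1) with hv'
    have hv'0 : v' 0 = s := rfl
    have hv's : ∀ i, v' (i + 1) = v i := fun i => rfl
    refine ⟨E ∪ E', {w'} ∪ Q, v', u, ?_, ⟨by simpa [hv'0] using hs, ?_, Or.inr ht.mem_u, ?_, ?_, ?_,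
      hsys.mono ?_ ?_, ?_, ?_⟩⟩
    · rintro p (rfl | hp)
      exacts [hwC, hQC hp]
    · intro i hi
      rw [hv's]
      rcases Nat.eq_zero_or_pos i with rfl | hi0
      · exact Or.inl hv0
      · have := ht.mem (i - 1) (by omega)
        rw [Nat.sub_add_cancel hi0] at this
        exact Or.inr this
    · rintro p (rfl | hp) q (rfl | hq) hpq
      · exact absurd rfl hpq
      · exact (hQ hq).2
      · exact fun hh => (hQ hp).2 hh.symm
      · exact ht.far p hp q hq hpq
    · intro i hi j hj hij
      rcases i with _ | i <;> rcases j with _ | j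
      · exact absurd rfl hij
      · rw [hv'0, hv's]
        exact fun hh => hsC (hh ▸ hvC j (by omega))
      · rw [hv'0, hv's]
        exact fun hh => hsC (hh ▸ hvC i (by omega))
      · rw [hv's, hv's]
        exact ht.inj i (by omega) j (by omega) (by omega)
    · intro i hi
      rcases i with _ | i
      · exact fun hh => hsC (hv'0 ▸ hh ▸ hQC ht.mem_u)
      · rw [hv's]
        exact ht.ne i (by omega)
    · rintro p (hp | hp | hp)
      exacts [Or.inl (Or.inl (Or.inl hp)), Or.inl (Or.inl (Or.inr hp)), Or.inl (Or.inr hp)]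
    · rintro x (⟨j, hj, hx⟩ | hx)
      exacts [Or.inr ⟨j, by have := (hJ' j hj).1; omega, hx⟩, Or.inl hx]
    · intro i hi
      rcases i with _ | i
      · rw [hv's, hv0]
        exact hfat.mono Set.subset_union_left
      · rw [hv's, hv's]
        exact (ht.fat i (by omega)).mono Set.subset_union_right
    · exact ht.ear.mono Set.subset_union_right

end Tail

/-! ### The first ear, and the complete path with both ears. -/

section Head

variable {V : Type*} {G : SimpleGraph V} {c : V → V} {C₀ : Set V} {B R : ℕ} {K : ℕ → ℕ}

/-- A group has, on a subset `L` of large chromatic number, ports with connected parts that are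
out of reach for another subset `F` of large chromatic number. -/
theorem IsGroup.exists_split_ports [Finite V] {Z D C : Set V} {k n τ : ℕ} {X : ℕ → Set V}
    (hX : IsGroup G c Z D (2 * k) X) (hCD : C ⊆ D) (hadj : ∀ p ∈ D, G.Adj p (c p))
    (hτ : Balls G 2 τ) (hC : ¬ Col G C (2 ^ (2 * k) * n + 2 * k * τ)) :
    ∃ L ⊆ C, ∃ F ⊆ C, ¬ Col G L n ∧ ¬ Col G F n ∧ ∃ (J : Finset ℕ) (R : ℕ → Set V)
      (e : ℕ → V → V), k ≤ J.card ∧ (∀ j ∈ J, j < 2 * k) ∧ PortGroup G c L J R e X ∧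
      ∀ j ∈ J, ∀ q ∈ F, ∀ x ∈ R j, ¬ G.Adj (c q) x := by
  classical
  have hroot : ∃ r : ℕ → V, ∀ j < 2 * k, r j ∈ X j := by
    have : ∀ j, ∃ r, j < 2 * k → r ∈ X j := fun j => by
      by_cases hj : j < 2 * k
      · obtain ⟨r, hr⟩ := (hX.conn j hj).1
        exact ⟨r, fun _ => hr⟩
      · exact ⟨(nonempty_of_not_col hC).some, fun h => absurd h hj⟩
    choose r hr using this
    exact ⟨r, hr⟩
  obtain ⟨r, hr⟩ := hroot
  have hball := col_biUnion (G := G) (Finset.range (2 * k)) (fun j => {v | Near G 2 (r j) v})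
    (n := τ) fun j _ => hτ (r j)
  rw [Finset.card_range] at hball
  have hC₁ := not_col_diff hC hball
  -- Away from the balls around the roots no label is adjacent to a root. Hence all `T j p` are
  -- positive, and a shortest walk has a vertex before its last one.
  set C₁ := C \ {v | ∃ j ∈ Finset.range (2 * k), v ∈ {v | Near G 2 (r j) v}} with hC₁def
  have hrC₁ : ∀ j < 2 * k, ∀ p ∈ C₁, ¬ G.Adj (c p) (r j) := fun j hj p hp hadj' =>
    hp.2 ⟨j, Finset.mem_range.2 hj, hadj'.near.symm.trans (hadj p (hCD hp.1)).near.symm⟩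
  set T : ℕ → V → ℕ := fun j p => dst G (X j) {r j} (labelNbrs G c {p}) with hT
  obtain ⟨L, hL, F, hF, hLcol, hFcol, J, hJ, hJ'⟩ := exists_split T hC₁
  have geod : ∀ j ∈ J, ∀ p ∈ C, ∃ f, IsGeod G (X j) {r j} (labelNbrs G c {p}) (T j p) f := by
    intro j hj p hp
    obtain ⟨x, hx, hx'⟩ := hX.touch j (hJ' j hj).1 p (hCD hp)
    exact (hX.conn j (hJ' j hj).1).exists_isGeod_dst ⟨r j, rfl, hr j (hJ' j hj).1⟩
      ⟨x, ⟨p, rfl, hx'⟩, hx⟩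
  have hFmin : ∀ j ∈ J, ∃ t, (∀ p ∈ L, T j p ≤ t) ∧ ∀ q ∈ F, t ≤ T j q := by
    intro j hj
    obtain ⟨q₀, hq₀⟩ := nonempty_of_not_col hFcol
    refine ⟨sInf (T j '' F), fun p hp => ?_, fun q hq => Nat.sInf_le ⟨q, hq, rfl⟩⟩
    obtain ⟨q, hq, hq'⟩ := Nat.sInf_mem (⟨_, q₀, hq₀, rfl⟩ : (T j '' F).Nonempty)
    rw [← hq']
    exact (hJ' j hj).2 p hp q hq
  choose! t htL htF using hFmin
  have hfe : ∀ j ∈ J, ∀ p ∈ L, ∃ f, IsGeod G (X j) {r j} (labelNbrs G c {p}) (T j p) f :=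
    fun j hj p hp => geod j hj p (hL hp).1
  have : Nonempty V := ⟨(nonempty_of_not_col hC).some⟩
  choose! f hf using hfe
  have hT0 : ∀ j ∈ J, ∀ p ∈ L, 0 < T j p := by
    intro j hj p hp
    refine Nat.pos_of_ne_zero fun h0 => ?_
    have h1 := (hf j hj p hp).last
    rw [h0, show f j p 0 = r j from (hf j hj p hp).zero] at h1
    obtain ⟨q, hq, h2⟩ := h1
    rw [Set.mem_singleton_iff.1 hq] at h2
    exact hrC₁ j (hJ' j hj).1 p (hL hp) h2
  -- The vertices of `X j` at distance less than `t j` from the root form a connected set with no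
  -- neighbours of labels of `F`. A label of `L` may reach it only through the last vertex of its
  -- shortest walk, at distance possibly equal to `t j`; this accounts for the maps `e` in
  -- `PortGroup`.
  set S : ℕ → Set V := fun j => {x | ∃ i < t j, ∃ g, IsGeod G (X j) {r j} {x} i g} with hS
  have hinit : ∀ j i n g (B : Set V), IsGeod G (X j) {r j} B n g → i ≤ n → i < t j → g i ∈ S j := by
    intro j i n g B hg hi hit
    exact ⟨i, hit, g, (show IsGeod G (X j) {r j} {g n} n g from ⟨hg.mem, hg.zero, rfl, hg.adj,
      fun a ha b hb p hp => hg.min a ha b (by rw [Set.mem_singleton_iff.1 hb]; exact hg.last)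
        p hp⟩).initial hi⟩
  refine ⟨L, hL.trans Set.sdiff_subset, F, hF.trans Set.sdiff_subset, hLcol, hFcol, J, S,
    fun j p => f j p (T j p), hJ, fun j hj => (hJ' j hj).1, ⟨fun p hp => hadj p (hCD (hL hp).1), ?_,
    ?_, fun j hj p hp => (hf j hj p hp).mem _ le_rfl, ?_, ?_,
    fun i hi j hj => hX.anti i (hJ' i hi).1 j (hJ' j hj).1,
    fun j hj => (hX.antiD j (hJ' j hj).1).mono subset_rfl fun p hp => hCD (hL hp).1⟩, ?_⟩
  · intro j hj
    obtain ⟨p, hp⟩ := nonempty_of_not_col hLcol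
    have ht0 : 0 < t j := (hT0 j hj p hp).trans_le (htL j hj p hp)
    have hconn : ∀ x ∈ S j, Conn G (S j) (r j) x := by
      rintro x ⟨i, hi, g, hg⟩
      have h1 := hg.conn (Nat.zero_le i) le_rfl
      rw [show g 0 = r j from hg.zero, show g i = x from hg.last] at h1
      refine h1.mono ?_
      rintro v ⟨s, -, hs, rfl⟩
      exact hinit j s i g _ hg hs (by omega)
    refine ⟨⟨f j p 0, hinit j 0 _ _ _ (hf j hj p hp) (Nat.zero_le _) ht0⟩, fun x hx y hy =>
      (hconn x hx).symm.trans (hconn y hy)⟩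
  · rintro j hj x ⟨i, hi, g, hg⟩
    have := hg.mem i le_rfl
    rwa [show g i = x from hg.last] at this
  · intro j hj p hp
    obtain ⟨q, hq, h1⟩ := (hf j hj p hp).last
    rwa [Set.mem_singleton_iff.1 hq] at h1
  · intro j hj p hp
    have h0 := hT0 j hj p hp
    have h1 := htL j hj p hp
    have h2 := (hf j hj p hp).adj (T j p - 1) (by omega)
    rw [Nat.sub_add_cancel h0] at h2
    exact ⟨_, hinit j (T j p - 1) _ _ _ (hf j hj p hp) (Nat.sub_le _ _) (by omega),
      Or.inr h2.symm⟩
  · rintro j hj q hq x ⟨i, hi, g, hg⟩ hqx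
    obtain ⟨g', hg'⟩ := geod j hj q (hF hq).1
    have hx : g i = x := hg.last
    have := hg.le_of_mem hg' le_rfl ⟨q, rfl, hx ▸ hqx⟩
    have := htF j hj q hq
    omega

/-- The output of the construction: labelled points and links that realize a fat path
with ears, except for the link between the two ears. -/
structure IsEarPath (G : SimpleGraph V) (l m n : ℕ) (c : V → V) (E : Set (V × V × Set V))
    (P Z : Set V) (w : ℕ → V) (a b : V) : Prop where
  mem : ∀ i ≤ n + 3, w i ∈ P
  mem_a : a ∈ P
  mem_b : b ∈ P
  far : ∀ p ∈ P, ∀ q ∈ P, p ≠ q → ¬ Near G (l + 10) p q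
  inj : ∀ i ≤ n + 3, ∀ j ≤ n + 3, i ≠ j → w i ≠ w j
  ne_a : ∀ i ≤ n + 3, w i ≠ a
  ne_b : ∀ i ≤ n + 3, w i ≠ b
  ne : a ≠ b
  system : IsSystem G l c E P Z
  ear : HasEar G m E (w 1) (w 0) a
  fat : ∀ i ≤ n, HasFat G m E (w (i + 1)) (w (i + 2))
  ear' : HasEar G m E (w (n + 2)) (w (n + 3)) b

/-- The group `X` carries the first ear, and `X'`, found in the part anticomplete to `X`, carries
the links from that ear to the tail. The ear uses points of `L` and connected sets hidden from the
labels of `F`, while the tail uses points of `F`. The ear is oriented last, when the tail has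
already selected its starting point `v 0` in `S`. -/
theorem IsScale.exists_isEarPath [Finite V] (h : IsScale G c C₀ B R K) {l m n τ : ℕ}
    (hadj : ∀ p ∈ C₀, G.Adj p (c p)) (hτ : Balls G (4 * l + 50) τ) (hB : (4 * m + 20) * τ < B)
    (hB₁ : 2 ^ (2 * (3 * m)) ≤ B) (hB₂ : 2 ^ (2 * (2 * m + 4)) ≤ B)
    (hR : n * (9 * m + 2) + (2 * m + 4) + 2 + 9 * m + 2 * (2 * m + 4) ≤ R)
    (hC₀ : ¬ Col G C₀ (K (n * (9 * m + 2) + (2 * m + 4) + 2 + 9 * m + 2 * (2 * m + 4)))) :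
    ∃ E P w a b, P ⊆ C₀ ∧ IsEarPath G l m n c E P C₀ w a b := by
  classical
  set r := n * (9 * m + 2) + (2 * m + 4) with hr
  have hB20 : 20 * τ < B := lt_of_le_of_lt (Nat.mul_le_mul_right τ (by omega)) hB
  obtain ⟨X, C₁, hC₁, hX, hC₁col⟩ := h.exists_group (2 * (2 * m + 4)) (r + 2 + 9 * m) subset_rfl hR
    hC₀
  obtain ⟨X', C₂, hC₂, hX', hC₂col⟩ := h.exists_group (9 * m) (r + 2) hC₁ (by omega) hC₁col
  have hadjC₁ : ∀ p ∈ C₁, G.Adj p (c p) := fun p hp => hadj p (hC₁ hp)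
  obtain ⟨L, hL, F, hF, hLcol, hFcol, J, Y, e, hJ, hJlt, hports, hYF⟩ :=
    hX.exists_split_ports (n := K (r + 1)) (τ := τ) hC₂ hadjC₁ (hτ.mono (by omega)) (by
      refine fun hh => hC₂col (hh.mono subset_rfl (le_trans ?_ (h.grow (r + 1))))
      rw [Nat.mul_add B, Nat.mul_one]
      refine Nat.add_le_add (Nat.mul_le_mul_right _ hB₂) (le_trans ?_ hB.le)
      exact Nat.mul_le_mul_right τ (by omega))
  obtain ⟨S, hScard, hS, hSL, hSfar, W, hWL, ⟨x₁, x₂, x₃, hW⟩, hear⟩ := hports.exists_ear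
    (l := l) (m := m) (τ := τ) hJ (hτ.mono (by omega)) fun hh => hLcol (hh.mono subset_rfl (by
      have := h.base_le (r + 1); omega))
  have hSC₂ : (↑S : Set V) ⊆ C₂ := hSL.trans hL
  -- At most six balls: three around the points of `S`, and three that cover `W`, widened by two so
  -- that labels of the remaining points have no neighbours in `W`.
  have hrem : Col G ({v | ∃ s ∈ S, v ∈ {v | Near G (l + 10) s v}} ∪ ({v | Near G (l + 13) x₁ v} ∪
      ({v | Near G (l + 13) x₂ v} ∪ {v | Near G (l + 13) x₃ v}))) (20 * τ) := by
    have h1 := col_biUnion (G := G) S (fun s => {v | Near G (l + 10) s v}) (n := τ)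
      fun s _ => hτ.mono (by omega) s
    have h2 := fun x => hτ.mono (show l + 13 ≤ 4 * l + 50 by omega) x
    refine (h1.union ((h2 x₁).union ((h2 x₂).union (h2 x₃)))).mono subset_rfl ?_
    have := Nat.mul_le_mul_right τ hScard
    omega
  set F' := F \ ({v | ∃ s ∈ S, v ∈ {v | Near G (l + 10) s v}} ∪ ({v | Near G (l + 13) x₁ v} ∪
      ({v | Near G (l + 13) x₂ v} ∪ {v | Near G (l + 13) x₃ v}))) with hF'
  have hF'C₂ : F' ⊆ C₂ := fun v hv => hF hv.1
  have hSF' : ∀ s ∈ S, ∀ p ∈ F', ¬ Near G (l + 10) s p := fun s hs p hp hh =>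
    hp.2 (Or.inl ⟨s, hs, hh⟩)
  have hWF' : ∀ v ∈ W, ∀ p ∈ F', ¬ Near G 2 v p := by
    intro v hv p hp hh
    refine hp.2 (Or.inr ?_)
    rcases hW v hv with h1 | h1 | h1
    · exact Or.inl ((h1.trans hh).mono (by omega))
    · exact Or.inr (Or.inl ((h1.trans hh).mono (by omega)))
    · exact Or.inr (Or.inr ((h1.trans hh).mono (by omega)))
  obtain ⟨E, Q, v, b, hQ, ht⟩ := h.exists_tail hadj hτ (by omega) hB₁ n (by omega) hScard hS hSC₂
    hF'C₂ (hC₂.trans hC₁) hX' hSfar hSF'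
    (not_col_diff (h.not_col_of_add (r := r) hB20.le (by omega) hFcol) hrem)
  obtain ⟨t, htS, a, haS, hst, hsa, hta, E', hE', hear'⟩ := hear (v 0) ht.zero
  set ZA : Set V := W ∪ {x | ∃ j ∈ J, x ∈ Y j ∪ e j '' ↑S} with hZA
  set ZT : Set V := F' ∪ {x | ∃ j < 9 * m, x ∈ X' j} with hZT
  have hZTC₁ : ZT ⊆ C₁ := by
    rintro x (hx | ⟨j, hj, hx⟩)
    exacts [hC₂ (hF'C₂ hx), hX'.sub j hj hx]
  have hpart : ∀ j ∈ J, Y j ∪ e j '' ↑S ⊆ X j := by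
    rintro j hj x (hx | ⟨s, hs, rfl⟩)
    exacts [hports.subX j hj hx, hports.mem_e j hj s (hSL hs)]
  have hZAC₀ : ZA ⊆ C₀ := by
    rintro x (hx | ⟨j, hj, hx⟩)
    exacts [hC₁ (hC₂ (hL (hWL hx))), hX.sub j (hJlt j hj) (hpart j hj hx)]
  have hanti : Anti G ZA ZT := by
    rintro x (hx | ⟨j, hj, hx⟩) y hy
    · rcases hy with hy | ⟨j, hj, hy⟩
      · exact ⟨fun hh => hWF' x hx y hy (hh ▸ Near.refl _ _), fun hh =>
          hWF' x hx y hy (hh.near.mono (by omega))⟩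
      · exact (hX'.antiD j hj).symm x (hL (hWL hx)) y hy
    · exact hX.antiD j (hJlt j hj) x (hpart j hj hx) y (hZTC₁ hy)
  have hQadj : ∀ p ∈ Q, G.Adj p (c p) := fun p hp => hadjC₁ p (hC₂ (hF'C₂ (hQ hp)))
  have hSadj : ∀ p ∈ S, G.Adj p (c p) := fun p hp => hadjC₁ p (hC₂ (hSC₂ hp))
  have hsys := hE'.union ht.system hanti (by
      rintro p (hp | hp) hpS z hz
      · exact absurd hp hpS
      · rcases hz with hz | ⟨j, hj, hz | ⟨s, hs, rfl⟩⟩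
        · exact fun hh => hWF' z hz p (hQ hp) (hh.near.symm.trans (hQadj p hp).near.symm)
        · exact hYF j hj p (hQ hp).1 z hz
        · exact fun hh => hSF' s hs p (hQ hp) ((((hSadj s hs).near.trans
            (hports.adj_e j hj s (hSL hs)).near).trans
            (hh.near.symm.trans (hQadj p hp).near.symm)).mono (by omega)))
    (fun p hp hp' => (hp' (Or.inl hp)).elim)
  have hSQ : ∀ s ∈ S, s ∉ Q := fun s hs hsQ => hSF' s hs s (hQ hsQ) (Near.refl _ _)
  have hvQ : ∀ i ≤ n + 1, v (i + 1) ∈ Q := ht.mem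
  have hvt : ∀ i ≤ n + 2, v i ≠ t ∧ v i ≠ a := by
    intro i hi
    rcases i with _ | i
    · exact ⟨hst, hsa⟩
    · have := hvQ i (by omega)
      exact ⟨fun hh => hSQ t htS (hh ▸ this), fun hh => hSQ a haS (hh ▸ this)⟩
  set w : ℕ → V := fun i => if i = 0 then t else v (i - 1) with hw
  have hw0 : w 0 = t := rfl
  have hws : ∀ i, w (i + 1) = v i := fun i => rfl
  refine ⟨E' ∪ E, ↑S ∪ Q, w, a, b, ?_, ⟨?_, Or.inl haS, Or.inr ht.mem_u, ?_, ?_, ?_, ?_, ?_,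
    hsys.mono (fun p hp => Or.inr hp) ?_, ?_, ?_, ?_⟩⟩
  · rintro p (hp | hp)
    exacts [hC₁ (hC₂ (hSC₂ hp)), hC₁ (hC₂ (hF'C₂ (hQ hp)))]
  · intro i hi
    rcases i with _ | _ | i
    · exact Or.inl htS
    · exact Or.inl ht.zero
    · exact Or.inr (hvQ i (by omega))
  · rintro p (hp | hp) q (hq | hq) hpq
    · exact hSfar p hp q hq hpq
    · exact hSF' p hp q (hQ hq)
    · exact fun hh => hSF' q hq p (hQ hp) hh.symm
    · exact ht.far p hp q hq hpq
  · intro i hi j hj hij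
    rcases i with _ | i <;> rcases j with _ | j
    · exact absurd rfl hij
    · exact (hvt j (by omega)).1.symm
    · exact (hvt i (by omega)).1
    · exact ht.inj i (by omega) j (by omega) (by omega)
  · intro i hi
    rcases i with _ | i
    · exact hta
    · exact (hvt i (by omega)).2
  · intro i hi
    rcases i with _ | i
    · exact fun hh => hSQ t htS (by rw [← hw0, hh]; exact ht.mem_u)
    · exact ht.ne i (by omega)
  · exact fun hh => hSQ a haS (hh ▸ ht.mem_u)
  · rintro x (hx | hx)
    exacts [hZAC₀ hx, hC₁ (hZTC₁ hx)]
  · exact hear'.mono Set.subset_union_left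
  · intro i hi
    exact (ht.fat i hi).mono Set.subset_union_right
  · exact ht.ear.mono Set.subset_union_right

end Head

/-! ### Closing the path with ears by a link between the ears. -/

section Realize

theorem EarEdge.ends_eq {k : ℕ} (hk : 4 ≤ k) {m : Fin (k - 1) → ℕ} {e f : EarEdge k m}
    (h : e.ends hk = f.ends hk) : e = f ∨ ∃ i j j', e = .path i j ∧ f = .path i j' := by
  rcases e with ⟨i, j⟩ | _ | _ | _ | _ | _ <;> rcases f with ⟨i', j'⟩ | _ | _ | _ | _ | _ <;>
    simp only [EarEdge.ends, Sym2.eq_iff, EarVertex.v.injEq, Fin.mk.injEq, reduceCtorEq, and_false,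
      false_and, or_self, or_false, and_self, and_true, true_and] at h <;>
    first
      | exact Or.inl rfl
      | omega
      | skip
  obtain rfl : i = i' := Fin.ext (by omega)
  exact Or.inr ⟨i, j, j', rfl, rfl⟩

variable {V : Type*} {G : SimpleGraph V}

/-- A levelling with a suitable fat path yields a realization of the fat path with ears. -/
theorem IsEarPath.exists_realizes {l n M : ℕ} {c e : V → V} {C C₀ Y : Set V}
    {E : Set (V × V × Set V)} {P : Set V} {w : ℕ → V} {a b : V}
    (h : IsEarPath G l M n c E P C₀ w a b) (hP : P ⊆ C₀) (hlev : Levelling G C C₀ c e Y)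
    (hk : 4 ≤ n + 4) (m : Fin (n + 4 - 1) → ℕ) (hm : ∀ i, m i ≤ M) :
    ∃ b I, Realizes G l (fatPathWithEars (n + 4) hk m) b I := by
  classical
  -- the link between the two ears
  have hconn : Conn G (({e a, e b} ∪ Y) ∪ {c a, c b}) (c a) (c b) := by
    obtain ⟨x, hx, hx'⟩ := hlev.touch a (hP h.mem_a)
    obtain ⟨y, hy, hy'⟩ := hlev.touch b (hP h.mem_b)
    have h1 : Conn G (({e a, e b} ∪ Y) ∪ {c a, c b}) (c a) x :=
      (Conn.of_adj (hlev.adj' a (hP h.mem_a)) (by simp) (by simp)).trans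
        (Conn.of_adj hx' (by simp) (Or.inl (Or.inr hx)))
    have h2 : Conn G (({e a, e b} ∪ Y) ∪ {c a, c b}) (c b) y :=
      (Conn.of_adj (hlev.adj' b (hP h.mem_b)) (by simp) (by simp)).trans
        (Conn.of_adj hy' (by simp) (Or.inl (Or.inr hy)))
    exact (h1.trans ((hlev.conn.2 x hx y hy).mono fun v hv => Or.inl (Or.inr hv))).trans h2.symm
  have hadj : ∀ p ∈ P, G.Adj p (c p) := fun p hp => hlev.adj p (hP hp)
  have hfar := h.far
  obtain ⟨I₀, hI₀, hI₀'⟩ := exists_link hconn (not_near_label (hadj a h.mem_a) (hadj b h.mem_b)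
    fun hh => hfar a h.mem_a b h.mem_b h.ne (hh.mono (show l + 2 ≤ l + 10 by omega)))
  have hI₀sub : I₀ ⊆ {e a, e b} ∪ Y := fun v hv => (hI₀ hv).1.resolve_right (hI₀ hv).2
  have hav₀ : ∀ p ∈ P, ∀ v ∈ I₀, G.Adj (c p) v → p = a ∨ p = b := by
    have key : ∀ p ∈ P, ∀ q ∈ P, G.Adj (c p) (e q) → p = q := by
      intro p hp q hq hpq
      by_contra hne
      exact hfar p hp q hq hne ((((hadj p hp).near.trans hpq.near).trans
        ((hlev.adj' q (hP hq)).near.symm.trans (hadj q hq).near.symm)).mono (by omega))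
    intro p hp v hv hpv
    rcases hI₀sub hv with (rfl | rfl) | hv
    · exact Or.inl (key p hp a h.mem_a hpv)
    · exact Or.inr (key p hp b h.mem_b hpv)
    · exact absurd hpv (hlev.not_adj p (hP hp) v hv)
  have hZanti : Anti G C₀ ({e a, e b} ∪ Y) := by
    rintro x hx y ((rfl | rfl) | hy)
    · exact hlev.anti_e x hx _ ⟨a, hP h.mem_a, rfl⟩
    · exact hlev.anti_e x hx _ ⟨b, hP h.mem_b, rfl⟩
    · exact hlev.antiY x hx y hy
  have hsys := h.system.union ((isSystem_singleton hI₀' hav₀).mono subset_rfl hI₀sub) hZanti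
    (fun p hp hp' => absurd hp hp') (fun p hp hp' => absurd hp hp')
  set E' := E ∪ {(a, b, I₀)} with hE'
  -- Interiors contain no labels: `c p` is adjacent to `e p`, which is anticomplete to `C₀`, and to
  -- `p`, which is anticomplete to the lower levels.
  have hcZ : ∀ p ∈ P, c p ∉ C₀ ∪ ({e a, e b} ∪ Y) := by
    rintro p hp (hc | hc)
    · exact (hlev.anti_e _ hc _ ⟨p, hP hp, rfl⟩).2 (hlev.adj' p (hP hp))
    · exact (hZanti p (hP hp) _ hc).2 (hadj p hp)
  let pt : EarVertex (n + 4) → V := fun x => match x with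
    | .v i => w i
    | .a => a
    | .b => b
  have hptP : ∀ x, pt x ∈ P := by
    rintro (i | _ | _)
    exacts [h.mem i (by have := i.2; omega), h.mem_a, h.mem_b]
  have hptinj : Function.Injective pt := by
    rintro (i | _ | _) (j | _ | _) hij
    · by_contra hne
      exact h.inj i (by have := i.2; omega) j (by have := j.2; omega)
        (fun hh => hne (by rw [Fin.ext hh])) hij
    · exact absurd hij (h.ne_a i (by have := i.2; omega))
    · exact absurd hij (h.ne_b i (by have := i.2; omega))
    · exact absurd hij.symm (h.ne_a j (by have := j.2; omega))
    · rfl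
    · exact absurd hij h.ne
    · exact absurd hij.symm (h.ne_b j (by have := j.2; omega))
    · exact absurd hij.symm h.ne
    · rfl
  have hfat : ∀ i : Fin (n + 4 - 1), ∃ (x y : V) (F : ℕ → Set V),
      s(x, y) = s(w i, w (i + 1)) ∧
      (∀ j < M, (x, y, F j) ∈ E) ∧ ∀ j < M, ∀ j' < M, j ≠ j' → Anti G (F j) (F j') := by
    rintro ⟨i, hi⟩
    -- The first and the last fat edge belong to the ears; the first is recorded there with its ends
    -- reversed.
    rcases i with _ | i
    · obtain ⟨F, hF, hF'⟩ := h.ear.1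
      exact ⟨_, _, F, Sym2.eq_swap, hF, hF'⟩
    · rcases Nat.lt_or_ge n i with h1 | h1
      · obtain rfl : i = n + 1 := by omega
        obtain ⟨F, hF, hF'⟩ := h.ear'.1
        exact ⟨_, _, F, rfl, hF, hF'⟩
      · obtain ⟨F, hF, hF'⟩ := h.fat i h1
        exact ⟨_, _, F, rfl, hF, hF'⟩
  choose x y F hxy hF hFanti using hfat
  obtain ⟨I₁, hI₁⟩ := h.ear.2.2
  obtain ⟨I₂, hI₂⟩ := h.ear.2.1
  obtain ⟨I₃, hI₃⟩ := h.ear'.2.1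
  obtain ⟨I₄, hI₄⟩ := h.ear'.2.2
  let I : EarEdge (n + 4) m → Set V := fun f => match f with
    | .path i j => F i j
    | .aFirst => I₁
    | .aSecond => I₂
    | .bPenultimate => I₃
    | .bLast => I₄
    | .ab => I₀
  have hI : ∀ f, ∃ x y, s(x, y) = (f.ends hk).map pt ∧ (x, y, I f) ∈ E' := by
    rintro (⟨i, j⟩ | _ | _ | _ | _ | _)
    · exact ⟨x i, y i, hxy i, Or.inl (hF i j (j.2.trans_le (hm i)))⟩
    · exact ⟨_, _, Sym2.eq_swap, Or.inl hI₁⟩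
    · exact ⟨_, _, Sym2.eq_swap, Or.inl hI₂⟩
    · exact ⟨_, _, Sym2.eq_swap, Or.inl hI₃⟩
    · exact ⟨_, _, Sym2.eq_swap, Or.inl hI₄⟩
    · exact ⟨_, _, rfl, Or.inr rfl⟩
  choose s t hst hI using hI
  have hcfar : ∀ x y, x ≠ y → c (pt x) ≠ c (pt y) ∧ ¬ G.Adj (c (pt x)) (c (pt y)) := by
    intro x y hne
    have h1 := hfar _ (hptP x) _ (hptP y) fun hh => hne (hptinj hh)
    have h2 := not_near_label (l := 1) (hadj _ (hptP x)) (hadj _ (hptP y))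
      fun hh => h1 (hh.mono (by omega))
    exact ⟨fun hh => h2 (hh ▸ Near.refl _ _), fun hh => h2 hh.near⟩
  -- The branch vertices are the labels of the chosen points, not the points themselves.
  refine ⟨fun x => c (pt x), I, ⟨fun f x y hf => ?_, fun f g hfg => ?_, fun x f v hv => ?_,
    hcfar⟩⟩
  · have hf : f.ends hk = s(x, y) := hf
    have h1 := hst f
    rw [hf, Sym2.map_mk] at h1
    have h2 := hsys.link _ _ _ (hI f)
    rcases Sym2.eq_iff.1 h1 with ⟨h3, h4⟩ | ⟨h3, h4⟩
    · rw [h3, h4] at h2; exact h2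
    · rw [h3, h4] at h2; exact h2.symm
  · by_cases hne : (s f, t f, I f) = (s g, t g, I g)
    · have h1 : (f.ends hk).map pt = (g.ends hk).map pt := by
        rw [← hst f, ← hst g, (Prod.mk.inj hne).1, (Prod.mk.inj (Prod.mk.inj hne).2).1]
      rcases EarEdge.ends_eq hk (Sym2.map.injective hptinj h1) with h2 | ⟨i, j, j', rfl, rfl⟩
      · exact absurd h2 hfg
      · exact hFanti i j (j.2.trans_le (hm i)) j' (j'.2.trans_le (hm i))
          fun hh => hfg (by rw [Fin.ext hh])
    · exact hsys.anti _ (hI f) _ (hI g) hne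
  · refine ⟨fun hh => hcZ _ (hptP x) (hh ▸ hsys.sub _ _ _ (hI f) hv), fun hh => ?_⟩
    have h1 := hsys.avoid (pt x) (Or.inl (hptP x)) _ _ _ (hI f) v hv hh
    have h2 : pt x ∈ (f.ends hk).map pt := by
      rw [← hst f, Sym2.mem_iff]
      exact h1
    obtain ⟨x', hx', hxx'⟩ := Sym2.mem_map.1 h2
    obtain rfl := hptinj hxx'
    obtain ⟨y, hy⟩ := Sym2.mem_iff_exists.1 hx'
    exact ⟨y, hy⟩

end Realize

/-! ### The dichotomy on touch bounds and the recursion on the number of types. -/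

section Recursion

theorem Levelling.mono {V : Type*} {G : SimpleGraph V} {C C' C'' : Set V} {c e : V → V} {Y : Set V}
    (h : Levelling G C C' c e Y) (hC : C'' ⊆ C') : Levelling G C C'' c e Y where
  sub := hC.trans h.sub
  adj p hp := h.adj p (hC hp)
  adj' p hp := h.adj' p (hC hp)
  touch p hp := h.touch p (hC hp)
  mem_c p hp := h.mem_c p (hC hp)
  mem_e p hp := h.mem_e p (hC hp)
  subY := h.subY
  conn := h.conn
  antiY := h.antiY.mono hC subset_rfl
  anti_e := h.anti_e.mono hC (Set.image_mono hC)
  not_adj p hp := h.not_adj p (hC hp)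

/-- A set anticomplete to a connected set to which all labels `c p` of its points are attached
is `b`-colourable. -/
def TouchBound {V : Type*} (G : SimpleGraph V) (C : Set V) (c : V → V) (b : ℕ) : Prop :=
  ∀ X ⊆ C, ∀ C' ⊆ C, IsConn G X → Anti G X C' → (∀ p ∈ C', ∃ x ∈ X, G.Adj (c p) x) → Col G C' b

theorem TouchBound.mono {V : Type*} {G : SimpleGraph V} {C C' : Set V} {c : V → V} {b b' : ℕ}
    (h : TouchBound G C c b) (hC : C' ⊆ C) (hb : b ≤ b') : TouchBound G C' c b' :=
  fun X hX D hD h1 h2 h3 => (h X (hX.trans hC) D (hD.trans hC) h1 h2 h3).mono subset_rfl hb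

/-- A levelling adds a new type to private types, up to a set of small chromatic number. -/
theorem PrivateTypes.exists_succ {V : Type*} {G : SimpleGraph V} {C C' Y : Set V} {s b n : ℕ}
    {c : ℕ → V → V} {X : ℕ → Set V} {c' e : V → V} (h : PrivateTypes G C s c X)
    (hb : ∀ i < s, TouchBound G C (c i) b) (hlev : Levelling G C C' c' e Y)
    (hC' : ¬ Col G C' (n + s * b)) : ∃ C₁ ⊆ C', ¬ Col G C₁ n ∧
      ∃ X', PrivateTypes G C₁ (s + 1) (fun i => if i < s then c i else c') X' := by
  classical
  set A : Set V := Y ∪ e '' C' with hA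
  have hAC : A ⊆ C := by
    rintro x (hx | ⟨p, hp, rfl⟩)
    exacts [hlev.subY hx, hlev.mem_e p hp]
  have hAconn : IsConn G A := by
    obtain ⟨y₀, hy₀⟩ := hlev.conn.1
    have key : ∀ x ∈ A, Conn G A x y₀ := by
      rintro x (hx | ⟨p, hp, rfl⟩)
      · exact (hlev.conn.2 x hx y₀ hy₀).mono Set.subset_union_left
      · obtain ⟨y, hy, hy'⟩ := hlev.touch p hp
        exact (Conn.of_adj hy' (Or.inr ⟨p, hp, rfl⟩) (Or.inl hy)).trans
          ((hlev.conn.2 y hy y₀ hy₀).mono Set.subset_union_left)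
    exact ⟨⟨y₀, Or.inl hy₀⟩, fun x hx y hy => (key x hx).trans (key y hy).symm⟩
  have hAanti : Anti G C' A := by
    rintro x hx y (hy | hy)
    exacts [hlev.antiY x hx y hy, hlev.anti_e x hx y hy]
  -- Points whose old label of type `i` touches the new connected set `A`. The touch bounds make the
  -- deletion of all of them cost `s * b` colours. In the other direction nothing is to be deleted:
  -- new labels lie in `C`, which is anticomplete to the old sets.
  set Z : ℕ → Set V := fun i => {p ∈ C' | ∃ x ∈ A, G.Adj (c i p) x} with hZ
  have hZcol := col_biUnion (G := G) (Finset.range s) Z (n := b) fun i hi =>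
    hb i (Finset.mem_range.1 hi) A hAC (Z i) (fun p hp => hlev.sub hp.1) hAconn
      (hAanti.symm.mono subset_rfl fun p hp => hp.1) fun p hp => hp.2
  rw [Finset.card_range] at hZcol
  refine ⟨_, Set.sdiff_subset, not_col_diff hC' hZcol, fun i => if i < s then X i else A, ?_⟩
  have hnot : ∀ i < s, ∀ p ∈ C' \ {v | ∃ i ∈ Finset.range s, v ∈ Z i}, ∀ x ∈ A,
      ¬ G.Adj (c i p) x := fun i hi p hp x hx hadj =>
    hp.2 ⟨i, Finset.mem_range.2 hi, hp.1, x, hx, hadj⟩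
  have hCC : ∀ p ∈ C' \ {v | ∃ i ∈ Finset.range s, v ∈ Z i}, p ∈ C := fun p hp => hlev.sub hp.1
  refine ⟨fun i hi => ?_, fun i hi p hp => ?_, fun i hi p hp => ?_, fun i hi p hp => ?_,
    fun i hi j hj hij => ?_, fun i hi j hj hij p hp x hx => ?_⟩
  · by_cases h1 : i < s
    · simpa only [if_pos h1] using h.conn i h1
    · simpa only [if_neg h1] using hAconn
  · by_cases h1 : i < s
    · simpa only [if_pos h1] using h.anti i h1 p (hCC p hp)
    · simpa only [if_neg h1] using hAanti p hp.1
  · by_cases h1 : i < s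
    · simpa only [if_pos h1] using h.adj i h1 p (hCC p hp)
    · simpa only [if_neg h1] using hlev.adj p hp.1
  · by_cases h1 : i < s
    · simpa only [if_pos h1] using h.touch i h1 p (hCC p hp)
    · simp only [if_neg h1]
      exact ⟨e p, Or.inr ⟨p, hp.1, rfl⟩, hlev.adj' p hp.1⟩
  · by_cases h1 : i < s <;> by_cases h2 : j < s
    · simpa only [if_pos h1, if_pos h2] using h.anti' i h1 j h2 hij
    · simpa only [if_pos h1, if_neg h2] using ((h.anti i h1).mono hAC subset_rfl).symm
    · simpa only [if_neg h1, if_pos h2] using (h.anti j h2).mono hAC subset_rfl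
    · omega
  · by_cases h1 : i < s <;> by_cases h2 : j < s
    · simp only [if_pos h1, if_pos h2] at hx ⊢
      exact h.not_adj i h1 j h2 hij p (hCC p hp) x hx
    · simp only [if_pos h1, if_neg h2] at hx ⊢
      exact hnot i h1 p hp x hx
    · simp only [if_neg h1, if_pos h2] at hx ⊢
      exact (h.anti j h2 _ (hlev.mem_c p hp.1) x hx).2
    · omega

variable {n : ℕ} (hk : 4 ≤ n + 4) (m : Fin (n + 4 - 1) → ℕ)

instance (k : ℕ) : Finite (EarVertex k) := by
  refine Finite.of_surjective (α := Option (Option (Fin k)))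
    (fun x => match x with
      | none => .a
      | some none => .b
      | some (some i) => .v i) ?_
  rintro (i | _ | _)
  exacts [⟨some (some i), rfl⟩, ⟨none, rfl⟩, ⟨some none, rfl⟩]

instance (k : ℕ) (m : Fin (k - 1) → ℕ) : Finite (EarEdge k m) := by
  refine Finite.of_surjective (α := (Σ i, Fin (m i)) ⊕ Fin 5)
    (fun x => match x with
      | .inl x => .path x.1 x.2
      | .inr 0 => .aFirst
      | .inr 1 => .aSecond
      | .inr 2 => .bPenultimate
      | .inr 3 => .bLast
      | .inr 4 => .ab) ?_
  rintro (⟨i, j⟩ | _ | _ | _ | _ | _)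
  exacts [⟨.inl ⟨i, j⟩, rfl⟩, ⟨.inr 0, rfl⟩, ⟨.inr 1, rfl⟩, ⟨.inr 2, rfl⟩, ⟨.inr 3, rfl⟩,
    ⟨.inr 4, rfl⟩]

theorem fatPathWithEars_not_isLink_self {k : ℕ} (hk : 4 ≤ k) (m : Fin (k - 1) → ℕ)
    (e : EarEdge k m) (x : EarVertex k) : ¬ (fatPathWithEars k hk m).IsLink e x x := by
  intro h
  have h : e.ends hk = s(x, x) := h
  have h' : (e.ends hk).IsDiag := h ▸ Sym2.mk_isDiag_iff.2 rfl
  rcases e with ⟨i, j⟩ | _ | _ | _ | _ | _ <;>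
    simp [EarEdge.ends, Sym2.mk_isDiag_iff] at h'

/-- Sets of large chromatic number with `s` private types of touch bound `b` contain
realizations of the fat path with ears. -/
def Wins (l τ s b : ℕ) : Prop :=
  ∃ N : ℕ, ∀ (V : Type) [Finite V] (G : SimpleGraph V), Balls G (4 * l + 50) τ →
    ∀ (C : Set V) (c : ℕ → V → V) (X : ℕ → Set V), PrivateTypes G C s c X →
    (∀ i < s, TouchBound G C (c i) b) → ¬ Col G C N →
    ∃ b I, Realizes G l (fatPathWithEars (n + 4) hk m) b I

/-- A levelling supplies a new type `c'`. If `attach` holds at all scales, the path with ears is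
built directly. If it fails at scale `r` on a set `D`, the failure says precisely that `c'` has
touch bound `K r` on `D`, and `D` is large enough to win with `s + 1` types. -/
theorem wins_of_wins_succ {l τ s : ℕ} (h : ∀ b, Wins hk m l τ (s + 1) b) (b : ℕ) :
    Wins hk m l τ s b := by
  classical
  choose f hf using h
  obtain ⟨M, hM⟩ : ∃ M, ∀ i, m i ≤ M := ⟨Finset.univ.sup m, fun i => Finset.le_sup (Finset.mem_univ i)⟩
  set B := (4 * M + 20) * τ + 1 + 2 ^ (2 * (3 * M)) + 2 ^ (2 * (2 * M + 4)) with hB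
  have hB₁ : 2 ^ (2 * (3 * M)) ≤ B := (Nat.le_add_left _ _).trans (Nat.le_add_right _ _)
  have hB₂ : 2 ^ (2 * (2 * M + 4)) ≤ B := Nat.le_add_left _ _
  have hB₀ : (4 * M + 20) * τ < B :=
    (Nat.le_add_right _ _).trans (Nat.le_add_right ((4 * M + 20) * τ + 1 + _) _)
  set R := n * (9 * M + 2) + (2 * M + 4) + 2 + 9 * M + 2 * (2 * M + 4) with hR
  -- The colours needed with `s + 1` types depend on the touch bound, so `K (r + 1)` has to dominate
  -- `f` at the bound `K r`; the other term provides the growth required by `IsScale`.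
  let K : ℕ → ℕ := fun r => Nat.rec B (fun _ x => max (f (max b x)) (B * (x + 1))) r
  have hK : ∀ r, K (r + 1) = max (f (max b (K r))) (B * (K r + 1)) := fun r => rfl
  refine ⟨2 * (K R + s * b + τ), fun V _ G hτ C c X hX hb hC => ?_⟩
  obtain ⟨C', c', e, Y, hlev, hC'⟩ := exists_levelling (hτ.mono (by omega)) (Nat.le_add_left _ _) hC
  obtain ⟨C₁, hC₁, hC₁col, X', hX'⟩ := hX.exists_succ hb hlev (n := K R)
    fun hh => hC' (hh.mono subset_rfl (Nat.le_add_right _ _))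
  by_cases hatt : ∀ r < R, ∀ D ⊆ C₁, ¬ Col G D (K (r + 1)) → ∃ X ⊆ D, ∃ D' ⊆ D, IsConn G X ∧
      Anti G X D' ∧ (∀ p ∈ D', ∃ x ∈ X, G.Adj (c' p) x) ∧ ¬ Col G D' (K r)
  · have hscale : IsScale G c' C₁ B R K :=
      ⟨hatt, fun r => (hK r).symm ▸ le_max_right _ _, le_rfl⟩
    have hlev' := hlev.mono hC₁
    obtain ⟨E, P, w, a, d, hP, hpath⟩ := hscale.exists_isEarPath (l := l) (m := M) (n := n) (τ := τ)
      hlev'.adj hτ hB₀ hB₁ hB₂ le_rfl hC₁col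
    exact hpath.exists_realizes hP hlev' hk m hM
  · push Not at hatt
    obtain ⟨r, -, D, hD, hDcol, hDtouch⟩ := hatt
    refine hf (max b (K r)) V G hτ D _ X' (hX'.mono hD) (fun i hi => ?_)
      fun hh => hDcol (hh.mono subset_rfl ((hK r).symm ▸ le_max_left _ _))
    by_cases his : i < s
    · simp only [if_pos his]
      exact (hb i his).mono (hD.trans (hC₁.trans hlev.sub)) (le_max_left _ _)
    · simp only [if_neg his]
      exact fun A hA D' hD' h1 h2 h3 => (hDtouch A hA D' hD' h1 h2 h3).mono subset_rfl
        (le_max_right _ _)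

/-- Downward induction on the number of types. With `τ` times as many types as edges,
`PrivateTypes.exists_realizes` applies whatever the touch bound is. -/
theorem wins_zero (l τ : ℕ) : Wins hk m l τ 0 0 := by
  set t := τ * Nat.card (EarEdge (n + 4) m) with ht
  have key : ∀ d s, s + d = t → ∀ b, Wins hk m l τ s b := by
    intro d
    induction d with
    | zero =>
      rintro s rfl b
      refine ⟨_, fun V _ G hτ C c X hX _ hC => hX.exists_realizes (l := l) (τ := τ) _
        (fatPathWithEars_not_isLink_self hk m) (hτ.mono (by omega)) hC⟩
    | succ d ih => exact fun s hs b => wins_of_wins_succ hk m (ih (s + 1) (by omega)) b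
  exact key t 0 (by omega) 0

theorem Balls.of_ballChromaticNumber_le {V : Type} {G : SimpleGraph V} {ρ τ : ℕ}
    (h : ballChromaticNumber ρ G ≤ τ) : Balls G ρ τ := by
  classical
  intro v
  have h1 : (G.induce {w | G.edist v w ≤ ρ}).chromaticNumber ≤ τ :=
    (le_iSup (fun v => (G.induce {w | G.edist v w ≤ ρ}).chromaticNumber) v).trans h
  obtain ⟨f⟩ := SimpleGraph.chromaticNumber_le_iff_colorable.1 h1
  have hsub : ∀ w ∈ {w | Near G ρ v w}, w ∈ {w | G.edist v w ≤ ρ} := by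
    rintro w ⟨p, hp⟩
    exact (SimpleGraph.Walk.edist_le p).trans (by exact_mod_cast hp)
  refine ⟨fun w => if hw : w ∈ {w | G.edist v w ≤ ρ} then f ⟨w, hw⟩ else 0, fun w hw => ?_,
    fun u hu w hw huw => ?_⟩
  · beta_reduce
    rw [dif_pos (hsub w hw)]
    exact (f _).2
  · beta_reduce
    rw [dif_pos (hsub u hu), dif_pos (hsub w hw)]
    exact fun hh => f.valid (v := ⟨u, hsub u hu⟩) (w := ⟨w, hsub w hw⟩) huw (Fin.ext hh)

theorem Col.chromaticNumber_le {V : Type} {G : SimpleGraph V} {N : ℕ} (h : Col G Set.univ N) :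
    G.chromaticNumber ≤ N := by
  obtain ⟨f, h1, h2⟩ := h
  exact SimpleGraph.chromaticNumber_le_iff_colorable.2
    ⟨SimpleGraph.Coloring.mk (fun v => (⟨f v, h1 v trivial⟩ : Fin N)) fun {u v} huv hh =>
      h2 u trivial v trivial huv (Fin.mk.inj_iff.1 hh)⟩

end Recursion

theorem theorem9p1 (k : ℕ) (hk : 4 ≤ k) (m : Fin (k - 1) → ℕ) (hm : ∀ i, 0 < m i) :
    Widespread (fatPathWithEars k hk m) := by
  obtain ⟨n, rfl⟩ : ∃ n, k = n + 4 := ⟨k - 4, by omega⟩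
  rintro J ⟨M⟩ κ
  have := J.finite
  have := Fintype.ofFinite J.V
  -- Every path of `J` is shorter than `l = Nat.card J.V`. The recursion starts from the whole
  -- vertex set with no types, where all conditions on types are vacuous.
  refine ⟨4 * Nat.card J.V + 50, fun C _ ⟨τ, hτ⟩ hfree => ?_⟩
  obtain ⟨N, hN⟩ := wins_zero hk m (Nat.card J.V) τ
  refine ⟨N, fun G hG => ?_⟩
  by_contra hlt
  have := G.finite
  obtain ⟨b, I, hI⟩ := hN G.V G.graph (.of_ballChromaticNumber_le (hτ G hG)) Set.univ
    (fun _ => id) (fun _ => ∅)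
    ⟨fun i hi => absurd hi (Nat.not_lt_zero i), fun i hi => absurd hi (Nat.not_lt_zero i),
      fun i hi => absurd hi (Nat.not_lt_zero i), fun i hi => absurd hi (Nat.not_lt_zero i),
      fun i hi => absurd hi (Nat.not_lt_zero i), fun i hi => absurd hi (Nat.not_lt_zero i)⟩
    (fun i hi => absurd hi (Nat.not_lt_zero i)) fun hh => hlt hh.chromaticNumber_le
  obtain ⟨S, hS⟩ := hI.exists_isSubdivision (fatPathWithEars_not_isLink_self hk m) M fun e => by
    rw [Nat.card_eq_fintype_card]
    exact (M.isPath e).length_lt.le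
  exact (hfree G hG).1 S hS
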